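/- Let $n\ge 1$, and let $a=(a_1,\dots,a_d)$ and $b=(b_1,\dots,b_d)$ be $d$-tuples of permutations, each of which generates a transitive subgroup of the symmetric group $S_n$. Call $a$ and $b$ simultaneously conjugate if there is $\tau\in S_n$ with $b_j=\tau^{-1}a_j\tau$ for all $j=1,\dots,d$. Let $\lambda$ be the smallest number for which there is an index $j$ such that $a_j$ and $b_j$ both have precisely $\lambda$ cycles in their cycle decompositions (fixed points count as cycles). Then one can test whether $a$ and $b$ are simultaneously conjugate in $O((d+\lambda)\,n\log n)$ time, using $O((d+\log n)\,n)$ space (where, for $n=1$, the factor $\log n$ in the time bound is read as $1$). More precisely, there are a single program for a unit-cost random access machine with words of $w$ bits and a constant $C$ such that, for all $n\ge1$, $d$ and $w$ with $n,d<2^w$ and all such tuples $a,b$ (given as tables of values), the program halts with the correct answer and, whenever $\lambda$ is defined (that is, whenever $a_j$ and $b_j$ have equally many cycles for some $j$), it does so within $C\,(d+\lambda)\,n\,(\lfloor\log_2 n\rfloor+1)$ steps, using at most $C\,(d+\lfloor\log_2 n\rfloor)\,n$ words of memory. An address consists of a constant number of words. -/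

import Mathlib

/-! ### Programs for a unit-cost random access machine with `b`-bit words

The machine has registers and a random access memory, all of whose cells hold one `b`-bit word,
that is, a natural number below `2 ^ b`.  An address consists of a constant number of words: a
segment number `A`, written literally in the program, and two words `i`, `j`; the cell is written
`A[i, j]`.  A program is one fixed finite text that does not depend on the input or on `b`. -/

namespace WordRAM

/-- The arithmetic and comparison instructions on words. -/
inductive Op where
  | add | sub | mul | div | mod | eq | lt

/-- The result of an instruction on words: sums and products are reduced modulo `2 ^ b`,
subtraction is cut off at `0`, comparisons return `1` for true and `0` for false. -/
def Op.eval (b : ℕ) (o : Op) (x y : ℕ) : ℕ :=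
  (match o with
    | .add => x + y
    | .sub => x - y
    | .mul => x * y
    | .div => x / y
    | .mod => x % y
    | .eq => if x = y then 1 else 0
    | .lt => if x < y then 1 else 0) % 2 ^ b

/-- Programs. Registers `x`, `y`, `z` and segments `A` are referred to by number. -/
inductive Cmd where
  /-- do nothing -/
  | skip
  /-- `x := c` for a literal `c` -/
  | const (x c : ℕ)
  /-- `x := y o z` -/
  | op (o : Op) (x y z : ℕ)
  /-- `x := A[i, j]`, where `i`, `j` are the contents of the registers `ri`, `rj` -/
  | load (x A ri rj : ℕ)
  /-- `A[i, j] := x`, where `i`, `j` are the contents of the registers `ri`, `rj` -/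
  | store (A ri rj x : ℕ)
  /-- `p; q` -/
  | seq (p q : Cmd)
  /-- if register `x` is nonzero then `p` else `q` -/
  | ite (x : ℕ) (p q : Cmd)
  /-- while register `x` is nonzero do `p` -/
  | loop (x : ℕ) (p : Cmd)

/-- The registers that occur in a program. -/
def Cmd.regs : Cmd → Finset ℕ
  | .skip => ∅
  | .const x _ => {x}
  | .op _ x y z => {x, y, z}
  | .load x _ ri rj => {x, ri, rj}
  | .store _ ri rj x => {ri, rj, x}
  | .seq p q => p.regs ∪ q.regs
  | .ite x p q => {x} ∪ p.regs ∪ q.regs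
  | .loop x p => {x} ∪ p.regs

/-- The memory segments that occur in a program. -/
def Cmd.segments : Cmd → Finset ℕ
  | .skip => ∅
  | .const _ _ => ∅
  | .op _ _ _ _ => ∅
  | .load _ A _ _ => {A}
  | .store A _ _ _ => {A}
  | .seq p q => p.segments ∪ q.segments
  | .ite _ p q => p.segments ∪ q.segments
  | .loop _ p => p.segments

/-- The contents of the registers and of the memory. -/
structure State where
  reg : ℕ → ℕ
  mem : ℕ → ℕ → ℕ → ℕ

/-- Write `v` to register `x`. -/
def State.setReg (s : State) (x v : ℕ) : State :=
  { s with reg := Function.update s.reg x v }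

/-- Write `v` to the cell `A[i, j]`. -/
def State.setMem (s : State) (A i j v : ℕ) : State :=
  { s with mem := fun A' i' j' => if A' = A ∧ i' = i ∧ j' = j then v else s.mem A' i' j' }

/-- `Exec b R K p s t s'`: on the machine with `b`-bit words, the program `p` started in the state
`s` halts in the state `s'` after `t` steps, and every access to a segment `A` during this run
is to a cell `A[i, j]` with `i < R A` and `j < K A`.  Every instruction and every evaluation of the
condition of a branch or of a loop is one step. -/
inductive Exec (b : ℕ) (R K : ℕ → ℕ) : Cmd → State → ℕ → State → Prop
  | skip (s : State) : Exec b R K .skip s 1 s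
  | const (x c : ℕ) (s : State) : Exec b R K (.const x c) s 1 (s.setReg x (c % 2 ^ b))
  | op (o : Op) (x y z : ℕ) (s : State) :
      Exec b R K (.op o x y z) s 1 (s.setReg x (o.eval b (s.reg y) (s.reg z)))
  | load (x A ri rj : ℕ) (s : State) (hi : s.reg ri < R A) (hj : s.reg rj < K A) :
      Exec b R K (.load x A ri rj) s 1 (s.setReg x (s.mem A (s.reg ri) (s.reg rj)))
  | store (A ri rj x : ℕ) (s : State) (hi : s.reg ri < R A) (hj : s.reg rj < K A) :
      Exec b R K (.store A ri rj x) s 1 (s.setMem A (s.reg ri) (s.reg rj) (s.reg x))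
  | seq {p q : Cmd} {s s₁ s₂ : State} {t₁ t₂ : ℕ} (hp : Exec b R K p s t₁ s₁)
      (hq : Exec b R K q s₁ t₂ s₂) : Exec b R K (.seq p q) s (t₁ + t₂) s₂
  | iteTrue {x : ℕ} {p q : Cmd} {s s₁ : State} {t : ℕ} (hx : s.reg x ≠ 0)
      (hp : Exec b R K p s t s₁) : Exec b R K (.ite x p q) s (t + 1) s₁
  | iteFalse {x : ℕ} {p q : Cmd} {s s₁ : State} {t : ℕ} (hx : s.reg x = 0)
      (hq : Exec b R K q s t s₁) : Exec b R K (.ite x p q) s (t + 1) s₁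
  | loopTrue {x : ℕ} {p : Cmd} {s s₁ s₂ : State} {t₁ t₂ : ℕ} (hx : s.reg x ≠ 0)
      (hp : Exec b R K p s t₁ s₁) (hl : Exec b R K (.loop x p) s₁ t₂ s₂) :
      Exec b R K (.loop x p) s (t₁ + t₂ + 1) s₂
  | loopFalse {x : ℕ} {p : Cmd} {s : State} (hx : s.reg x = 0) :
      Exec b R K (.loop x p) s 1 s

/-- The number of words reserved for the program `p` when each segment `A` gets the cells
`A[i, j]` with `i < R A` and `j < K A`: the registers and all segments that occur in `p`. -/
def space (p : Cmd) (R K : ℕ → ℕ) : ℕ :=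
  p.regs.card + ∑ A ∈ p.segments, R A * K A

end WordRAM

/-- The number of cycles of a permutation, fixed points counted as cycles of length one. -/
def numCycles {n : ℕ} (σ : Equiv.Perm (Fin n)) : ℕ := σ.partition.parts.card

/-- The permutations `σ 0, …, σ (d - 1)` generate a transitive subgroup of the symmetric group. -/
def GeneratesTransitive {n d : ℕ} (σ : Fin d → Equiv.Perm (Fin n)) : Prop :=
  MulAction.IsPretransitive (Subgroup.closure (Set.range σ)) (Fin n)

/-- Some permutation `τ` satisfies `τ⁻¹ (σ j) τ = ρ j` for all `j`. -/
def SimConj {n d : ℕ} (σ ρ : Fin d → Equiv.Perm (Fin n)) : Prop :=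
  ∃ τ : Equiv.Perm (Fin n), ∀ j, ρ j = τ⁻¹ * σ j * τ

/-- The tuple `σ` as a table: row `j`, column `i` holds the image of `i` under `σ j`. -/
def permTable {n d : ℕ} (σ : Fin d → Equiv.Perm (Fin n)) (j i : ℕ) : ℕ :=
  if h : j < d ∧ i < n then (σ ⟨j, h.1⟩ ⟨i, h.2⟩ : ℕ) else 0

/-- The initial state on input `σ`, `ρ`: register `0` holds `n`, register `1` holds `d`, segment `0`
holds the table of `σ`, segment `1` holds the table of `ρ`, and everything else is zero. -/
def inputState {n d : ℕ} (σ ρ : Fin d → Equiv.Perm (Fin n)) : WordRAM.State where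
  reg x := if x = 0 then n else if x = 1 then d else 0
  mem A j i := if A = 0 then permTable σ j i else if A = 1 then permTable ρ j i else 0

/-! Because both groups are transitive, an equivariant map between the two systems is automatically
bijective, so simultaneous conjugacy amounts to the existence of an equivariant map (`simConj_iff`).
Such a map is determined by the image of one point. Trying all `n` images would cost a factor `n`;
discarding candidate points in bulk reduces this to about `log n` trials.

Let `J` be an index with the least common number `λ` of cycles. A search of `A` from `x` arranges
the points in a tree of at most `λ` cycles of `A J`. Each point thereby becomes a word in the
generators applied to `x`, encoded by the tree and by an offset on its cycle. The same words applied
to `y` in `B` give `ta`, the only map sending `x` to `y` that can be equivariant. If `ta` is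
equivariant, the answer is yes. Otherwise some relation `A j u = v`, read as a relation between
words, holds at the root `x` in `A` and fails at the root `y` in `B` (`Explored.related_left`,
`Explored.not_related_right`).

Equivariant maps preserve the validity of such a relation at every root
(`IsEquivariant.related_iff`). The relation is therefore evaluated at all candidate roots of both
systems. If the numbers of roots where it holds differ, there is no equivariant map
(`Matching.card_eq`). If they agree, both candidate sets split into two nonempty matched parts, and
keeping the smaller one loses no solution (`runs_shrink`).

Halving leaves `O(log n)` searches of cost `O((d + λ) n)` each. Evaluating a relation at one root
costs only `O(λ log n)`, since offsets are applied through tables of the `2 ^ i`-th iterates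
(`runs_locate`), and the numbers of candidates form a geometric sum of order `n` (`runs_rounds`).
The same doubling, applied to minima along orbits, counts the cycles of all `d` permutations in `O(d
n log n)`; these tables need `O(log n)` rows of length `n`. -/

namespace WordRAM

/-! ### Weakest preconditions with running times -/

infixr:60 "⨟" => Cmd.seq

/-- The program `p` started in `s` halts after `t` steps in a state `s'` with `Q t s'`, accessing
only cells with row below `r` and column below `m`. -/
def Runs (b r m : ℕ) (p : Cmd) (s : State) (Q : ℕ → State → Prop) : Prop :=
  ∃ t s', Exec b (fun _ => r) (fun _ => m) p s t s' ∧ Q t s'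

/-- Whether a program may write to a register. -/
def Cmd.writesReg : Cmd → ℕ → Bool
  | .skip, _ => false
  | .const x _, y => y == x
  | .op _ x _ _, y => y == x
  | .load x _ _ _, y => y == x
  | .store _ _ _ _, _ => false
  | .seq p q, y => p.writesReg y || q.writesReg y
  | .ite _ p q, y => p.writesReg y || q.writesReg y
  | .loop _ p, y => p.writesReg y

/-- Whether a program may write to a memory segment. -/
def Cmd.writesSeg : Cmd → ℕ → Bool
  | .skip, _ => false
  | .const _ _, _ => false
  | .op _ _ _ _, _ => false
  | .load _ _ _ _, _ => false
  | .store A _ _ _, B => B == A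
  | .seq p q, y => p.writesSeg y || q.writesSeg y
  | .ite _ p q, y => p.writesSeg y || q.writesSeg y
  | .loop _ p, y => p.writesSeg y

@[simp] theorem State.reg_setReg (s : State) (x v y : ℕ) :
    (s.setReg x v).reg y = if y = x then v else s.reg y := by
  simp [State.setReg, Function.update_apply]

@[simp] theorem State.mem_setReg (s : State) (x v : ℕ) : (s.setReg x v).mem = s.mem := rfl

@[simp] theorem State.reg_setMem (s : State) (A i j v : ℕ) : (s.setMem A i j v).reg = s.reg := rfl

@[simp] theorem State.mem_setMem (s : State) (A i j v A' i' j' : ℕ) :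
    (s.setMem A i j v).mem A' i' j' = if A' = A ∧ i' = i ∧ j' = j then v else s.mem A' i' j' := rfl

/-- The states agree on everything that `p` does not write to. -/
structure Frame (p : Cmd) (s s' : State) : Prop where
  reg : ∀ y, p.writesReg y = false → s'.reg y = s.reg y
  mem : ∀ A, p.writesSeg A = false → s'.mem A = s.mem A

theorem Frame.refl (p : Cmd) (s : State) : Frame p s s := ⟨fun _ _ => rfl, fun _ _ => rfl⟩

theorem Frame.trans {p : Cmd} {s s₁ s₂ : State} (h : Frame p s s₁) (h' : Frame p s₁ s₂) :
    Frame p s s₂ :=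
  ⟨fun y hy => (h'.reg y hy).trans (h.reg y hy), fun A hA => (h'.mem A hA).trans (h.mem A hA)⟩

theorem Frame.mono {p q : Cmd} {s s' : State} (h : Frame p s s')
    (hr : ∀ y, q.writesReg y = false → p.writesReg y = false)
    (hm : ∀ y, q.writesSeg y = false → p.writesSeg y = false) : Frame q s s' :=
  ⟨fun y hy => h.reg y (hr y hy), fun A hA => h.mem A (hm A hA)⟩

/-- What a program can write to is decidable from its text. For concrete programs the side
conditions are thus closed computations, and loop invariants need only mention what changes. -/
theorem Exec.frame {b : ℕ} {R K : ℕ → ℕ} {p : Cmd} {s s' : State} {t : ℕ}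
    (h : Exec b R K p s t s') : Frame p s s' := by
  induction h with
  | skip s => exact Frame.refl _ _
  | const x c s =>
    exact ⟨fun y hy => by simp_all [Cmd.writesReg], fun A _ => rfl⟩
  | op o x y z s =>
    exact ⟨fun y hy => by simp_all [Cmd.writesReg], fun A _ => rfl⟩
  | load x A ri rj s hi hj =>
    exact ⟨fun y hy => by simp_all [Cmd.writesReg], fun A _ => rfl⟩
  | store A ri rj x s hi hj =>
    refine ⟨fun y _ => rfl, fun B hB => ?_⟩
    funext i j
    simp_all [Cmd.writesSeg]
  | seq hp hq ihp ihq =>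
    exact (ihp.mono (by simp_all [Cmd.writesReg]) (by simp_all [Cmd.writesSeg])).trans
      (ihq.mono (by simp_all [Cmd.writesReg]) (by simp_all [Cmd.writesSeg]))
  | iteTrue hx hp ih =>
    exact ih.mono (by simp_all [Cmd.writesReg]) (by simp_all [Cmd.writesSeg])
  | iteFalse hx hp ih =>
    exact ih.mono (by simp_all [Cmd.writesReg]) (by simp_all [Cmd.writesSeg])
  | loopTrue hx hp hl ih ihl =>
    exact (ih.mono (by simp_all [Cmd.writesReg]) (by simp_all [Cmd.writesSeg])).trans ihl
  | loopFalse hx => exact Frame.refl _ _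

section Rules

variable {b r m : ℕ} {p q : Cmd} {s : State} {Q Q' : ℕ → State → Prop}

theorem Runs.mono (h : Runs b r m p s Q) (hQ : ∀ t s', Q t s' → Q' t s') : Runs b r m p s Q' := by
  obtain ⟨t, s', he, h⟩ := h
  exact ⟨t, s', he, hQ _ _ h⟩

theorem Runs.frame (h : Runs b r m p s Q) :
    Runs b r m p s (fun t s' => Q t s' ∧ Frame p s s') := by
  obtain ⟨t, s', he, h⟩ := h
  exact ⟨t, s', he, h, he.frame⟩

theorem Runs.framed (h : Runs b r m p s Q) (hQ : ∀ t s', Q t s' → Frame p s s' → Q' t s') :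
    Runs b r m p s Q' :=
  h.frame.mono fun t s' h' => hQ t s' h'.1 h'.2

@[simp] theorem runs_skip : Runs b r m .skip s Q ↔ Q 1 s := by
  constructor
  · rintro ⟨t, s', h, hQ⟩; cases h; exact hQ
  · exact fun h => ⟨_, _, .skip s, h⟩

@[simp] theorem runs_const {x c : ℕ} : Runs b r m (.const x c) s Q ↔ Q 1 (s.setReg x (c % 2 ^ b)) := by
  constructor
  · rintro ⟨t, s', h, hQ⟩; cases h; exact hQ
  · exact fun h => ⟨_, _, .const x c s, h⟩

theorem runs_op {o : Op} {x y z : ℕ} :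
    Runs b r m (.op o x y z) s Q ↔ Q 1 (s.setReg x (o.eval b (s.reg y) (s.reg z))) := by
  constructor
  · rintro ⟨t, s', h, hQ⟩; cases h; exact hQ
  · exact fun h => ⟨_, _, .op o x y z s, h⟩

@[simp] theorem runs_load {x A ri rj : ℕ} :
    Runs b r m (.load x A ri rj) s Q ↔
      s.reg ri < r ∧ s.reg rj < m ∧ Q 1 (s.setReg x (s.mem A (s.reg ri) (s.reg rj))) := by
  constructor
  · rintro ⟨t, s', h, hQ⟩; cases h with | load _ _ _ _ _ h1 h2 => exact ⟨h1, h2, hQ⟩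
  · exact fun h => ⟨_, _, .load x A ri rj s h.1 h.2.1, h.2.2⟩

@[simp] theorem runs_store {x A ri rj : ℕ} :
    Runs b r m (.store A ri rj x) s Q ↔
      s.reg ri < r ∧ s.reg rj < m ∧ Q 1 (s.setMem A (s.reg ri) (s.reg rj) (s.reg x)) := by
  constructor
  · rintro ⟨t, s', h, hQ⟩; cases h with | store _ _ _ _ _ h1 h2 => exact ⟨h1, h2, hQ⟩
  · exact fun h => ⟨_, _, .store A ri rj x s h.1 h.2.1, h.2.2⟩

@[simp] theorem runs_seq :
    Runs b r m (p ⨟ q) s Q ↔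
      Runs b r m p s fun t₁ s₁ => Runs b r m q s₁ fun t₂ s₂ => Q (t₁ + t₂) s₂ := by
  constructor
  · rintro ⟨t, s', h, hQ⟩
    cases h with | seq hp hq => exact ⟨_, _, hp, _, _, hq, hQ⟩
  · rintro ⟨t, s', hp, t', s'', hq, hQ⟩
    exact ⟨_, _, .seq hp hq, hQ⟩

@[simp] theorem runs_ite {x : ℕ} :
    Runs b r m (.ite x p q) s Q ↔
      if s.reg x = 0 then Runs b r m q s (fun t s' => Q (t + 1) s')
      else Runs b r m p s (fun t s' => Q (t + 1) s') := by
  constructor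
  · rintro ⟨t, s', h, hQ⟩
    cases h with
    | iteTrue hx hp => rw [if_neg hx]; exact ⟨_, _, hp, hQ⟩
    | iteFalse hx hp => rw [if_pos hx]; exact ⟨_, _, hp, hQ⟩
  · intro h
    split_ifs at h with hx
    · obtain ⟨t, s', h, hQ⟩ := h
      exact ⟨_, _, .iteFalse hx h, hQ⟩
    · obtain ⟨t, s', h, hQ⟩ := h
      exact ⟨_, _, .iteTrue hx h, hQ⟩

/-- Not a simplification rule, since the right side contains the same loop again. -/
theorem runs_loop {x : ℕ} :
    Runs b r m (.loop x p) s Q ↔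
      if s.reg x = 0 then Q 1 s
      else Runs b r m p s fun t s' => Runs b r m (.loop x p) s' fun t' s'' => Q (t + t' + 1) s'' := by
  constructor
  · rintro ⟨t, s', h, hQ⟩
    cases h with
    | loopTrue hx hp hl => rw [if_neg hx]; exact ⟨_, _, hp, _, _, hl, hQ⟩
    | loopFalse hx => rw [if_pos hx]; exact hQ
  · intro h
    split_ifs at h with hx
    · exact ⟨_, _, .loopFalse hx, h⟩
    · obtain ⟨t, s', h, t', s'', hl, hQ⟩ := h
      exact ⟨_, _, .loopTrue hx h hl, hQ⟩

@[simp] theorem runs_add {x y z : ℕ} :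
    Runs b r m (.op .add x y z) s Q ↔ Q 1 (s.setReg x ((s.reg y + s.reg z) % 2 ^ b)) := runs_op

@[simp] theorem runs_sub {x y z : ℕ} :
    Runs b r m (.op .sub x y z) s Q ↔ Q 1 (s.setReg x ((s.reg y - s.reg z) % 2 ^ b)) := runs_op

@[simp] theorem runs_div {x y z : ℕ} :
    Runs b r m (.op .div x y z) s Q ↔ Q 1 (s.setReg x (s.reg y / s.reg z % 2 ^ b)) := runs_op

@[simp] theorem runs_mod {x y z : ℕ} :
    Runs b r m (.op .mod x y z) s Q ↔ Q 1 (s.setReg x (s.reg y % s.reg z % 2 ^ b)) := runs_op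

theorem runs_lt (hb : 1 < 2 ^ b) {x y z : ℕ} :
    Runs b r m (.op .lt x y z) s Q ↔
      Q 1 (s.setReg x (if s.reg y < s.reg z then 1 else 0)) := by
  rw [runs_op, Op.eval]
  split_ifs <;> simp [Nat.mod_eq_of_lt hb]

theorem runs_eq (hb : 1 < 2 ^ b) {x y z : ℕ} :
    Runs b r m (.op .eq x y z) s Q ↔
      Q 1 (s.setReg x (if s.reg y = s.reg z then 1 else 0)) := by
  rw [runs_op, Op.eval]
  split_ifs <;> simp [Nat.mod_eq_of_lt hb]

/-- `for i := 0, …, N - 1 do body`, with register `2` holding `1` and scratch register `5`. -/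
def Cmd.for (i N : ℕ) (body : Cmd) : Cmd :=
  .const i 0 ⨟ .op .lt 5 i N ⨟ .loop 5 (body ⨟ .op .add i i 2 ⨟ .op .lt 5 i N)

/-- The rule for counting loops; the invariant `I k t s` may speak about the time `t` spent in the
first `k` iterations. -/
theorem runs_for {i N l : ℕ} (hb : 1 < 2 ^ b) (I : ℕ → ℕ → State → Prop)
    (hl : s.reg N = l) (hlb : l < 2 ^ b) (h1 : s.reg 2 = 1)
    (hw : (p.writesReg i || p.writesReg N || p.writesReg 2) = false)
    (hd : i ≠ N ∧ i ≠ 5 ∧ N ≠ 5 ∧ i ≠ 2)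
    (h0 : ∀ v, I 0 0 ((s.setReg i 0).setReg 5 v))
    (hs : ∀ k t s₁, k < l → I k t s₁ → s₁.reg i = k → Frame (.for i N p) s s₁ →
      Runs b r m p s₁ fun t' s₂ =>
        ∀ v, I (k + 1) (t + t' + 3) ((s₂.setReg i (k + 1)).setReg 5 v))
    (hQ : ∀ t s', I l t s' → Frame (.for i N p) s s' → Q (t + 3) s') :
    Runs b r m (.for i N p) s Q := by
  obtain ⟨hiN, hi5, hN5, hi2⟩ := hd
  simp only [Bool.or_eq_false_iff] at hw
  obtain ⟨⟨hwi, hwN⟩, hw2⟩ := hw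
  -- Induction on the number `e` of iterations left. The `- 1` removes the final failing loop test,
  -- which is not part of the time seen by the invariant; together with the two initializing
  -- instructions it makes up the `3` in the conclusion.
  have key : ∀ e k t s₁, k + e = l → I k t s₁ → s₁.reg i = k →
      s₁.reg 5 = (if k < l then 1 else 0) → Frame (.for i N p) s s₁ →
      Runs b r m (.loop 5 (p ⨟ .op .add i i 2 ⨟ .op .lt 5 i N)) s₁
        fun t' s₂ => I l (t + t' - 1) s₂ ∧ Frame (.for i N p) s s₂ ∧ 1 ≤ t' := by
    intro e
    induction e with
    | zero =>
      intro k t s₁ hk hI hi hc hF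
      rw [runs_loop, if_pos (by simp [hc, ← hk])]
      obtain rfl : k = l := by omega
      exact ⟨hI, hF, le_rfl⟩
    | succ e ih =>
      intro k t s₁ hk hI hi hc hF
      rw [runs_loop, if_neg (by rw [hc, if_pos (by omega)]; exact one_ne_zero), runs_seq]
      refine (hs k t s₁ (by omega) hI hi hF).framed fun t' s₂ hI₂ hF₂ => ?_
      have e1 : s₂.reg i = k := (hF₂.reg i hwi).trans hi
      have e2 : s₂.reg 2 = 1 := by
        rw [hF₂.reg 2 hw2, ← h1]
        refine hF.reg 2 ?_
        simp [Cmd.for, Cmd.writesReg, hw2, hi2.symm]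
      have e3 : s₂.reg N = l := by
        rw [hF₂.reg N hwN, ← hl]
        refine hF.reg N ?_
        simp [Cmd.for, Cmd.writesReg, hwN, hN5, hiN.symm]
      have e4 : (k + 1) % 2 ^ b = k + 1 := Nat.mod_eq_of_lt (by omega)
      rw [runs_seq, runs_op, runs_lt hb]
      simp only [Op.eval, e1, e2, e4, State.reg_setReg, if_true, if_neg hiN.symm, e3]
      refine (ih (k + 1) _ _ (by omega) (hI₂ _) (by simp [hi5]) (by simp) ?_).mono ?_
      · refine hF.trans ⟨fun y hy => ?_, fun A hA => ?_⟩
        · have hy' : p.writesReg y = false ∧ y ≠ i ∧ y ≠ 5 := by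
            simp_all [Cmd.for, Cmd.writesReg]
          simp [hy'.2.1, hy'.2.2, hF₂.reg y hy'.1]
        · have hA' : p.writesSeg A = false := by simp_all [Cmd.for, Cmd.writesSeg]
          simp [hF₂.mem A hA']
      · intro t'' s₃ h
        refine ⟨?_, h.2.1, by omega⟩
        convert h.1 using 1
        have := h.2.2
        omega
  rw [Cmd.for, runs_seq, runs_const, runs_seq, runs_lt hb]
  simp only [Nat.zero_mod, State.reg_setReg, if_true, if_neg hiN.symm, hl]
  refine (key l 0 0 _ (by omega) (h0 _) (by simp [hi5]) (by simp) ?_).mono ?_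
  · refine ⟨fun y hy => ?_, fun A _ => rfl⟩
    have hy' : y ≠ i ∧ y ≠ 5 := by simp_all [Cmd.for, Cmd.writesReg]
    simp [hy'.1, hy'.2]
  · intro t s' h
    have := hQ _ _ h.1 h.2.1
    have h3 := h.2.2
    convert this using 1
    omega

end Rules

end WordRAM

/-! ### Permutations of an initial segment of the natural numbers -/

/-- `f` restricts to an injective map of `{0, …, n - 1}` to itself. -/
structure PermBelow (n : ℕ) (f : ℕ → ℕ) : Prop where
  lt : ∀ p < n, f p < n
  inj : ∀ p < n, ∀ q < n, f p = f q → p = q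

namespace PermBelow

variable {n : ℕ} {f : ℕ → ℕ}

theorem iterate_lt (hf : PermBelow n f) (k : ℕ) {p : ℕ} (hp : p < n) : f^[k] p < n := by
  induction k with
  | zero => exact hp
  | succ k ih => rw [Function.iterate_succ_apply']; exact hf.lt _ ih

theorem iterate_inj (hf : PermBelow n f) (k : ℕ) {p q : ℕ}
    (hp : p < n) (hq : q < n) (h : f^[k] p = f^[k] q) :
    p = q := by
  induction k with
  | zero => exact h
  | succ k ih =>
    rw [Function.iterate_succ_apply', Function.iterate_succ_apply'] at h
    exact ih (hf.inj _ (hf.iterate_lt k hp) _ (hf.iterate_lt k hq) h)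

/-- Pigeonhole on the first `n + 1` iterates; injectivity cancels the common initial part of a
coincidence. -/
theorem exists_period (hf : PermBelow n f) {p : ℕ} (hp : p < n) :
    ∃ P, 0 < P ∧ P ≤ n ∧ f^[P] p = p := by
  have key : ∀ i j, j ≤ n → i < j → f^[i] p = f^[j] p → ∃ P, 0 < P ∧ P ≤ n ∧ f^[P] p = p := by
    intro i j hj hlt he
    refine ⟨j - i, by omega, by omega, ?_⟩
    have h2 : f^[i] (f^[j - i] p) = f^[i] p := by
      rw [← Function.iterate_add_apply, Nat.add_sub_of_le hlt.le]
      exact he.symm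
    exact hf.iterate_inj i (hf.iterate_lt _ hp) hp h2
  obtain ⟨i, hi, j, hj, hij, he⟩ := Finset.exists_ne_map_eq_of_card_lt_of_maps_to
    (s := Finset.range (n + 1)) (t := Finset.range n) (f := fun k => f^[k] p) (by simp)
    (fun k _ => by simpa using hf.iterate_lt k hp)
  simp only [Finset.mem_range] at hi hj
  rcases lt_or_gt_of_ne hij with h | h
  · exact key i j (by omega) h he
  · exact key j i (by omega) h he.symm

theorem exists_iterate_lt (hf : PermBelow n f) {p : ℕ} (hp : p < n) (k : ℕ) :
    ∃ k' < n, f^[k'] p = f^[k] p := by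
  obtain ⟨P, h0, hP, hper⟩ := hf.exists_period hp
  refine ⟨k % P, (Nat.mod_lt _ h0).trans_le hP, ?_⟩
  exact Function.IsPeriodicPt.iterate_mod_apply (f := f) hper k

theorem exists_iterate_back (hf : PermBelow n f) {p : ℕ} (hp : p < n) (k : ℕ) :
    ∃ k', f^[k'] (f^[k] p) = p := by
  obtain ⟨P, h0, hP, hper⟩ := hf.exists_period hp
  -- Since `P ≥ 1`, the subtraction is exact, and the total of `P * k` steps is a whole number of
  -- periods.
  refine ⟨P * k - k, ?_⟩
  rw [← Function.iterate_add_apply, Nat.sub_add_cancel (Nat.le_mul_of_pos_left k h0)]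
  exact Function.IsPeriodicPt.mul_const hper k

end PermBelow

/-- The least elements of the cycles of `f` on `{0, …, n - 1}`. -/
noncomputable def cycleMins (n : ℕ) (f : ℕ → ℕ) : Finset ℕ :=
  open Classical in (Finset.range n).filter fun p => ∀ k, p ≤ f^[k] p

theorem mem_cycleMins {n : ℕ} {f : ℕ → ℕ} {p : ℕ} :
    p ∈ cycleMins n f ↔ p < n ∧ ∀ k, p ≤ f^[k] p := by
  simp [cycleMins]

theorem PermBelow.exists_mem_cycleMins {n : ℕ} {f : ℕ → ℕ} (hf : PermBelow n f) {p : ℕ}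
    (hp : p < n) : ∃ k, f^[k] p ∈ cycleMins n f := by
  obtain ⟨k, hk⟩ : ∃ k, ∀ l, f^[k] p ≤ f^[l] p := by
    have h : ∃ v k, f^[k] p = v := ⟨_, 0, rfl⟩
    classical
    obtain ⟨k, hk⟩ := Nat.find_spec h
    exact ⟨k, fun l => hk.le.trans (Nat.find_min' h ⟨l, rfl⟩)⟩
  refine ⟨k, mem_cycleMins.2 ⟨hf.iterate_lt _ hp, fun l => ?_⟩⟩
  rw [← Function.iterate_add_apply]
  exact hk _

/-- The least of the first `2 ^ i` iterates, computed by doubling. -/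
def minIterate (f : ℕ → ℕ) : ℕ → ℕ → ℕ
  | 0, p => p
  | i + 1, p => min (minIterate f i p) (minIterate f i (f^[2 ^ i] p))

theorem minIterate_le (f : ℕ → ℕ) (i : ℕ) : ∀ p, ∀ k < 2 ^ i, minIterate f i p ≤ f^[k] p := by
  induction i with
  | zero => intro p k hk; obtain rfl : k = 0 := by simpa using hk
            exact le_rfl
  | succ i ih =>
    intro p k hk
    rw [minIterate]
    rcases lt_or_ge k (2 ^ i) with h | h
    · exact (min_le_left _ _).trans (ih p k h)
    · refine (min_le_right _ _).trans ((ih _ (k - 2 ^ i) (by rw [pow_succ] at hk; omega)).trans_eq ?_)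
      rw [← Function.iterate_add_apply, Nat.sub_add_cancel h]

theorem exists_minIterate_eq (f : ℕ → ℕ) (i : ℕ) : ∀ p, ∃ k, minIterate f i p = f^[k] p := by
  induction i with
  | zero => exact fun p => ⟨0, rfl⟩
  | succ i ih =>
    intro p
    rw [minIterate]
    rcases min_choice (minIterate f i p) (minIterate f i (f^[2 ^ i] p)) with h | h <;> rw [h]
    · exact ih p
    · obtain ⟨k, hk⟩ := ih (f^[2 ^ i] p)
      exact ⟨k + 2 ^ i, by rw [hk, Function.iterate_add_apply]⟩

/-- Periods are at most `n ≤ 2 ^ i`, so the first `2 ^ i` iterates already exhaust the cycle.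
Counting cycles thus becomes counting fixed points of the last row of the table. -/
theorem PermBelow.minIterate_eq_iff {n : ℕ} {f : ℕ → ℕ} (hf : PermBelow n f) {i p : ℕ}
    (hi : n ≤ 2 ^ i) (hp : p < n) : minIterate f i p = p ↔ p ∈ cycleMins n f := by
  rw [mem_cycleMins]
  constructor
  · refine fun h => ⟨hp, fun k => ?_⟩
    obtain ⟨k', hk', e⟩ := hf.exists_iterate_lt hp k
    rw [← e]
    exact h.symm.trans_le (minIterate_le f i p k' (by omega))
  · rintro ⟨-, h⟩
    refine le_antisymm (minIterate_le f i p 0 (by positivity)) ?_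
    obtain ⟨k, hk⟩ := exists_minIterate_eq f i p
    exact hk ▸ h k

/-! ### Tuples of permutations and their isomorphisms -/

/-- `A 0, …, A (d - 1)` are permutations of `{0, …, n - 1}` that generate a transitive group. -/
structure PermSystem (n d : ℕ) (A : ℕ → ℕ → ℕ) : Prop where
  perm : ∀ j < d, PermBelow n (A j)
  trans : ∀ U : ℕ → Prop, (∃ p < n, U p) → (∀ j < d, ∀ p < n, U p → U (A j p)) → ∀ p < n, U p

/-- `τ` is an equivariant map from the system `A` to the system `B`. -/
structure IsEquivariant (n d : ℕ) (A B : ℕ → ℕ → ℕ) (τ : ℕ → ℕ) : Prop where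
  lt : ∀ p < n, τ p < n
  map : ∀ j < d, ∀ p < n, τ (A j p) = B j (τ p)

namespace IsEquivariant

variable {n d : ℕ} {A B : ℕ → ℕ → ℕ} {τ : ℕ → ℕ}

/-- The image is nonempty and closed under the permutations of `B`, hence everything by
transitivity. -/
theorem surj (h : IsEquivariant n d A B τ) (hA : PermSystem n d A) (hB : PermSystem n d B)
    (hn : 1 ≤ n) {q : ℕ} (hq : q < n) : ∃ p < n, τ p = q := by
  refine hB.trans (fun q => ∃ p < n, τ p = q) ⟨τ 0, h.lt 0 hn, 0, hn, rfl⟩ ?_ q hq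
  rintro j hj _ - ⟨p, hp, rfl⟩
  exact ⟨A j p, (hA.perm j hj).lt p hp, h.map j hj p hp⟩

/-- A surjection of a finite set onto itself. The algorithm therefore never has to check
bijectivity. -/
theorem inj (h : IsEquivariant n d A B τ) (hA : PermSystem n d A) (hB : PermSystem n d B)
    (hn : 1 ≤ n) : ∀ p < n, ∀ q < n, τ p = τ q → p = q := by
  have hs : Set.SurjOn τ (Finset.range n : Finset ℕ) (Finset.range n : Finset ℕ) := by
    intro q hq
    obtain ⟨p, hp, e⟩ := h.surj hA hB hn (by simpa using hq)
    exact ⟨p, by simpa using hp, e⟩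
  have hi := Finset.injOn_of_surjOn_of_card_le τ
    (by intro p hp; simpa using h.lt p (by simpa using hp)) hs le_rfl
  intro p hp q hq e
  exact hi (by simpa using hp) (by simpa using hq) e

theorem map_iterate (h : IsEquivariant n d A B τ) (hA : PermSystem n d A) {j : ℕ} (hj : j < d)
    (k : ℕ) {p : ℕ} (hp : p < n) : τ ((A j)^[k] p) = (B j)^[k] (τ p) := by
  induction k with
  | zero => rfl
  | succ k ih =>
    rw [Function.iterate_succ_apply', Function.iterate_succ_apply', ← ih]
    exact h.map j hj _ ((hA.perm j hj).iterate_lt k hp)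

end IsEquivariant

/-! ### Relative coordinates

A point of a system is described relative to a varying root `q`: the cycles of the permutation `J`
are numbered; the base point of cycle `0` is `q`, that of cycle `c` is the image under the
permutation `pj c` of the point with coordinates of `pu c`; a point `u` is reached from the base
point of the cycle `ci u` by `of u` applications of the permutation `J`. -/

/-- The base points of the cycles numbered below `c`, relative to the root `q`. -/
def basePoints (G : ℕ → ℕ → ℕ) (J : ℕ) (pu pj ci of : ℕ → ℕ) (q : ℕ) : ℕ → ℕ → ℕ
  | 0 => fun _ => 0
  | c + 1 => Function.update (basePoints G J pu pj ci of q c) c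
      (if c = 0 then q
        else G (pj c) ((G J)^[of (pu c)] (basePoints G J pu pj ci of q c (ci (pu c)))))

/-- The point with the coordinates of `u` relative to the root `q`. -/
def locate (G : ℕ → ℕ → ℕ) (J : ℕ) (pu pj ci of : ℕ → ℕ) (nc q u : ℕ) : ℕ :=
  (G J)^[of u] (basePoints G J pu pj ci of q nc (ci u))

/-- Cycles numbered below `nc` are attached to cycles with smaller numbers. -/
structure IsCycleTree (n d : ℕ) (pu pj ci : ℕ → ℕ) (nc : ℕ) : Prop where
  pu_lt : ∀ c, 0 < c → c < nc → pu c < n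
  pj_lt : ∀ c, 0 < c → c < nc → pj c < d
  ci_lt : ∀ c, 0 < c → c < nc → ci (pu c) < c

section Locate

variable {n d : ℕ} {A B : ℕ → ℕ → ℕ} {J nc q : ℕ} {pu pj ci of : ℕ → ℕ}

theorem basePoints_succ_of_lt {c i : ℕ} (hi : i < c) :
    basePoints A J pu pj ci of q (c + 1) i = basePoints A J pu pj ci of q c i := by
  rw [basePoints, Function.update_of_ne hi.ne]

theorem basePoints_lt (hA : PermSystem n d A) (hJ : J < d) (hT : IsCycleTree n d pu pj ci nc)
    (hq : q < n) {c : ℕ} (hc : c ≤ nc) :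
    ∀ i < c, basePoints A J pu pj ci of q c i < n := by
  induction c with
  | zero => intro i hi; omega
  | succ c ih =>
    intro i hi
    rcases Nat.lt_succ_iff_lt_or_eq.1 hi with h | rfl
    · rw [basePoints_succ_of_lt h]; exact ih (by omega) i h
    · rw [basePoints, Function.update_self]
      split_ifs with h0
      · exact hq
      · exact (hA.perm _ (hT.pj_lt i (by omega) hc)).lt _ ((hA.perm J hJ).iterate_lt _
          (ih (by omega) _ (hT.ci_lt i (by omega) hc)))

theorem locate_lt (hA : PermSystem n d A) (hJ : J < d) (hT : IsCycleTree n d pu pj ci nc)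
    (hq : q < n) {u : ℕ} (hu : ci u < nc) : locate A J pu pj ci of nc q u < n :=
  (hA.perm J hJ).iterate_lt _ (basePoints_lt hA hJ hT hq le_rfl _ hu)

/-- A base point is a fixed word in the generators applied to the root, the same word in both
systems, and equivariant maps commute with words. -/
theorem IsEquivariant.basePoints {τ : ℕ → ℕ} (h : IsEquivariant n d A B τ)
    (hA : PermSystem n d A) (hJ : J < d) (hT : IsCycleTree n d pu pj ci nc) (hq : q < n) {c : ℕ}
    (hc : c ≤ nc) : ∀ i < c,
      τ (_root_.basePoints A J pu pj ci of q c i) = _root_.basePoints B J pu pj ci of (τ q) c i := by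
  induction c with
  | zero => intro i hi; omega
  | succ c ih =>
    intro i hi
    rcases Nat.lt_succ_iff_lt_or_eq.1 hi with h' | rfl
    · rw [basePoints_succ_of_lt h', basePoints_succ_of_lt h']; exact ih (by omega) i h'
    · rw [_root_.basePoints, Function.update_self, _root_.basePoints, Function.update_self]
      split_ifs with h0
      · rfl
      · have hl := hT.ci_lt i (by omega) hc
        have hb := basePoints_lt (of := of) hA hJ hT hq (by omega : i ≤ nc) _ hl
        rw [h.map _ (hT.pj_lt i (by omega) hc) _ ((hA.perm J hJ).iterate_lt _ hb),
          h.map_iterate hA hJ _ hb, ih (by omega) _ hl]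

theorem IsEquivariant.locate {τ : ℕ → ℕ} (h : IsEquivariant n d A B τ)
    (hA : PermSystem n d A) (hJ : J < d) (hT : IsCycleTree n d pu pj ci nc) (hq : q < n) {u : ℕ}
    (hu : ci u < nc) :
    τ (_root_.locate A J pu pj ci of nc q u) = _root_.locate B J pu pj ci of nc (τ q) u := by
  rw [_root_.locate, _root_.locate, h.map_iterate hA hJ _ (basePoints_lt hA hJ hT hq le_rfl _ hu),
    h.basePoints hA hJ hT hq le_rfl _ hu]

/-- The relation `A j u = v` holds in relative coordinates at the root `q`. -/
def Related (G : ℕ → ℕ → ℕ) (J : ℕ) (pu pj ci of : ℕ → ℕ) (nc j u v q : ℕ) : Prop :=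
  G j (locate G J pu pj ci of nc q u) = locate G J pu pj ci of nc q v

/-- Both sides of the relation are words applied to the root, so `τ` carries one equation to the
other; injectivity of `τ` gives the converse. This is the invariant that separates candidates. -/
theorem IsEquivariant.related_iff {τ : ℕ → ℕ} (h : IsEquivariant n d A B τ)
    (hA : PermSystem n d A) (hB : PermSystem n d B) (hJ : J < d)
    (hT : IsCycleTree n d pu pj ci nc) (hq : q < n) {j u v : ℕ} (hj : j < d)
    (hu : ci u < nc) (hv : ci v < nc) :
    Related A J pu pj ci of nc j u v q ↔ Related B J pu pj ci of nc j u v (τ q) := by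
  have h1 := locate_lt (of := of) hA hJ hT hq hu
  have h2 := locate_lt (of := of) hA hJ hT hq hv
  rw [Related, Related, ← h.locate hA hJ hT hq hu, ← h.locate hA hJ hT hq hv, ← h.map j hj _ h1]
  exact ⟨fun e => e ▸ rfl, h.inj hA hB (by omega) _ ((hA.perm j hj).lt _ h1) _ h2⟩

end Locate

/-! ### Exploring a system from a point -/

/-- The base point of cycle `c` in the system `A` explored from `x`; in a second system, the points
`u` are replaced by `ta u`. -/
def rootOf (A : ℕ → ℕ → ℕ) (x : ℕ) (pu pj ta : ℕ → ℕ) (c : ℕ) : ℕ :=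
  if c = 0 then x else A (pj c) (ta (pu c))

/-- The marked points of the system `A`, explored from `x`, have coordinates `ci`, `of` in a cycle
tree with `nc` cycles; `ta u` is the point of the system `B` with the coordinates of `u` relative
to `y`. -/
structure Explored (n d : ℕ) (A B : ℕ → ℕ → ℕ) (J x y : ℕ) (mk ci of ta pu pj : ℕ → ℕ) (nc : ℕ) :
    Prop where
  tree : IsCycleTree n d pu pj ci nc
  mk_pu : ∀ c, 0 < c → c < nc → mk (pu c) ≠ 0
  ci_lt : ∀ u < n, mk u ≠ 0 → ci u < nc
  of_lt : ∀ u < n, mk u ≠ 0 → of u < n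
  ta_lt : ∀ u < n, mk u ≠ 0 → ta u < n
  iter : ∀ u < n, mk u ≠ 0 → (A J)^[of u] (rootOf A x pu pj id (ci u)) = u
  iter' : ∀ u < n, mk u ≠ 0 → (B J)^[of u] (rootOf B y pu pj ta (ci u)) = ta u

section Explored

variable {n d : ℕ} {A B : ℕ → ℕ → ℕ} {J x y nc : ℕ} {mk ci of ta pu pj : ℕ → ℕ}

/-- The recursive definition of base points unwinds to the stored data because `pu i` lies in an
earlier cycle, where `iter` and `iter'` identify the point reached. -/
theorem Explored.basePoints (h : Explored n d A B J x y mk ci of ta pu pj nc) :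
    ∀ c ≤ nc, ∀ i < c, _root_.basePoints A J pu pj ci of x c i = rootOf A x pu pj id i ∧
      _root_.basePoints B J pu pj ci of y c i = rootOf B y pu pj ta i := by
  intro c
  induction c with
  | zero => intro _ i hi; omega
  | succ c ih =>
    intro hc i hi
    rcases Nat.lt_succ_iff_lt_or_eq.1 hi with h' | rfl
    · rw [basePoints_succ_of_lt h', basePoints_succ_of_lt h']; exact ih (by omega) i h'
    · rw [_root_.basePoints, Function.update_self, _root_.basePoints, Function.update_self, rootOf,
        rootOf]
      split_ifs with h0
      · exact ⟨rfl, rfl⟩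
      · obtain ⟨e1, e2⟩ := ih (by omega) _ (h.tree.ci_lt i (by omega) hc)
        have hp := h.tree.pu_lt i (by omega) hc
        have hm := h.mk_pu i (by omega) hc
        rw [e1, e2, h.iter _ hp hm, h.iter' _ hp hm]
        exact ⟨rfl, rfl⟩

theorem Explored.locate (h : Explored n d A B J x y mk ci of ta pu pj nc) {u : ℕ} (hu : u < n)
    (hm : mk u ≠ 0) : _root_.locate A J pu pj ci of nc x u = u ∧
      _root_.locate B J pu pj ci of nc y u = ta u := by
  obtain ⟨e1, e2⟩ := h.basePoints nc le_rfl _ (h.ci_lt u hu hm)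
  rw [_root_.locate, _root_.locate, e1, e2, h.iter u hu hm, h.iter' u hu hm]
  exact ⟨rfl, rfl⟩

theorem Explored.empty (hmk : ∀ u < n, mk u = 0) :
    Explored n d A B J x y mk ci of ta pu pj 0 where
  tree := ⟨by omega, by omega, by omega⟩
  mk_pu := by omega
  ci_lt u hu h := absurd (hmk u hu) h
  of_lt u hu h := absurd (hmk u hu) h
  ta_lt u hu h := absurd (hmk u hu) h
  iter u hu h := absurd (hmk u hu) h
  iter' u hu h := absurd (hmk u hu) h

/-- Adding a cycle. -/
theorem Explored.step (h : Explored n d A B J x y mk ci of ta pu pj nc)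
    {mk' ci' of' ta' pu' pj' : ℕ → ℕ} (hB : PermBelow n (B J))
    (hold : ∀ u < n, mk u ≠ 0 → mk' u ≠ 0 ∧ ci' u = ci u ∧ of' u = of u ∧ ta' u = ta u)
    (hpu : ∀ c < nc, pu' c = pu c) (hpj : ∀ c < nc, pj' c = pj c)
    (hnc : 0 < nc → pu' nc < n ∧ pj' nc < d ∧ mk (pu' nc) ≠ 0)
    (hy : rootOf B y pu' pj' ta nc < n)
    (hnew : ∀ u < n, mk u = 0 → mk' u ≠ 0 → ci' u = nc ∧ of' u < n ∧
      (A J)^[of' u] (rootOf A x pu' pj' id nc) = u ∧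
      (B J)^[of' u] (rootOf B y pu' pj' ta nc) = ta' u) :
    Explored n d A B J x y mk' ci' of' ta' pu' pj' (nc + 1) := by
  have hT := h.tree
  have hmk : ∀ c, 0 < c → c < nc + 1 → pu' c < n ∧ pj' c < d ∧ mk (pu' c) ≠ 0 := by
    intro c h0 hc
    rcases Nat.lt_succ_iff_lt_or_eq.1 hc with hc | rfl
    · rw [hpu c hc, hpj c hc]
      exact ⟨hT.pu_lt c h0 hc, hT.pj_lt c h0 hc, h.mk_pu c h0 hc⟩
    · exact hnc h0
  have hrA : ∀ c < nc, rootOf A x pu' pj' id c = rootOf A x pu pj id c := by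
    intro c hc; simp only [rootOf, hpu c hc, hpj c hc]
  -- Attachment points were marked before the new cycle, and `ta` does not change on marked points.
  have hrB : ∀ c ≤ nc, rootOf B y pu' pj' ta' c = rootOf B y pu' pj' ta c := by
    intro c hc
    rw [rootOf, rootOf]
    split_ifs with h0
    · rfl
    · have := hmk c (by omega) (by omega)
      rw [(hold _ this.1 this.2.2).2.2.2]
  have hrB' : ∀ c < nc, rootOf B y pu' pj' ta c = rootOf B y pu pj ta c := by
    intro c hc; simp only [rootOf, hpu c hc, hpj c hc]
  refine ⟨⟨fun c h0 hc => (hmk c h0 hc).1, fun c h0 hc => (hmk c h0 hc).2.1, fun c h0 hc => ?_⟩,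
    fun c h0 hc => ?_, fun u hu hm => ?_, fun u hu hm => ?_, fun u hu hm => ?_, fun u hu hm => ?_,
    fun u hu hm => ?_⟩
  · obtain ⟨h1, -, h3⟩ := hmk c h0 hc
    rw [(hold _ h1 h3).2.1]
    rcases Nat.lt_succ_iff_lt_or_eq.1 hc with hc' | rfl
    · rw [hpu c hc']; exact hT.ci_lt c h0 hc'
    · exact h.ci_lt _ h1 h3
  · obtain ⟨h1, -, h3⟩ := hmk c h0 hc
    exact (hold _ h1 h3).1
  · by_cases h0 : mk u = 0
    · rw [(hnew u hu h0 hm).1]; omega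
    · rw [(hold u hu h0).2.1]; exact (h.ci_lt u hu h0).trans (by omega)
  · by_cases h0 : mk u = 0
    · exact (hnew u hu h0 hm).2.1
    · rw [(hold u hu h0).2.2.1]; exact h.of_lt u hu h0
  · by_cases h0 : mk u = 0
    · rw [← (hnew u hu h0 hm).2.2.2]; exact hB.iterate_lt _ hy
    · rw [(hold u hu h0).2.2.2]; exact h.ta_lt u hu h0
  · by_cases h0 : mk u = 0
    · rw [(hnew u hu h0 hm).1]; exact (hnew u hu h0 hm).2.2.1
    · obtain ⟨-, e1, e2, -⟩ := hold u hu h0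
      rw [e1, e2, hrA _ (h.ci_lt u hu h0)]; exact h.iter u hu h0
  · by_cases h0 : mk u = 0
    · rw [(hnew u hu h0 hm).1, hrB nc le_rfl]; exact (hnew u hu h0 hm).2.2.2
    · obtain ⟨-, e1, e2, e3⟩ := hold u hu h0
      have := h.ci_lt u hu h0
      rw [e1, e2, e3, hrB _ this.le, hrB' _ this]
      exact h.iter' u hu h0

end Explored

/-! ### Tuples of permutations as systems -/

section Bridge

variable {n d : ℕ}

theorem permTable_apply (σ : Fin d → Equiv.Perm (Fin n)) {j i : ℕ} (hj : j < d) (hi : i < n) :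
    permTable σ j i = (σ ⟨j, hj⟩ ⟨i, hi⟩ : ℕ) := by
  rw [permTable, dif_pos ⟨hj, hi⟩]

theorem permBelow_permTable (σ : Fin d → Equiv.Perm (Fin n)) {j : ℕ} (hj : j < d) :
    PermBelow n (permTable σ j) where
  lt p hp := by rw [permTable_apply σ hj hp]; exact Fin.is_lt _
  inj p hp q hq h := by
    rw [permTable_apply σ hj hp, permTable_apply σ hj hq, Fin.val_inj,
      EmbeddingLike.apply_eq_iff_eq, Fin.mk.injEq] at h
    exact h

/-- The group contains inverses, while `PermSystem.trans` assumes closure under the generators only.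
The two agree because a permutation of a finite set has its inverse among its nonnegative powers. -/
theorem permSystem_permTable {σ : Fin d → Equiv.Perm (Fin n)} (h : GeneratesTransitive σ) :
    PermSystem n d (permTable σ) where
  perm _ hj := permBelow_permTable σ hj
  trans U := by
    rintro ⟨p, hp, hU⟩ hcl q hq
    obtain ⟨⟨g, hg⟩, e⟩ := h.exists_smul_eq (⟨p, hp⟩ : Fin n) ⟨q, hq⟩
    have hstep : ∀ j, ∀ i : Fin n, U i → U (σ j i) := by
      intro j i hi
      have := hcl j j.2 i i.2 hi
      rwa [permTable_apply σ j.2 i.2] at this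
    have hback : ∀ j, ∀ i : Fin n, U i → U ((σ j)⁻¹ i) := by
      intro j i hi
      have hpow : ∀ k : ℕ, U ((σ j ^ k) i) := by
        intro k
        induction k with
        | zero => exact hi
        | succ k ih => rw [pow_succ']; exact hstep j _ ih
      have hinv : (σ j)⁻¹ = σ j ^ (orderOf (σ j) - 1) := by
        rw [inv_eq_iff_mul_eq_one, ← pow_succ', Nat.sub_add_cancel (orderOf_pos _), pow_orderOf_eq_one]
      rw [hinv]
      exact hpow _
    have key : ∀ g ∈ Subgroup.closure (Set.range σ), ∀ i : Fin n, U i → U (g i) := by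
      intro g hg
      induction hg using Subgroup.closure_induction'' with
      | mem x hx => obtain ⟨j, rfl⟩ := hx; exact hstep j
      | inv_mem x hx => obtain ⟨j, rfl⟩ := hx; exact hback j
      | one => exact fun i hi => hi
      | mul x y _ _ hx hy => exact fun i hi => hx _ (hy i hi)
    have := key g hg ⟨p, hp⟩ hU
    have e' : g ⟨p, hp⟩ = ⟨q, hq⟩ := e
    rwa [e'] at this

/-- The intertwining map is `τ⁻¹`: from `ρ j = τ⁻¹ * σ j * τ` follows `τ⁻¹ * σ j = ρ j * τ⁻¹`.
Conversely, transitivity makes an equivariant map a permutation, whose inverse conjugates. -/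
theorem simConj_iff {σ ρ : Fin d → Equiv.Perm (Fin n)} (hn : 1 ≤ n) (hσ : GeneratesTransitive σ)
    (hρ : GeneratesTransitive ρ) :
    SimConj σ ρ ↔ ∃ τ, IsEquivariant n d (permTable σ) (permTable ρ) τ := by
  constructor
  · rintro ⟨τ, h⟩
    refine ⟨fun i => if hi : i < n then (τ⁻¹ ⟨i, hi⟩ : Fin n) else 0, fun p hp => ?_,
      fun j hj p hp => ?_⟩
    · rw [dif_pos hp]; exact Fin.is_lt _
    · have h1 := (permBelow_permTable σ hj).lt p hp
      rw [dif_pos h1, dif_pos hp, permTable_apply ρ hj (Fin.is_lt _), h]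
      simp [permTable_apply σ hj hp]
  · rintro ⟨τ, h⟩
    have hinj := h.inj (permSystem_permTable hσ) (permSystem_permTable hρ) hn
    let e : Equiv.Perm (Fin n) := Equiv.ofBijective (fun i => ⟨τ i, h.lt i i.2⟩)
      (Finite.injective_iff_bijective.1 fun i i' hi =>
        Fin.ext (hinj i i.2 i' i'.2 (congrArg Fin.val hi)))
    have he : ∀ i, (e i : ℕ) = τ i := fun i => rfl
    refine ⟨e⁻¹, fun j => ?_⟩
    rw [inv_inv, eq_mul_inv_iff_mul_eq]
    ext i
    have := h.map j j.2 i i.2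
    rw [permTable_apply σ j.2 i.2] at this
    rw [Equiv.Perm.mul_apply, Equiv.Perm.mul_apply, he, this, ← he i, permTable_apply ρ j.2 (Fin.is_lt _)]

theorem iterate_permTable (σ : Fin d → Equiv.Perm (Fin n)) (j : Fin d) (k : ℕ) (i : Fin n) :
    (permTable σ j)^[k] i = ((σ j ^ k) i : Fin n) := by
  induction k with
  | zero => rfl
  | succ k ih =>
    rw [Function.iterate_succ_apply', ih, permTable_apply σ j.2 (Fin.is_lt _), pow_succ',
      Equiv.Perm.mul_apply]

/-- A permutation has as many cycles as there are least elements of cycles. -/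
theorem card_cycleMins (σ : Fin d → Equiv.Perm (Fin n)) (j : Fin d) :
    (cycleMins n (permTable σ j)).card = numCycles (σ j) := by
  classical
  set f := σ j with hf
  have hmem : ∀ i : Fin n, (i : ℕ) ∈ cycleMins n (permTable σ j) ↔
      ∀ i', f.SameCycle i i' → i ≤ i' := by
    intro i
    rw [mem_cycleMins]
    constructor
    · rintro ⟨-, h⟩ i' hs
      obtain ⟨k, -, -, rfl⟩ := hs.exists_pow_eq
      have := h k
      rwa [iterate_permTable] at this
    · refine fun h => ⟨i.2, fun k => ?_⟩
      rw [iterate_permTable]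
      exact h _ ⟨k, by simp [hf]⟩
  have h1 : (cycleMins n (permTable σ j)).card =
      (Finset.univ.filter fun i : Fin n => ∀ i', f.SameCycle i i' → i ≤ i').card := by
    symm
    refine Finset.card_bij (fun i _ => (i : ℕ)) ?_ ?_ ?_
    · intro i hi
      exact (hmem i).2 (by simpa using hi)
    · intro i _ i' _ h; exact Fin.ext h
    · intro p hp
      have hp' := (mem_cycleMins.1 hp).1
      exact ⟨⟨p, hp'⟩, by simpa using (hmem ⟨p, hp'⟩).1 hp, rfl⟩
  -- The least elements are split into fixed points and least elements of nontrivial cycles, as the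
  -- partition consists of the cycle type and a block of ones.
  have h2 := Finset.card_filter_add_card_filter_not (s := Finset.univ.filter fun i : Fin n =>
    ∀ i', f.SameCycle i i' → i ≤ i') (fun i => f i = i)
  have h3 : ((Finset.univ.filter fun i : Fin n =>
      ∀ i', f.SameCycle i i' → i ≤ i').filter fun i => f i = i).card
      = n - f.support.card := by
    have : ((Finset.univ.filter fun i : Fin n =>
      ∀ i', f.SameCycle i i' → i ≤ i').filter fun i => f i = i) = f.supportᶜ := by
      ext i
      simp only [Finset.mem_filter, Finset.mem_univ, true_and, Finset.mem_compl,
        Equiv.Perm.mem_support, not_not, and_iff_right_iff_imp]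
      intro hi i' hs
      exact (hs.eq_of_left hi).le
    rw [this, Finset.card_compl, Fintype.card_fin]
  have h4 : ((Finset.univ.filter fun i : Fin n =>
      ∀ i', f.SameCycle i i' → i ≤ i').filter fun i => ¬ f i = i).card
      = f.cycleFactorsFinset.card := by
    -- A nontrivial cycle corresponds to the least point of its support.
    refine Finset.card_bij (fun i _ => f.cycleOf i) ?_ ?_ ?_
    · intro i hi
      simp only [Finset.mem_filter] at hi
      exact Equiv.Perm.cycleOf_mem_cycleFactorsFinset_iff.2 (Equiv.Perm.mem_support.2 hi.2)
    · intro i hi i' hi' h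
      simp only [Finset.mem_filter, Finset.mem_univ, true_and] at hi hi'
      have hs : f.SameCycle i i' := by
        have : f.cycleOf i i' ≠ i' := by rw [h, Equiv.Perm.cycleOf_apply_self]; exact hi'.2
        exact Equiv.Perm.cycleOf_apply_of_not_sameCycle.mt this |> not_not.1
      exact le_antisymm (hi.1 _ hs) (hi'.1 _ hs.symm)
    · intro c hc
      obtain ⟨hcyc, hcf⟩ := Equiv.Perm.mem_cycleFactorsFinset_iff.1 hc
      have hne : c.support.Nonempty := hcyc.nonempty_support
      have hmin := Finset.min'_mem c.support hne
      set i := c.support.min' hne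
      have hci : c = f.cycleOf i := Equiv.Perm.cycle_is_cycleOf hmin hc
      refine ⟨i, ?_, hci.symm⟩
      have hfi : f i ≠ i := by rw [← hcf i hmin]; exact Equiv.Perm.mem_support.1 hmin
      simp only [Finset.mem_filter, Finset.mem_univ, true_and]
      refine ⟨fun i' hs => Finset.min'_le _ _ ?_, hfi⟩
      rw [hci, Equiv.Perm.mem_support_cycleOf_iff]
      exact ⟨hs, Equiv.Perm.mem_support.2 hfi⟩
  rw [h1, ← h2, h3, h4, numCycles, Equiv.Perm.parts_partition, Multiset.card_add,
    Multiset.card_replicate, Fintype.card_fin, Equiv.Perm.cycleType, Multiset.card_map,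
    Finset.card_val, add_comm]

end Bridge

/-! ### Invariant sets of candidates -/

/-- Every equivariant map matches the sets `S ⊆ {0, …, n - 1}` and `S'`. -/
def Matching (n d : ℕ) (A B : ℕ → ℕ → ℕ) (S S' : ℕ → Prop) : Prop :=
  ∀ τ, IsEquivariant n d A B τ → ∀ p < n, (S p ↔ S' (τ p))

/-- An equivariant map is bijective and restricts to a bijection between the two sets. Used
contrapositively: different sizes refute conjugacy. -/
theorem Matching.card_eq {n d : ℕ} {A B : ℕ → ℕ → ℕ} {S S' : ℕ → Prop} [DecidablePred S]
    [DecidablePred S'] (h : Matching n d A B S S') (hA : PermSystem n d A) (hB : PermSystem n d B)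
    (hn : 1 ≤ n) {τ : ℕ → ℕ} (hτ : IsEquivariant n d A B τ) :
    ((Finset.range n).filter S).card = ((Finset.range n).filter S').card := by
  refine Finset.card_bij (fun p _ => τ p) ?_ ?_ ?_
  · intro p hp
    simp only [Finset.mem_filter, Finset.mem_range] at hp ⊢
    exact ⟨hτ.lt p hp.1, (h τ hτ p hp.1).1 hp.2⟩
  · intro p hp q hq e
    simp only [Finset.mem_filter, Finset.mem_range] at hp hq
    exact hτ.inj hA hB hn p hp.1 q hq.1 e
  · intro q hq
    simp only [Finset.mem_filter, Finset.mem_range] at hq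
    obtain ⟨p, hp, rfl⟩ := hτ.surj hA hB hn hq.1
    exact ⟨p, by simpa [hp] using (h τ hτ p hp).2 hq.2, rfl⟩

/-! ### Doubling tables and counting cycles on the machine -/

namespace WordRAM

/-- Word length `b`, number of rows `r` per segment, `n` points, `d` permutations and `l` levels of
the doubling tables fit together. -/
structure Params (b r n d l : ℕ) : Prop where
  one_lt : 1 < 2 ^ b
  n_lt : n < 2 ^ b
  d_lt : d < 2 ^ b
  l_lt : l < 2 ^ b
  d_le : d ≤ r
  l_lt_r : l < r
  n_pos : 1 ≤ n
  l_pos : 1 ≤ l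
  n_lt_two_pow : n < 2 ^ l

/-- The registers that hold parameters: `0` holds `n`, `1` holds `d`, `2`, `3` and `4` hold `1`, `0`
and `2`, and `6` holds the number of levels of the doubling tables. -/
structure Ctx (b n d l : ℕ) (s : State) : Prop where
  n : s.reg 0 = n
  d : s.reg 1 = d
  one : s.reg 2 = 1
  zero : s.reg 3 = 0
  two : s.reg 4 = 2 % 2 ^ b
  l : s.reg 6 = l

theorem Ctx.of_frame {b n d l : ℕ} {s s' : State} {p : Cmd} (h : Ctx b n d l s) (hF : Frame p s s')
    (hw : (p.writesReg 0 || p.writesReg 1 || p.writesReg 2 || p.writesReg 3 || p.writesReg 4 ||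
      p.writesReg 6) = false := by rfl) : Ctx b n d l s' := by
  simp only [Bool.or_eq_false_iff] at hw
  obtain ⟨⟨⟨⟨⟨h0, h1⟩, h2⟩, h3⟩, h4⟩, h6⟩ := hw
  exact ⟨(hF.reg 0 h0).trans h.n, (hF.reg 1 h1).trans h.d, (hF.reg 2 h2).trans h.one,
    (hF.reg 3 h3).trans h.zero, (hF.reg 4 h4).trans h.two, (hF.reg 6 h6).trans h.l⟩

theorem Ctx.setReg {b n d l : ℕ} {s : State} (h : Ctx b n d l s) (x v : ℕ)
    (hx : x = 5 ∨ 6 < x := by omega) : Ctx b n d l (s.setReg x v) := by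
  constructor <;> rw [State.reg_setReg, if_neg (by omega)]
  exacts [h.n, h.d, h.one, h.zero, h.two, h.l]

theorem Ctx.setMem {b n d l : ℕ} {s : State} (h : Ctx b n d l s) (A i j v : ℕ) :
    Ctx b n d l (s.setMem A i j v) :=
  ⟨h.n, h.d, h.one, h.zero, h.two, h.l⟩

/-- The doubling tables of the permutation in row `J` (register `7`) of segment `G`: iterates in
segment `T`, least elements of initial parts of orbits in segment `4`. -/
def tables (G T : ℕ) : Cmd :=
  .for 12 0 (.load 14 G 7 12 ⨟ .store T 3 12 14 ⨟ .store 4 3 12 12) ⨟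
  .for 13 6 (.op .add 15 13 2 ⨟
    .for 12 0 (.load 14 T 13 12 ⨟ .load 16 T 13 14 ⨟ .store T 15 12 16 ⨟
      .load 16 4 13 12 ⨟ .load 17 4 13 14 ⨟ .op .lt 14 17 16 ⨟
      .ite 14 (.store 4 15 12 17) (.store 4 15 12 16)))

/-- The number of fixed points of the last row of segment `4`. -/
def countCycles (c : ℕ) : Cmd :=
  .const c 0 ⨟ .for 12 0 (.load 14 4 6 12 ⨟ .op .eq 14 14 12 ⨟ .op .add c c 14)

variable {b r n d l : ℕ} {s : State}

/-- Row `i + 1` is computed from row `i` alone, by looking up the `2 ^ i`-th iterate of `p` and then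
the entries there. There are `l + 1` rows, each at linear cost. -/
theorem runs_tables (P : Params b r n d l) (c : Ctx b n d l s) {G T J : ℕ} {F : ℕ → ℕ → ℕ}
    (hJ : s.reg 7 = J) (hJr : J < r) (hG : s.mem G = F) (hf : PermBelow n (F J)) (hGT : G ≠ T)
    (hG4 : G ≠ 4) (hT4 : T ≠ 4) :
    Runs b r n (tables G T) s fun t s' => t ≤ (l + 1) * (11 * n + 7) ∧
      ∀ i ≤ l, ∀ p < n, s'.mem T i p = (F J)^[2 ^ i] p ∧ s'.mem 4 i p = minIterate (F J) i p := by
  have hr : 0 < r := (Nat.zero_le _).trans_lt P.l_lt_r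
  rw [tables, runs_seq]
  refine runs_for P.one_lt (fun k t s₁ => t ≤ 6 * k ∧
    ∀ p < k, s₁.mem T 0 p = F J p ∧ s₁.mem 4 0 p = p) c.n P.n_lt c.one rfl (by decide)
    (fun v => ⟨le_rfl, fun p hp => by omega⟩) ?_ ?_
  · intro k t s₁ hk ⟨ht, hI⟩ hi hF
    have c₁ := c.of_frame hF
    have e7 := (hF.reg 7 rfl).trans hJ
    have eG := (hF.mem G (by simp [Cmd.for, Cmd.writesSeg, hGT, hG4])).trans hG
    simp [c₁.zero, e7, hi, hk, hJr, hr, eG, hT4, hT4.symm]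
    refine ⟨by omega, fun p hp => ?_⟩
    split_ifs with h
    · simp [h]
    · exact hI p (by omega)
  · intro t s₁ ⟨ht, hI⟩ hF
    have c₁ := c.of_frame hF
    refine runs_for P.one_lt (fun k t s₂ => t ≤ (11 * n + 7) * k ∧ ∀ i ≤ k, ∀ p < n,
      s₂.mem T i p = (F J)^[2 ^ i] p ∧ s₂.mem 4 i p = minIterate (F J) i p) c₁.l P.l_lt c₁.one rfl
      (by decide) (fun v => ⟨le_rfl, ?_⟩) ?_ ?_
    · intro i hi p hp
      obtain rfl : i = 0 := by omega
      simpa [minIterate] using hI p hp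
    · intro i t₂ s₂ hil ⟨ht₂, hI₂⟩ hi hF₂
      have c₂ := c₁.of_frame hF₂
      have hi1 : (i + 1) % 2 ^ b = i + 1 := Nat.mod_eq_of_lt (by have := P.l_lt; omega)
      have hl := P.l_lt_r
      rw [runs_seq, runs_add, hi, c₂.one, hi1]
      refine runs_for P.one_lt (fun k t s₃ => t ≤ 11 * k ∧ (∀ i' ≤ i, ∀ p < n,
        s₃.mem T i' p = (F J)^[2 ^ i'] p ∧ s₃.mem 4 i' p = minIterate (F J) i' p) ∧ ∀ p < k,
        s₃.mem T (i + 1) p = (F J)^[2 ^ (i + 1)] p ∧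
          s₃.mem 4 (i + 1) p = minIterate (F J) (i + 1) p) (l := n)
        (by simp [c₂.n]) P.n_lt (by simp [c₂.one]) rfl (by decide)
        (fun v => ⟨le_rfl, hI₂, fun p hp => by omega⟩) ?_ ?_
      · intro k t₃ s₃ hk ⟨ht₃, hI₃, hI₃'⟩ hk' hF₃
        have e13 : s₃.reg 13 = i := (hF₃.reg 13 rfl).trans (by simp [hi])
        have e15 : s₃.reg 15 = i + 1 := (hF₃.reg 15 rfl).trans (by simp)
        obtain ⟨h1, h2⟩ := hI₃ i le_rfl k hk
        have hlt := hf.iterate_lt (2 ^ i) hk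
        obtain ⟨h3, h4⟩ := hI₃ i le_rfl _ hlt
        have hir : i < r := by omega
        have hir1 : i + 1 < r := by omega
        have hne : ∀ i' ≤ i, i' ≠ i + 1 := by omega
        simp [e13, e15, hk', hk, h1, hlt, hir, hir1, runs_lt P.one_lt, hT4, hT4.symm, h2, h3, h4]
        have e2 : (F J)^[2 ^ (i + 1)] k = (F J)^[2 ^ i] ((F J)^[2 ^ i] k) := by
          rw [← Function.iterate_add_apply, ← two_mul, ← pow_succ']
        have em : minIterate (F J) (i + 1) k = if minIterate (F J) i k ≤
            minIterate (F J) i ((F J)^[2 ^ i] k) then minIterate (F J) i k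
            else minIterate (F J) i ((F J)^[2 ^ i] k) := rfl
        split_ifs with hmin
        all_goals
          refine ⟨by omega, fun i' hi' p hp => ?_, fun p hp => ?_⟩
          · simpa [hne i' hi'] using hI₃ i' hi' p hp
          · split_ifs with h
            · subst h
              rw [em]
              simp [hmin, e2]
            · exact hI₃' p (by omega)
      · intro t₃ s₃ ⟨ht₃, hI₃, hI₃'⟩ _ v
        refine ⟨by rw [mul_add]; omega, fun i' hi' p hp => ?_⟩
        rcases Nat.le_succ_iff.1 hi' with h | rfl
        · exact hI₃ i' h p hp
        · exact hI₃' p hp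
    · intro t₂ s₂ ⟨ht₂, hI₂⟩ _
      refine ⟨?_, hI₂⟩
      nlinarith

theorem runs_countCycles (P : Params b r n d l) (c : Ctx b n d l s) {f : ℕ → ℕ}
    (hf : PermBelow n f) (hM : ∀ p < n, s.mem 4 l p = minIterate f l p) {x : ℕ}
    (hx : x = 10 ∨ x = 11) :
    Runs b r n (countCycles x) s fun t s' => t ≤ 6 * n + 4 ∧ s'.reg x = (cycleMins n f).card := by
  have hfix : ∀ p < n, minIterate f l p = p ↔ p ∈ cycleMins n f :=
    fun p hp => hf.minIterate_eq_iff P.n_lt_two_pow.le hp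
  have hl := P.l_lt_r
  rw [countCycles, runs_seq, runs_const]
  refine runs_for P.one_lt (fun k t s₁ => t ≤ 6 * k ∧ s₁.reg x =
    ((Finset.range k).filter fun p => minIterate f l p = p).card) (l := n) ?_ P.n_lt ?_ ?_ (by decide)
    ?_ ?_ ?_
  · rcases hx with rfl | rfl <;> simp [c.n]
  · rcases hx with rfl | rfl <;> simp [c.one]
  · rcases hx with rfl | rfl <;> rfl
  · rcases hx with rfl | rfl <;> simp
  · intro k t s₁ hk ⟨ht, hI⟩ hi hF
    have e6 : s₁.reg 6 = l := by
      rcases hx with rfl | rfl <;> exact (hF.reg 6 rfl).trans (by simp [c.l])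
    have eM : s₁.mem 4 = s.mem 4 := hF.mem 4 rfl
    -- The counter never exceeds `n`, so the word addition does not overflow.
    have hcard : ((Finset.range (k + 1)).filter fun p => minIterate f l p = p).card < 2 ^ b :=
      (Finset.card_filter_le _ _).trans_lt (by have := P.n_lt; rw [Finset.card_range]; omega)
    rw [Finset.range_add_one, Finset.filter_insert] at hcard ⊢
    have hx14 : x ≠ 14 := by omega
    have hx12 : x ≠ 12 := by omega
    have hx5 : x ≠ 5 := by omega
    simp [runs_eq P.one_lt, e6, hi, hl, hk, eM, hM k hk, hI, hx14, hx12, hx5]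
    split_ifs at hcard ⊢ with h
    · rw [Finset.card_insert_of_notMem (by simp)] at hcard ⊢
      exact ⟨by omega, Nat.mod_eq_of_lt hcard⟩
    · exact ⟨by omega, Nat.mod_eq_of_lt hcard⟩
  · intro t s' ⟨ht, hI⟩ _
    refine ⟨by omega, hI.trans (congrArg _ ?_)⟩
    ext p
    simp only [Finset.mem_filter, Finset.mem_range]
    constructor
    · exact fun h => (hfix p h.1).1 h.2
    · exact fun h => ⟨(mem_cycleMins.1 h).1, (hfix p (mem_cycleMins.1 h).1).2 h⟩

end WordRAM

/-! ### Initialization and choice of the permutation with fewest common cycles -/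

namespace WordRAM

/-- Set the parameter registers. -/
def setup : Cmd :=
  .const 2 1 ⨟ .const 3 0 ⨟ .op .add 4 2 2 ⨟ .const 6 0 ⨟ .op .add 14 0 3 ⨟
  .loop 14 (.op .div 14 14 4 ⨟ .op .add 6 6 2)

/-- Count the cycles of permutation number `J` of both systems. -/
def cycleCounts : Cmd :=
  tables 0 2 ⨟ countCycles 10 ⨟ tables 1 3 ⨟ countCycles 11

/-- Find a permutation number with equal and least number of cycles: register `8` receives the
number of cycles, or `0` if there is none, and register `9` the permutation number. -/
def select : Cmd :=
  .const 8 0 ⨟ .for 7 1 (cycleCounts ⨟ .op .eq 14 10 11 ⨟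
    .ite 14
      (.ite 8 (.op .lt 15 10 8 ⨟ .ite 15 (.op .add 8 10 3 ⨟ .op .add 9 7 3) .skip)
        (.op .add 8 10 3 ⨟ .op .add 9 7 3))
      .skip)

variable {b r n d l : ℕ} {s : State}

/-- With one-bit words the constant two is stored as `0`. Division by `0` gives `0`, which is still
`x / 2` for `x < 2`. -/
theorem two_mod_div {b x : ℕ} (hb : 1 < 2 ^ b) (hx : x < 2 ^ b) : x / (2 % 2 ^ b) = x / 2 := by
  rcases Nat.lt_or_ge 2 (2 ^ b) with h | h
  · rw [Nat.mod_eq_of_lt h]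
  · have : 2 ^ b = 2 := by omega
    rw [this] at hx ⊢
    simp; omega

/-- With one-bit words the modulus is `0`, and `x % 0 = x` is still `x % 2` for `x < 2`. -/
theorem two_mod_mod {b x : ℕ} (hb : 1 < 2 ^ b) (hx : x < 2 ^ b) : x % (2 % 2 ^ b) = x % 2 := by
  rcases Nat.lt_or_ge 2 (2 ^ b) with h | h
  · rw [Nat.mod_eq_of_lt h]
  · have : 2 ^ b = 2 := by omega
    rw [this] at hx ⊢
    simp; omega

/-- The number of halvings until zero is the binary length of `q`. The bound on `s.reg 6 + q`
persists because each round adds one to the counter and takes at least one from `q`, so the counter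
cannot overflow. -/
theorem runs_halving (hb : 1 < 2 ^ b) (q : ℕ) : ∀ (s : State), s.reg 14 = q → s.reg 2 = 1 →
    s.reg 4 = 2 % 2 ^ b → s.reg 6 + q < 2 ^ b →
    Runs b r n (.loop 14 (.op .div 14 14 4 ⨟ .op .add 6 6 2)) s fun t s' =>
      t ≤ 3 * (if q = 0 then 0 else Nat.log 2 q + 1) + 1 ∧
      s'.reg 6 = s.reg 6 + (if q = 0 then 0 else Nat.log 2 q + 1) ∧
      ∀ x, x ≠ 14 → x ≠ 6 → s'.reg x = s.reg x := by
  induction q using Nat.strong_induction_on with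
  | _ q ih =>
    intro s hq h1 h2 h6
    rw [runs_loop]
    by_cases h0 : q = 0
    · simp [hq, h0]
    · have e := two_mod_div hb (by omega : q < 2 ^ b)
      have e1 : q / 2 % 2 ^ b = q / 2 := Nat.mod_eq_of_lt (by omega)
      have e2 : (s.reg 6 + 1) % 2 ^ b = s.reg 6 + 1 := Nat.mod_eq_of_lt (by omega)
      simp only [hq, h0, if_false, runs_seq, runs_div, runs_add, h2, e, e1, State.reg_setReg, h1]
      norm_num [e2, h1]
      refine (ih (q / 2) (by omega) _ (by simp) (by simp [h1]) (by simp [h2])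
        (by simp; omega)).mono ?_
      intro t s' ⟨ht, h6', hx⟩
      have hlog : q / 2 ≠ 0 → Nat.log 2 q = Nat.log 2 (q / 2) + 1 :=
        fun h => Nat.log_of_one_lt_of_le (by omega) (by omega)
      have hlog' : q / 2 = 0 → Nat.log 2 q = 0 := fun h => Nat.log_of_lt (by omega)
      refine ⟨?_, ?_, fun x hx14 hx6 => ?_⟩
      · split_ifs at ht with h
        · rw [hlog' (by omega)]; omega
        · rw [hlog (by omega)]; omega
      · rw [h6']
        simp
        split_ifs with h
        · rw [hlog' (by omega)]
        · rw [hlog (by omega)]; omega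
      · rw [hx x hx14 hx6]
        simp [hx14, hx6]

theorem runs_setup (hb : 1 < 2 ^ b) (hn : 1 ≤ n) (hnb : n < 2 ^ b) (h0 : s.reg 0 = n)
    (h1 : s.reg 1 = d) :
    Runs b r n setup s fun t s' => t ≤ 3 * (Nat.log 2 n + 1) + 6 ∧ s'.mem = s.mem ∧
      Ctx b n d (Nat.log 2 n + 1) s' := by
  have e : n % 2 ^ b = n := Nat.mod_eq_of_lt hnb
  have e1 : 1 % 2 ^ b = 1 := Nat.mod_eq_of_lt hb
  rw [setup]
  simp only [runs_seq, runs_const, runs_add]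
  refine (runs_halving hb n _ (by simp [h0, e]) (by simp [e1]) (by simp) (by simp [hnb])).framed ?_
  intro t s' ⟨ht, h6, hx⟩ hF
  rw [if_neg (by omega)] at ht h6
  refine ⟨by omega, ?_, ?_⟩
  · funext A
    exact hF.mem A rfl
  · exact ⟨by simp [hx, h0], by simp [hx, h1], by simp [hx, e1], by simp [hx], by simp [hx],
      by simp [h6]⟩

variable {A B : ℕ → ℕ → ℕ}

/-- Segment `4` is shared, so the count for `A` is taken before the second table overwrites the
minima; the iterates of both systems survive in segments `2` and `3`. -/
theorem runs_cycleCounts (P : Params b r n d l) (c : Ctx b n d l s) {J : ℕ}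
    (hJ : s.reg 7 = J) (hJr : J < r) (hA : s.mem 0 = A) (hB : s.mem 1 = B)
    (hfA : PermBelow n (A J)) (hfB : PermBelow n (B J)) :
    Runs b r n cycleCounts s fun t s' => t ≤ 2 * ((l + 1) * (11 * n + 7) + 6 * n + 4) ∧
      s'.reg 10 = (cycleMins n (A J)).card ∧ s'.reg 11 = (cycleMins n (B J)).card ∧
      ∀ i ≤ l, ∀ p < n, s'.mem 2 i p = (A J)^[2 ^ i] p ∧ s'.mem 3 i p = (B J)^[2 ^ i] p := by
  rw [cycleCounts, runs_seq]
  refine (runs_tables P c hJ hJr hA hfA (by decide) (by decide) (by decide)).framed ?_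
  intro t s₁ ⟨ht, hI⟩ hF
  have c₁ := c.of_frame hF
  rw [runs_seq]
  refine (runs_countCycles P c₁ hfA (fun p hp => (hI l le_rfl p hp).2) (.inl rfl)).framed ?_
  intro t₂ s₂ ⟨ht₂, h10⟩ hF₂
  have c₂ := c₁.of_frame hF₂
  rw [runs_seq]
  refine (runs_tables P c₂ (((hF₂.reg 7 rfl).trans (hF.reg 7 rfl)).trans hJ) hJr
    (((hF₂.mem 1 rfl).trans (hF.mem 1 rfl)).trans hB) hfB
    (by decide) (by decide) (by decide)).framed ?_
  intro t₃ s₃ ⟨ht₃, hI₃⟩ hF₃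
  have c₃ := c₂.of_frame hF₃
  refine (runs_countCycles P c₃ hfB (fun p hp => (hI₃ l le_rfl p hp).2) (.inr rfl)).framed ?_
  intro t₄ s₄ ⟨ht₄, h11⟩ hF₄
  refine ⟨by omega, ?_, h11, fun i hi p hp => ⟨?_, ?_⟩⟩
  · rw [hF₄.reg 10 rfl, hF₃.reg 10 rfl, h10]
  · rw [hF₄.mem 2 rfl, hF₃.mem 2 rfl, hF₂.mem 2 rfl, (hI i hi p hp).1]
  · rw [hF₄.mem 3 rfl, (hI₃ i hi p hp).1]

/-- Among the permutation numbers below `k`, number `i` is one with the same number `c` of cycles in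
both systems and `c` least; there is none if `c = 0`. -/
structure Selected (n : ℕ) (A B : ℕ → ℕ → ℕ) (k c i : ℕ) : Prop where
  none : c = 0 → ∀ j < k, (cycleMins n (A j)).card ≠ (cycleMins n (B j)).card
  lt : c ≠ 0 → i < k
  left : c ≠ 0 → (cycleMins n (A i)).card = c
  right : c ≠ 0 → (cycleMins n (B i)).card = c
  le : c ≠ 0 → ∀ j < k, (cycleMins n (A j)).card = (cycleMins n (B j)).card →
    c ≤ (cycleMins n (A j)).card

theorem Selected.keep {k c i : ℕ} (h : Selected n A B k c i)
    (hk : (cycleMins n (A k)).card = (cycleMins n (B k)).card →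
      c ≠ 0 ∧ c ≤ (cycleMins n (A k)).card) : Selected n A B (k + 1) c i where
  none h0 j hj := by
    rcases Nat.lt_succ_iff_lt_or_eq.1 hj with hj | rfl
    · exact h.none h0 j hj
    · exact fun e => (hk e).1 h0
  lt h0 := (h.lt h0).trans k.lt_succ_self
  left := h.left
  right := h.right
  le h0 j hj e := by
    rcases Nat.lt_succ_iff_lt_or_eq.1 hj with hj | rfl
    · exact h.le h0 j hj e
    · exact (hk e).2

theorem Selected.replace {k c i : ℕ} (h : Selected n A B k c i)
    (hk : (cycleMins n (A k)).card = (cycleMins n (B k)).card) (hpos : (cycleMins n (A k)).card ≠ 0)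
    (hc : c = 0 ∨ (cycleMins n (A k)).card < c) :
    Selected n A B (k + 1) (cycleMins n (A k)).card k where
  none h0 := absurd h0 hpos
  lt _ := k.lt_succ_self
  left _ := rfl
  right _ := hk.symm
  le _ j hj e := by
    rcases Nat.lt_succ_iff_lt_or_eq.1 hj with hj | rfl
    · rcases hc with h0 | hc
      · exact absurd e (h.none h0 j hj)
      · exact hc.le.trans (h.le (by omega) j hj e)
    · exact le_rfl

theorem runs_select (P : Params b r n d l) (c : Ctx b n d l s)
    (hA : s.mem 0 = A) (hB : s.mem 1 = B)
    (hfA : ∀ j < d, PermBelow n (A j)) (hfB : ∀ j < d, PermBelow n (B j)) :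
    Runs b r n select s fun t s' =>
      t ≤ d * (2 * ((l + 1) * (11 * n + 7) + 6 * n + 4) + 12) + 4 ∧
      Selected n A B d (s'.reg 8) (s'.reg 9) := by
  -- Since `n ≥ 1`, every permutation has a cycle, which leaves `0` free as the code for "none
  -- selected".
  have hcard : ∀ j < d, 0 < (cycleMins n (A j)).card ∧ (cycleMins n (A j)).card < 2 ^ b := by
    refine fun j hj => ⟨?_, ?_⟩
    · obtain ⟨k, hk⟩ := (hfA j hj).exists_mem_cycleMins P.n_pos
      exact Finset.card_pos.2 ⟨_, hk⟩
    · refine (Finset.card_le_card fun p hp => ?_).trans_lt ((Finset.card_range n).trans_lt P.n_lt)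
      exact Finset.mem_range.2 (mem_cycleMins.1 hp).1
  have hd := P.d_le
  rw [select, runs_seq, runs_const]
  refine runs_for P.one_lt (fun k t s₁ =>
      t ≤ k * (2 * ((l + 1) * (11 * n + 7) + 6 * n + 4) + 12) ∧
      Selected n A B k (s₁.reg 8) (s₁.reg 9)) (l := d)
      (by simp [c.d]) P.d_lt (by simp [c.one]) rfl (by decide) ?_ ?_ ?_
  · exact fun v => ⟨by simp, ⟨by simp, by simp, by simp, by simp, by simp⟩⟩
  · intro J t s₁ hJ ⟨ht, hI⟩ hJ7 hF
    have c₁ := (c.setReg 8 (0 % 2 ^ b)).of_frame hF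
    rw [runs_seq]
    refine (runs_cycleCounts P c₁ hJ7 (by omega) ((hF.mem 0 rfl).trans hA)
      ((hF.mem 1 rfl).trans hB) (hfA J hJ) (hfB J hJ)).framed ?_
    intro t₂ s₂ ⟨ht₂, h10, h11, _⟩ hF₂
    have e7 := (hF₂.reg 7 rfl).trans hJ7
    have e8 := hF₂.reg 8 rfl
    have e9 := hF₂.reg 9 rfl
    have c₂ := c₁.of_frame hF₂
    have hJb : J % 2 ^ b = J := Nat.mod_eq_of_lt (by have := P.d_lt; omega)
    have hcb := Nat.mod_eq_of_lt (hcard J hJ).2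
    have htt : ∀ x ≤ t₂ + 7, t + x + 3 ≤
        (J + 1) * (2 * ((l + 1) * (11 * n + 7) + 6 * n + 4) + 12) := by
      intro x hx
      rw [add_mul]; omega
    simp only [runs_seq, runs_eq P.one_lt, runs_ite, runs_lt P.one_lt, runs_add, runs_skip]
    norm_num [h10, h11, e7, e8, e9, hJb, hcb, c₂.zero]
    split_ifs with h1 h2 h3
    · exact ⟨htt _ (by omega), hI.replace h1 (hcard J hJ).1.ne' (.inl h2)⟩
    · exact ⟨htt _ (by omega), hI.keep fun _ => ⟨h2, h3⟩⟩
    · exact ⟨htt _ (by omega), hI.replace h1 (hcard J hJ).1.ne' (.inr (by omega))⟩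
    · exact ⟨htt _ (by omega), hI.keep fun h => absurd h h1⟩
  · intro t s' ⟨ht, h⟩ _
    exact ⟨by omega, h⟩

end WordRAM

/-! ### Marking and queueing the points of a cycle -/

/-- `Q 0, …, Q (k - 1)` are the marked points, and `k` is their number. -/
structure IsQueue (n : ℕ) (mk Q : ℕ → ℕ) (k : ℕ) : Prop where
  card : k = ((Finset.range n).filter fun u => mk u ≠ 0).card
  lt : ∀ i < k, Q i < n
  mk_ne : ∀ i < k, mk (Q i) ≠ 0
  surj : ∀ u < n, mk u ≠ 0 → ∃ i < k, Q i = u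

theorem IsQueue.le {n : ℕ} {mk Q : ℕ → ℕ} {k : ℕ} (h : IsQueue n mk Q k) : k ≤ n := by
  rw [h.card]
  exact (Finset.card_filter_le _ _).trans_eq (Finset.card_range n)

theorem IsQueue.push {n : ℕ} {mk Q : ℕ → ℕ} {k q : ℕ} (h : IsQueue n mk Q k) (hq : q < n)
    (h0 : mk q = 0) : IsQueue n (Function.update mk q 1) (Function.update Q k q) (k + 1) := by
  have hne : ∀ i < k, Q i ≠ q := fun i hi e => h.mk_ne i hi (e ▸ h0)
  constructor
  · have : ((Finset.range n).filter fun u => Function.update mk q 1 u ≠ 0) =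
        insert q ((Finset.range n).filter fun u => mk u ≠ 0) := by
      ext u
      by_cases hu : u = q <;> simp [hu, hq, Function.update_apply]
    rw [this, Finset.card_insert_of_notMem (by simp [h0]), ← h.card]
  · intro i hi
    rcases Nat.lt_succ_iff_lt_or_eq.1 hi with hi | rfl
    · rw [Function.update_of_ne hi.ne]; exact h.lt i hi
    · rwa [Function.update_self]
  · intro i hi
    rcases Nat.lt_succ_iff_lt_or_eq.1 hi with hi | rfl
    · rw [Function.update_of_ne hi.ne, Function.update_of_ne (hne i hi)]; exact h.mk_ne i hi
    · simp
  · intro u hu hm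
    by_cases e : u = q
    · exact ⟨k, k.lt_succ_self, by simp [e]⟩
    · rw [Function.update_of_ne e] at hm
      obtain ⟨i, hi, rfl⟩ := h.surj u hu hm
      exact ⟨i, hi.trans k.lt_succ_self, Function.update_of_ne hi.ne _ _⟩

/-- The queue extended by `q` still has at most `n` entries, so the write at position `k` stays in
range. -/
theorem IsQueue.lt_of_eq_zero {n : ℕ} {mk Q : ℕ → ℕ} {k q : ℕ} (h : IsQueue n mk Q k) (hq : q < n)
    (h0 : mk q = 0) : k < n :=
  (h.push hq h0).le

/-- The effect of the first `k` steps of a walk from `v` along the cycle of `f`, in parallel with a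
walk from `v'` along the cycle of `g`: unmarked points are marked, queued, and get the cycle number
`nc`, the number of steps, and the corresponding point on the other walk. -/
structure Walked (n : ℕ) (f g : ℕ → ℕ) (v v' nc : ℕ) (mk₀ ci₀ of₀ ta₀ Q₀ : ℕ → ℕ) (c₀ k : ℕ)
    (mk ci of ta Q : ℕ → ℕ) (c : ℕ) : Prop where
  marked : ∀ u < n, mk u ≠ 0 ↔ mk₀ u ≠ 0 ∨ ∃ i < k, f^[i] v = u
  old : ∀ u < n, mk₀ u ≠ 0 → ci u = ci₀ u ∧ of u = of₀ u ∧ ta u = ta₀ u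
  new : ∀ u < n, mk₀ u = 0 → mk u ≠ 0 →
    ci u = nc ∧ of u < n ∧ f^[of u] v = u ∧ g^[of u] v' = ta u
  queue : IsQueue n mk Q c
  le : c₀ ≤ c
  base_eq : ∀ i < c₀, Q i = Q₀ i

section Walked

variable {n : ℕ} {f g : ℕ → ℕ} {v v' nc : ℕ} {mk₀ ci₀ of₀ ta₀ Q₀ : ℕ → ℕ} {c₀ k : ℕ}
  {mk ci of ta Q : ℕ → ℕ} {c : ℕ}

theorem Walked.zero (h : IsQueue n mk Q c) :
    Walked n f g v v' nc mk ci of ta Q c 0 mk ci of ta Q c where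
  marked u _ := by simp
  old u _ _ := ⟨rfl, rfl, rfl⟩
  new u _ h0 hm := absurd h0 hm
  queue := h
  le := le_rfl
  base_eq _ _ := rfl

/-- Walks always take `n` steps, whatever the cycle length; after the first round they meet only
marked points. -/
theorem Walked.skip (h : Walked n f g v v' nc mk₀ ci₀ of₀ ta₀ Q₀ c₀ k mk ci of ta Q c)
    (hm : mk (f^[k] v) ≠ 0) (hlt : f^[k] v < n) :
    Walked n f g v v' nc mk₀ ci₀ of₀ ta₀ Q₀ c₀ (k + 1) mk ci of ta Q c where
  marked u hu := by
    rw [h.marked u hu]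
    constructor
    · rintro (h | ⟨i, hi, e⟩)
      exacts [.inl h, .inr ⟨i, by omega, e⟩]
    · rintro (h' | ⟨i, hi, e⟩)
      · exact .inl h'
      · rcases Nat.lt_succ_iff_lt_or_eq.1 hi with hi | rfl
        · exact .inr ⟨i, hi, e⟩
        · exact e ▸ (h.marked _ hlt).1 hm
  old := h.old
  new := h.new
  queue := h.queue
  le := h.le
  base_eq := h.base_eq

theorem Walked.mark (h : Walked n f g v v' nc mk₀ ci₀ of₀ ta₀ Q₀ c₀ k mk ci of ta Q c)
    (hm : mk (f^[k] v) = 0) (hlt : f^[k] v < n) (hk : k < n) :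
    Walked n f g v v' nc mk₀ ci₀ of₀ ta₀ Q₀ c₀ (k + 1) (Function.update mk (f^[k] v) 1)
      (Function.update ci (f^[k] v) nc) (Function.update of (f^[k] v) k)
      (Function.update ta (f^[k] v) (g^[k] v')) (Function.update Q c (f^[k] v)) (c + 1) where
  marked u hu := by
    by_cases e : u = f^[k] v
    · simp only [e, Function.update_self]
      exact iff_of_true one_ne_zero (.inr ⟨k, k.lt_succ_self, rfl⟩)
    · rw [Function.update_of_ne e, h.marked u hu]
      refine or_congr Iff.rfl ⟨fun ⟨i, hi, e'⟩ => ⟨i, by omega, e'⟩, fun ⟨i, hi, e'⟩ => ?_⟩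
      rcases Nat.lt_succ_iff_lt_or_eq.1 hi with hi | rfl
      · exact ⟨i, hi, e'⟩
      · exact absurd e'.symm e
  old u hu h0 := by
    have e : u ≠ f^[k] v := fun e => (h.marked u hu).2 (.inl h0) (e ▸ hm)
    simp only [Function.update_of_ne e]
    exact h.old u hu h0
  new u hu h0 hm' := by
    by_cases e : u = f^[k] v
    · simp [e, hk]
    · simp only [Function.update_of_ne e] at hm' ⊢
      exact h.new u hu h0 hm'
  queue := h.queue.push hlt hm
  le := h.le.trans c.le_succ
  base_eq i hi := by rw [Function.update_of_ne (hi.trans_le h.le).ne]; exact h.base_eq i hi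

end Walked

/-! ### The search -/

/-- The state of a search of the system `A` from the point `x`, in parallel with the system `B` from
the point `y`: see `Explored`; `Q` is the queue of marked points. -/
structure Search (n d : ℕ) (A B : ℕ → ℕ → ℕ) (J x y : ℕ) (mk ci of ta pu pj Q : ℕ → ℕ)
    (c nc : ℕ) : Prop where
  explored : Explored n d A B J x y mk ci of ta pu pj nc
  queue : IsQueue n mk Q c
  closed : ∀ u < n, mk u ≠ 0 → mk (A J u) ≠ 0
  card : nc ≤ ((cycleMins n (A J)).filter fun u => mk u ≠ 0).card

section Search

variable {n d : ℕ} {A B : ℕ → ℕ → ℕ} {J x y nc : ℕ} {mk ci of ta pu pj Q : ℕ → ℕ} {c : ℕ}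

theorem Search.empty (hmk : ∀ u < n, mk u = 0) :
    Search n d A B J x y mk ci of ta pu pj Q 0 0 where
  explored := Explored.empty hmk
  queue := by
    refine ⟨?_, by omega, by omega, fun u hu h => absurd (hmk u hu) h⟩
    rw [eq_comm, Finset.card_eq_zero, Finset.filter_eq_empty_iff]
    exact fun u hu => not_not.2 (hmk u (Finset.mem_range.1 hu))
  closed u hu h := absurd (hmk u hu) h
  card := Nat.zero_le _

theorem Search.iterate_ne (S : Search n d A B J x y mk ci of ta pu pj Q c nc)
    (hA : PermBelow n (A J)) {u : ℕ} (hu : u < n) (hm : mk u ≠ 0) (k : ℕ) :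
    mk ((A J)^[k] u) ≠ 0 := by
  induction k with
  | zero => exact hm
  | succ k ih =>
    rw [Function.iterate_succ_apply']
    exact S.closed _ (hA.iterate_lt k hu) ih

/-- The marked set is a union of cycles: were the least point of the cycle of `v` marked, going on
around the cycle would mark `v`. -/
theorem Search.exists_unmarked (S : Search n d A B J x y mk ci of ta pu pj Q c nc)
    (hA : PermBelow n (A J)) {v : ℕ} (hv : v < n) (hm : mk v = 0) :
    ∃ k, (A J)^[k] v ∈ cycleMins n (A J) ∧ mk ((A J)^[k] v) = 0 := by
  obtain ⟨k, hk⟩ := hA.exists_mem_cycleMins hv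
  refine ⟨k, hk, ?_⟩
  by_contra h
  obtain ⟨k', e⟩ := hA.exists_iterate_back hv k
  exact S.iterate_ne hA (hA.iterate_lt k hv) h k' (by rw [e, hm])

/-- The cycle of `v` is missing from those already visited. This bounds the number of walks by the
number of cycles of `A J`, and so brings `λ` into the running time. -/
theorem Search.lt_card (S : Search n d A B J x y mk ci of ta pu pj Q c nc)
    (hA : PermBelow n (A J)) {v : ℕ} (hv : v < n) (hm : mk v = 0) :
    nc < (cycleMins n (A J)).card := by
  obtain ⟨k, hk, h0⟩ := S.exists_unmarked hA hv hm
  refine S.card.trans_lt (Finset.card_lt_card ?_)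
  exact Finset.filter_ssubset.2 ⟨_, hk, not_not.2 h0⟩

theorem card_cycleMins_le (n : ℕ) (f : ℕ → ℕ) : (cycleMins n f).card ≤ n :=
  (Finset.card_le_card fun _ hp => Finset.mem_range.2 (mem_cycleMins.1 hp).1).trans_eq
    (Finset.card_range n)

/-- Since `n` steps cover the whole cycle of `v`, the marked set remains closed under `A J`, and the
least point of that cycle is newly counted in `card`. -/
theorem Search.visit (S : Search n d A B J x y mk ci of ta pu pj Q c nc) (hA : PermBelow n (A J))
    (hB : PermBelow n (B J)) {mk' ci' of' ta' pu' pj' Q' : ℕ → ℕ} {c' v v' : ℕ}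
    (W : Walked n (A J) (B J) v v' nc mk ci of ta Q c n mk' ci' of' ta' Q' c')
    (hv : v < n) (hm : mk v = 0) (hv' : v' < n)
    (ev : v = rootOf A x pu' pj' id nc) (ev' : v' = rootOf B y pu' pj' ta nc)
    (hpu : ∀ i < nc, pu' i = pu i) (hpj : ∀ i < nc, pj' i = pj i)
    (hnc : 0 < nc → pu' nc < n ∧ pj' nc < d ∧ mk (pu' nc) ≠ 0) :
    Search n d A B J x y mk' ci' of' ta' pu' pj' Q' c' (nc + 1) where
  explored := by
    subst ev ev'
    exact S.explored.step hB (fun u hu h0 => ⟨(W.marked u hu).2 (.inl h0), W.old u hu h0⟩) hpu hpj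
      hnc hv' W.new
  queue := W.queue
  closed u hu hm' := by
    have hlt := hA.lt u hu
    rw [W.marked _ hlt]
    rcases (W.marked u hu).1 hm' with h | ⟨i, -, rfl⟩
    · exact .inl (S.closed u hu h)
    · obtain ⟨k, hk, e⟩ := hA.exists_iterate_lt hv (i + 1)
      exact .inr ⟨k, hk, by rw [e, Function.iterate_succ_apply']⟩
  card := by
    obtain ⟨k, hk, h0⟩ := S.exists_unmarked hA hv hm
    have hsub : insert ((A J)^[k] v) ((cycleMins n (A J)).filter fun u => mk u ≠ 0) ⊆
        (cycleMins n (A J)).filter fun u => mk' u ≠ 0 := by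
      intro u hu
      rw [Finset.mem_insert, Finset.mem_filter] at hu
      rw [Finset.mem_filter]
      rcases hu with rfl | hu
      · obtain ⟨k', hk', e⟩ := hA.exists_iterate_lt hv k
        exact ⟨hk, (W.marked _ (hA.iterate_lt k hv)).2 (.inr ⟨k', hk', e⟩)⟩
      · exact ⟨hu.1, (W.marked _ (mem_cycleMins.1 hu.1).1).2 (.inl hu.2)⟩
    refine (Nat.succ_le_succ S.card).trans ?_
    have := Finset.card_le_card hsub
    rwa [Finset.card_insert_of_notMem (by simp [h0])] at this

end Search

/-! ### Parallel search of the two systems -/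

namespace WordRAM

theorem State.mem_setMem_row (s : State) (A i j v A' i' : ℕ) :
    (s.setMem A i j v).mem A' i' =
      if A' = A ∧ i' = i then Function.update (s.mem A i) j v else s.mem A' i' := by
  funext j'
  rw [State.mem_setMem]
  split_ifs with h1 h2 h2
  · obtain ⟨rfl, rfl, rfl⟩ := h1; simp
  · exact absurd ⟨h1.1, h1.2.1⟩ h2
  · rw [Function.update_of_ne fun e => h1 ⟨h2.1, h2.2, e⟩, h2.1, h2.2]
  · rfl

/-- Visit the cycle of the point in register `32`, in parallel with that of the point in register
`33` of the other system. Register `25` holds the length of the queue, register `26` the number of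
cycles. -/
def visit : Cmd :=
  .op .add 34 32 3 ⨟ .op .add 35 33 3 ⨟
  .for 29 0 (.load 36 10 3 34 ⨟
    .ite 36 .skip (.store 10 3 34 2 ⨟ .store 12 3 34 26 ⨟ .store 13 3 34 29 ⨟ .store 14 3 34 35 ⨟
      .store 11 3 25 34 ⨟ .op .add 25 25 2) ⨟
    .load 34 2 3 34 ⨟ .load 35 3 3 35) ⨟
  .op .add 26 26 2

/-- Search the first system from the point in register `20`, in parallel with the second system
from the point in register `21`. -/
def explore : Cmd :=
  .const 25 0 ⨟ .const 26 0 ⨟ .op .add 32 20 3 ⨟ .op .add 33 21 3 ⨟ visit ⨟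
  .for 27 0 (.load 30 11 3 27 ⨟ .load 31 14 3 30 ⨟
    .for 28 1 (.load 32 0 28 30 ⨟ .load 36 10 3 32 ⨟
      .ite 36 .skip (.load 33 1 28 31 ⨟ .store 15 3 26 30 ⨟ .store 16 3 26 28 ⨟ visit)))

variable {b r n d l : ℕ} {s : State} {A B : ℕ → ℕ → ℕ}

/-- The contents of the memory that stay fixed after permutation `J` has been selected: both systems
and their doubling tables. -/
structure Data (n l J : ℕ) (A B : ℕ → ℕ → ℕ) (s : State) : Prop where
  left : s.mem 0 = A
  right : s.mem 1 = B
  pow_left : ∀ i ≤ l, ∀ p < n, s.mem 2 i p = (A J)^[2 ^ i] p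
  pow_right : ∀ i ≤ l, ∀ p < n, s.mem 3 i p = (B J)^[2 ^ i] p

theorem Data.of_mem {J : ℕ} {s s' : State} (h : Data n l J A B s)
    (hm : ∀ i < 4, s'.mem i = s.mem i) : Data n l J A B s' := by
  constructor
  · rw [hm 0 (by omega), h.left]
  · rw [hm 1 (by omega), h.right]
  · rw [hm 2 (by omega)]; exact h.pow_left
  · rw [hm 3 (by omega)]; exact h.pow_right

theorem Data.of_frame {J : ℕ} {s s' : State} {p : Cmd} (h : Data n l J A B s) (hF : Frame p s s')
    (hw : (p.writesSeg 0 || p.writesSeg 1 || p.writesSeg 2 || p.writesSeg 3) = false := by rfl) :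
    Data n l J A B s' := by
  simp only [Bool.or_eq_false_iff] at hw
  obtain ⟨⟨⟨h0, h1⟩, h2⟩, h3⟩ := hw
  refine h.of_mem fun i hi => hF.mem i ?_
  interval_cases i <;> assumption

theorem Data.setReg {J : ℕ} {s : State} (h : Data n l J A B s) (x v : ℕ) :
    Data n l J A B (s.setReg x v) :=
  h.of_mem fun _ _ => rfl

theorem Data.setMem {J : ℕ} {s : State} (h : Data n l J A B s) (X i j v : ℕ)
    (hX : 4 ≤ X := by omega) : Data n l J A B (s.setMem X i j v) := by
  refine h.of_mem fun k hk => ?_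
  funext i' j'
  rw [State.mem_setMem, if_neg (by omega)]

theorem runs_visit (P : Params b r n d l) (c : Ctx b n d l s) {J v v' k nc : ℕ}
    (D : Data n l J A B s) (hA : PermBelow n (A J)) (hB : PermBelow n (B J))
    (hv : s.reg 32 = v) (hv' : s.reg 33 = v') (hk : s.reg 25 = k) (hnc : s.reg 26 = nc)
    (hvn : v < n) (hvn' : v' < n) (hncn : nc < n)
    (hQ : IsQueue n (s.mem 10 0) (s.mem 11 0) k) :
    Runs b r n visit s fun t s' => t ≤ 13 * n + 6 ∧ s'.reg 26 = nc + 1 ∧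
      Walked n (A J) (B J) v v' nc (s.mem 10 0) (s.mem 12 0) (s.mem 13 0) (s.mem 14 0) (s.mem 11 0)
        k n (s'.mem 10 0) (s'.mem 12 0) (s'.mem 13 0) (s'.mem 14 0) (s'.mem 11 0) (s'.reg 25) := by
  have hr : 0 < r := (Nat.zero_le _).trans_lt P.l_lt_r
  have hnb := P.n_lt
  have ev : v % 2 ^ b = v := Nat.mod_eq_of_lt (by omega)
  have ev' : v' % 2 ^ b = v' := Nat.mod_eq_of_lt (by omega)
  have enc : (nc + 1) % 2 ^ b = nc + 1 := Nat.mod_eq_of_lt (by omega)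
  rw [visit, runs_seq, runs_add, runs_seq, runs_add, runs_seq]
  refine runs_for P.one_lt (fun i t s₁ => t ≤ 13 * i ∧ s₁.reg 34 = (A J)^[i] v ∧
      s₁.reg 35 = (B J)^[i] v' ∧
      Walked n (A J) (B J) v v' nc (s.mem 10 0) (s.mem 12 0) (s.mem 13 0) (s.mem 14 0) (s.mem 11 0)
        k i (s₁.mem 10 0) (s₁.mem 12 0) (s₁.mem 13 0) (s₁.mem 14 0) (s₁.mem 11 0) (s₁.reg 25))
    (l := n) (by simp [c.n]) P.n_lt (by simp [c.one]) rfl (by decide) ?_ ?_ ?_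
  · intro w
    refine ⟨le_rfl, by simp [hv, c.zero, ev], by simp [hv', c.zero, ev'], ?_⟩
    simp only [State.reg_setReg, State.mem_setReg]
    norm_num [hk]
    exact Walked.zero hQ
  · intro i t s₁ hi ⟨ht, h34, h35, hW⟩ h29 hF
    have c₁ := ((c.setReg 34 _).setReg 35 _).of_frame hF
    have D₁ : Data n l J A B s₁ := ((D.setReg 34 _).setReg 35 _).of_frame hF
    have h26 : s₁.reg 26 = nc := (hF.reg 26 rfl).trans (by simp [hnc])
    have hlt := hA.iterate_lt i hvn
    have hlt' := hB.iterate_lt i hvn'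
    -- Row `0` of a doubling table is the permutation itself.
    have e2 := D₁.pow_left 0 (Nat.zero_le _) _ hlt
    have e3 := D₁.pow_right 0 (Nat.zero_le _) _ hlt'
    rw [pow_zero, Function.iterate_one] at e2 e3
    simp [c₁.zero, c₁.one, h34, h35, hr, hlt, hlt', State.mem_setMem_row, h29, h26, e2, e3,
      Function.iterate_succ_apply', -Function.iterate_succ]
    split_ifs with h0
    · have hc := hW.queue.lt_of_eq_zero hlt h0
      have ec : (s₁.reg 25 + 1) % 2 ^ b = s₁.reg 25 + 1 := Nat.mod_eq_of_lt (by omega)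
      rw [ec]
      exact ⟨hc, by omega, hW.mark h0 hlt hi⟩
    · exact ⟨by omega, hW.skip h0 hlt⟩
  · intro t s₁ ⟨ht, _, _, hW⟩ hF
    have c₁ := ((c.setReg 34 _).setReg 35 _).of_frame hF
    have h26 : s₁.reg 26 = nc := (hF.reg 26 rfl).trans (by simp [hnc])
    simp [c₁.one, h26, enc]
    exact ⟨by omega, hW⟩

/-- Each pair of a point and a generator is inspected once at constant cost, and a full walk is
charged only to a new cycle: hence `O(n d)` plus `O(n)` per cycle. Transitivity ensures that all
points are reached. -/
theorem runs_explore (P : Params b r n d l) (c : Ctx b n d l s) {J x y : ℕ}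
    (D : Data n l J A B s) (hA : PermSystem n d A) (hB : PermSystem n d B) (hJ : J < d)
    (hx : s.reg 20 = x) (hy : s.reg 21 = y) (hxn : x < n) (hyn : y < n)
    (hmk : ∀ u < n, s.mem 10 0 u = 0) :
    Runs b r n explore s fun t s' => t ≤ n * (9 * d + 8) + (13 * n + 10) * s'.reg 26 + 10 ∧
      Search n d A B J x y (s'.mem 10 0) (s'.mem 12 0) (s'.mem 13 0) (s'.mem 14 0) (s'.mem 15 0)
        (s'.mem 16 0) (s'.mem 11 0) (s'.reg 25) (s'.reg 26) ∧ 0 < s'.reg 26 ∧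
      ∀ u < n, s'.mem 10 0 u ≠ 0 := by
  have hr : 0 < r := (Nat.zero_le _).trans_lt P.l_lt_r
  have hnb := P.n_lt
  have hAJ := hA.perm J hJ
  have hBJ := hB.perm J hJ
  have ex : x % 2 ^ b = x := Nat.mod_eq_of_lt (by omega)
  have ey : y % 2 ^ b = y := Nat.mod_eq_of_lt (by omega)
  have S₀ := Search.empty (d := d) (A := A) (B := B) (J := J) (x := x) (y := y) (ci := s.mem 12 0)
    (of := s.mem 13 0) (ta := s.mem 14 0) (pu := s.mem 15 0) (pj := s.mem 16 0) (Q := s.mem 11 0)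
    hmk
  rw [explore, runs_seq, runs_const, runs_seq, runs_const, runs_seq, runs_add, runs_seq, runs_add,
    runs_seq]
  refine (runs_visit P ((((c.setReg 25 _).setReg 26 _).setReg 32 _).setReg 33 _) (v := x) (v' := y)
    (k := 0) (nc := 0) ((((D.setReg 25 _).setReg 26 _).setReg 32 _).setReg 33 _) hAJ hBJ (by simp [hx, c.zero, ex])
    (by simp [hy, c.zero, ey]) (by simp) (by simp) hxn hyn P.n_pos S₀.queue).framed ?_
  intro t s₁ ⟨ht, h26, W⟩ hF
  have c₁ := ((((c.setReg 25 _).setReg 26 _).setReg 32 _).setReg 33 _).of_frame hF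
  have D₁ : Data n l J A B s₁ := ((((D.setReg 25 _).setReg 26 _).setReg 32 _).setReg 33 _).of_frame hF
  have S₁ := S₀.visit hAJ hBJ W hxn (hmk x hxn) hyn (pu' := s₁.mem 15 0) (pj' := s₁.mem 16 0)
    rfl rfl (by omega) (by omega) (by omega)
  rw [← h26] at S₁
  have hx₁ : s₁.mem 10 0 x ≠ 0 := (W.marked x hxn).2 (.inr ⟨0, by omega, rfl⟩)
  -- The time of the first walk lies outside this loop but its cycle is counted in register `26`;
  -- the summand on the left offsets it.
  refine runs_for P.one_lt (fun h t s₂ => t + (13 * n + 10) ≤ h * (9 * d + 8) +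
      (13 * n + 10) * s₂.reg 26 ∧
      Search n d A B J x y (s₂.mem 10 0) (s₂.mem 12 0) (s₂.mem 13 0) (s₂.mem 14 0) (s₂.mem 15 0)
        (s₂.mem 16 0) (s₂.mem 11 0) (s₂.reg 25) (s₂.reg 26) ∧ 0 < s₂.reg 26 ∧
      s₂.mem 10 0 x ≠ 0 ∧ h ≤ s₂.reg 25 ∧
      ∀ i < h, ∀ j < d, s₂.mem 10 0 (A j (s₂.mem 11 0 i)) ≠ 0)
    c₁.n P.n_lt c₁.one rfl (by decide) ?_ ?_ ?_
  · intro w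
    refine ⟨?_, S₁, ?_, hx₁, Nat.zero_le _, by omega⟩
    · simp [h26]
    · simp [h26]
  · intro h t₂ s₂ hh ⟨ht₂, S₂, hpos₂, hx₂, hle₂, hdone₂⟩ h27 hF₂
    have c₂ := c₁.of_frame hF₂
    have D₂ := D₁.of_frame hF₂
    -- The queue cannot run dry early: if all marked points had been processed, the marked set would
    -- be closed under every `A j`, hence everything, and the queue would have length `n > h`.
    have hlt : h < s₂.reg 25 := by
      refine lt_of_le_of_ne hle₂ fun e => ?_
      have hall := hA.trans (fun u => u < n ∧ s₂.mem 10 0 u ≠ 0) ⟨x, hxn, hxn, hx₂⟩ (by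
        rintro j hj u - ⟨hu, hm⟩
        obtain ⟨i, hi, rfl⟩ := S₂.queue.surj u hu hm
        exact ⟨(hA.perm j hj).lt _ hu, hdone₂ i (by omega) j hj⟩)
      have := S₂.queue.card
      rw [Finset.filter_true_of_mem fun u hu => (hall u (Finset.mem_range.1 hu)).2,
        Finset.card_range] at this
      omega
    have hun := S₂.queue.lt h hlt
    have hum := S₂.queue.mk_ne h hlt
    obtain ⟨u, hu⟩ : ∃ u, s₂.mem 11 0 h = u := ⟨_, rfl⟩
    obtain ⟨u', hu'⟩ : ∃ u', s₂.mem 14 0 u = u' := ⟨_, rfl⟩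
    rw [hu] at hun hum
    simp only [runs_seq, runs_load, State.reg_setReg, State.mem_setReg]
    norm_num [c₂.zero, h27, hu, hu', hr, hh, hun]
    refine runs_for P.one_lt (fun j t s₃ => t + (13 * n + 10) * s₂.reg 26 ≤ j * 9 +
        (13 * n + 10) * s₃.reg 26 ∧
      Search n d A B J x y (s₃.mem 10 0) (s₃.mem 12 0) (s₃.mem 13 0) (s₃.mem 14 0) (s₃.mem 15 0)
        (s₃.mem 16 0) (s₃.mem 11 0) (s₃.reg 25) (s₃.reg 26) ∧ 0 < s₃.reg 26 ∧
      (∀ v < n, s₂.mem 10 0 v ≠ 0 → s₃.mem 10 0 v ≠ 0) ∧ h < s₃.reg 25 ∧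
      (∀ i ≤ h, s₃.mem 11 0 i = s₂.mem 11 0 i) ∧ s₃.mem 14 0 u = u' ∧
      ∀ j' < j, s₃.mem 10 0 (A j' u) ≠ 0) (l := d)
      (by simp [c₂.d]) P.d_lt (by simp [c₂.one]) rfl (by decide) ?_ ?_ ?_
    · intro w
      simpa using ⟨S₂, hpos₂, hlt, hu'⟩
    · intro j t₃ s₃ hj ⟨ht₃, S₃, hpos₃, hmono, hlt₃, hQ, hta, hdone⟩ h28 hF₃
      have c₃ := ((c₂.setReg 30 _).setReg 31 _).of_frame hF₃
      have D₃ : Data n l J A B s₃ := ((D₂.setReg 30 _).setReg 31 _).of_frame hF₃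
      have h30 : s₃.reg 30 = u := (hF₃.reg 30 rfl).trans (by simp)
      have h31 : s₃.reg 31 = u' := (hF₃.reg 31 rfl).trans (by simp)
      have hjr : j < r := hj.trans_le P.d_le
      have hvn := (hA.perm j hj).lt u hun
      have hum₃ := hmono u hun hum
      have hu'n : u' < n := hta ▸ S₃.explored.ta_lt u hun hum₃
      have hvn' := (hB.perm j hj).lt u' hu'n
      simp only [runs_seq, runs_load, runs_ite, runs_skip, State.reg_setReg, State.mem_setReg]
      norm_num [c₃.zero, h28, h30, h31, hjr, hun, hvn, hr, D₃.left, D₃.right, hu'n]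
      split_ifs with hm
      -- An unmarked point leaves a free cycle number below `n`, so the tree arrays are not overrun.
      · have hcard := S₃.lt_card hAJ hvn hm
        have hncn := hcard.trans_le (card_cycleMins_le n (A J))
        refine ⟨hncn, ?_⟩
        refine (runs_visit P (((((c₃.setReg 32 _).setReg 36 _).setReg 33 _).setMem 15 _ _ _).setMem
          16 _ _ _) (((((D₃.setReg 32 _).setReg 36 _).setReg 33 _).setMem 15 _ _ _).setMem
          16 _ _ _) hAJ hBJ (v := A j u) (v' := B j u') (k := s₃.reg 25) (nc := s₃.reg 26)
          (by simp) (by simp) (by simp) (by simp) hvn hvn' hncn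
          (by simpa [State.mem_setMem_row] using S₃.queue)).framed ?_
        intro t₄ s₄ ⟨ht₄, h26, W⟩ hF₄
        simp [State.mem_setMem_row] at W
        have e15 : s₄.mem 15 0 = Function.update (s₃.mem 15 0) (s₃.reg 26) u := by
          rw [hF₄.mem 15 rfl]; simp [State.mem_setMem_row]
        have e16 : s₄.mem 16 0 = Function.update (s₃.mem 16 0) (s₃.reg 26) j := by
          rw [hF₄.mem 16 rfl]; simp [State.mem_setMem_row]
        have hmono₄ : ∀ v < n, s₃.mem 10 0 v ≠ 0 → s₄.mem 10 0 v ≠ 0 :=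
          fun v hv h => (W.marked v hv).2 (.inl h)
        have S₄ := S₃.visit hAJ hBJ W hvn hm hvn' (pu' := s₄.mem 15 0) (pj' := s₄.mem 16 0)
          (by simp [rootOf, e15, e16, hpos₃.ne']) (by simp [rootOf, e15, e16, hpos₃.ne', hta])
          (fun i hi => by simp [e15, hi.ne]) (fun i hi => by simp [e16, hi.ne])
          (fun _ => by simpa [e15, e16] using ⟨hun, hj, hum₃⟩)
        rw [h26]
        refine ⟨by rw [mul_add]; omega, S₄, by omega, fun v hv h => hmono₄ v hv (hmono v hv h),
          hlt₃.trans_le W.le, fun i hi => ?_, ?_, fun j' hj' => ?_⟩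
        · rw [W.base_eq i (by omega), hQ i hi]
        · rw [(W.old u hun hum₃).2.2, hta]
        · rcases Nat.lt_or_eq_of_le hj' with hj' | rfl
          · exact hmono₄ _ ((hA.perm j' (by omega)).lt u hun) (hdone j' hj')
          · exact (W.marked _ hvn).2 (.inr ⟨0, by omega, rfl⟩)
      · refine ⟨by omega, S₃, hpos₃, hmono, hlt₃, hQ, hta, fun j' hj' => ?_⟩
        rcases Nat.lt_or_eq_of_le hj' with hj' | rfl
        · exact hdone j' hj'
        · exact hm
    · intro t₃ s₃ ⟨ht₃, S₃, hpos₃, hmono, hlt₃, hQ, hta, hdone⟩ hF₃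
      refine ⟨?_, S₃, hpos₃, hmono x hxn hx₂, hlt₃, fun i hi j hj => ?_⟩
      · rw [add_mul]
        omega
      · rw [hQ i (by omega)]
        rcases Nat.lt_or_eq_of_le hi with hi | rfl
        · exact hmono _ ((hA.perm j hj).lt _ (S₂.queue.lt i (by omega))) (hdone₂ i hi j hj)
        · rw [hu]; exact hdone j hj
  · intro t₂ s₂ ⟨ht₂, S₂, hpos₂, hx₂, hle₂, hdone₂⟩ hF₂
    refine ⟨by omega, S₂, hpos₂, fun u hu => ?_⟩
    have hc := S₂.queue.card
    have h1 := Finset.card_filter_le (Finset.range n) fun u => s₂.mem 10 0 u ≠ 0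
    rw [Finset.card_range] at h1
    -- The queue has reached length `n`, so no point is left unmarked.
    have h2 := Finset.card_filter_eq_iff.1 (hc.symm.trans (le_antisymm (hc.trans_le h1) hle₂ |>.trans
      (Finset.card_range n).symm))
    exact h2 u (Finset.mem_range.2 hu)

end WordRAM

instance (G : ℕ → ℕ → ℕ) (J : ℕ) (pu pj ci of : ℕ → ℕ) (nc j u v q : ℕ) :
    Decidable (Related G J pu pj ci of nc j u v q) :=
  inferInstanceAs (Decidable (_ = _))

/-! ### Verifying the map and evaluating relations in relative coordinates -/

namespace WordRAM

/-- Test whether the map in segment `14` is equivariant. Otherwise register `37` is set, and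
registers `38` and `39` receive a point and a permutation number where it is not. -/
def verify : Cmd :=
  .const 37 0 ⨟ .for 27 0 (.load 31 14 3 27 ⨟ .for 28 1 (.load 32 0 28 27 ⨟ .load 33 14 3 32 ⨟
    .load 36 1 28 31 ⨟ .op .eq 36 33 36 ⨟
    .ite 36 .skip (.const 37 1 ⨟ .op .add 38 27 3 ⨟ .op .add 39 28 3)))

/-- The point with the coordinates of the point in register `30`, with doubling table `T`; the
result goes to register `42`. -/
def locateCmd (T : ℕ) : Cmd :=
  .load 43 13 3 30 ⨟ .load 44 12 3 30 ⨟ .load 42 17 3 44 ⨟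
  .for 13 6 (.op .mod 45 43 4 ⨟ .ite 45 (.load 42 T 13 42) .skip ⨟ .op .div 43 43 4)

/-- Test the relation given by registers `38` and `39` at the root in register `40`, in the system
`G` with doubling table `T`; the result goes to register `36`. -/
def evalRelated (G T : ℕ) : Cmd :=
  .for 41 26 (.ite 41 (.load 30 15 3 41 ⨟ .load 47 16 3 41 ⨟ locateCmd T ⨟ .load 42 G 47 42 ⨟
    .store 17 3 41 42) (.store 17 3 41 40)) ⨟
  .op .add 30 38 3 ⨟ locateCmd T ⨟ .load 48 G 39 42 ⨟
  .load 30 0 39 38 ⨟ locateCmd T ⨟ .op .eq 36 48 42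

variable {b r n d l : ℕ} {s : State} {A B : ℕ → ℕ → ℕ}

theorem Params.r_pos (P : Params b r n d l) : 0 < r := (Nat.zero_le _).trans_lt P.l_lt_r

theorem runs_verify (P : Params b r n d l) (c : Ctx b n d l s) {J : ℕ} (D : Data n l J A B s)
    (hA : ∀ j < d, PermBelow n (A j)) {ta : ℕ → ℕ} (hta : s.mem 14 0 = ta)
    (hlt : ∀ u < n, ta u < n) :
    Runs b r n verify s fun t s' => t ≤ n * (11 * d + 7) + 4 ∧
      (s'.reg 37 = 0 → IsEquivariant n d A B ta) ∧
      (s'.reg 37 ≠ 0 → s'.reg 38 < n ∧ s'.reg 39 < d ∧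
        ta (A (s'.reg 39) (s'.reg 38)) ≠ B (s'.reg 39) (ta (s'.reg 38))) := by
  have hr := P.r_pos
  have hb := P.one_lt
  have hnb := P.n_lt
  have hdb := P.d_lt
  have hdr := P.d_le
  rw [verify, runs_seq, runs_const]
  refine runs_for hb (fun h t s₁ => t ≤ h * (11 * d + 7) ∧
      (s₁.reg 37 = 0 → ∀ u < h, ∀ j < d, ta (A j u) = B j (ta u)) ∧
      (s₁.reg 37 ≠ 0 → s₁.reg 38 < n ∧ s₁.reg 39 < d ∧
        ta (A (s₁.reg 39) (s₁.reg 38)) ≠ B (s₁.reg 39) (ta (s₁.reg 38))))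
    (l := n) (by simp [c.n]) P.n_lt (by simp [c.one]) rfl (by decide) (fun v => by simp) ?_ ?_
  · intro u t s₁ hu ⟨ht, hI, hI'⟩ h27 hF
    have c₁ := (c.setReg 37 _).of_frame hF
    have D₁ : Data n l J A B s₁ := (D.setReg 37 _).of_frame hF
    have e14 : s₁.mem 14 0 = ta := by rw [hF.mem 14 rfl]; exact hta
    rw [runs_seq, runs_load]
    refine ⟨by rwa [c₁.zero], by rwa [h27], ?_⟩
    rw [c₁.zero, h27, e14]
    refine runs_for hb (fun j t s₂ => t ≤ j * 11 ∧
      (s₂.reg 37 = 0 → (∀ u' < u, ∀ j < d, ta (A j u') = B j (ta u')) ∧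
        ∀ j' < j, ta (A j' u) = B j' (ta u)) ∧
      (s₂.reg 37 ≠ 0 → s₂.reg 38 < n ∧ s₂.reg 39 < d ∧
        ta (A (s₂.reg 39) (s₂.reg 38)) ≠ B (s₂.reg 39) (ta (s₂.reg 38)))) (l := d)
      (by simp [c₁.d]) P.d_lt (by simp [c₁.one]) rfl (by decide) ?_ ?_ ?_
    · intro v
      simpa using ⟨hI, hI'⟩
    · intro j t₂ s₂ hj ⟨ht₂, hI₂, hI₂'⟩ h28 hF₂
      have c₂ := (c₁.setReg 31 _).of_frame hF₂
      have D₂ : Data n l J A B s₂ := (D₁.setReg 31 _).of_frame hF₂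
      have e14₂ : s₂.mem 14 0 = ta := by rw [hF₂.mem 14 rfl]; exact e14
      have e27 : s₂.reg 27 = u := (hF₂.reg 27 rfl).trans (by simp [h27])
      have e31 : s₂.reg 31 = ta u := (hF₂.reg 31 rfl).trans (by simp)
      have hjr : j < r := by omega
      have hA1 := (hA j hj).lt u hu
      have hb1 : 1 % 2 ^ b = 1 := Nat.mod_eq_of_lt hb
      have hb2 : u % 2 ^ b = u := Nat.mod_eq_of_lt (by omega)
      have hb3 : j % 2 ^ b = j := Nat.mod_eq_of_lt (by omega)
      simp [runs_eq hb, h28, e27, c₂.zero, hjr, hu, D₂.left, D₂.right, hr, hA1, e31, hlt, e14₂, hb1,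
        hb2, hb3]
      split_ifs with h
      · refine ⟨by omega, fun h0 => ?_, hI₂'⟩
        refine ⟨(hI₂ h0).1, fun j' hj' => ?_⟩
        rcases Nat.lt_or_eq_of_le hj' with hj' | rfl
        exacts [(hI₂ h0).2 j' hj', h]
      · exact ⟨by omega, hj, h⟩
    · intro t₂ s₂ ⟨ht₂, hI₂, hI₂'⟩ _ v
      refine ⟨?_, fun h0 u' hu' => ?_, hI₂'⟩
      · rw [add_mul]; omega
      · rcases Nat.lt_succ_iff_lt_or_eq.1 hu' with hu' | rfl
        exacts [(hI₂ h0).1 u' hu', (hI₂ h0).2]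
  · intro t s' ⟨ht, hI, hI'⟩ _
    exact ⟨by omega, fun h0 => ⟨hlt, fun j hj p hp => hI h0 p hp j hj⟩, hI'⟩

/-- The offset `k` is applied through its binary digits: each digit `1` at position `m` contributes
a jump by the `2 ^ m`-th iterate. This replaces up to `n` steps by `O(log n)`. -/
theorem runs_locate (P : Params b r n d l) (c : Ctx b n d l s) {T u k i w : ℕ} {f : ℕ → ℕ}
    (hf : PermBelow n f) (hT : ∀ i ≤ l, ∀ p < n, s.mem T i p = f^[2 ^ i] p)
    (hu : s.reg 30 = u) (hun : u < n) (hk : s.mem 13 0 u = k) (hkn : k < n)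
    (hi : s.mem 12 0 u = i) (hin : i < n) (hw : s.mem 17 0 i = w) (hwn : w < n) :
    Runs b r n (locateCmd T) s fun t s' => t ≤ 7 * l + 6 ∧ s'.reg 42 = f^[k] w := by
  have hr := P.r_pos
  have hnb := P.n_lt
  rw [locateCmd, runs_seq, runs_load, runs_seq, runs_load, runs_seq, runs_load]
  norm_num [c.zero, hu, hr, hun, hk, hi, hin, hw]
  refine runs_for P.one_lt (fun m t s₁ => t ≤ 7 * m ∧ s₁.reg 43 = k / 2 ^ m ∧
    s₁.reg 42 = f^[k % 2 ^ m] w) (l := l) (by simp [c.l]) P.l_lt (by simp [c.one]) rfl (by decide)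
    (fun v => by simp [Nat.mod_one]) ?_ ?_
  · intro m t s₁ hm ⟨ht, h43, h42⟩ h13 hF
    have c₁ := (((c.setReg 43 _).setReg 44 _).setReg 42 _).of_frame hF
    have eT : s₁.mem T = s.mem T := hF.mem T rfl
    have hmr : m < r := hm.trans P.l_lt_r
    have hwn' := hf.iterate_lt (k % 2 ^ m) hwn
    have hkm : k / 2 ^ m < 2 ^ b := (Nat.div_le_self _ _).trans_lt (by omega)
    have e1 := two_mod_mod P.one_lt hkm
    have e2 := two_mod_div P.one_lt hkm
    have e3 : k / 2 ^ m % 2 % 2 ^ b = k / 2 ^ m % 2 :=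
      Nat.mod_eq_of_lt ((Nat.mod_le _ _).trans_lt hkm)
    have e4 : k / 2 ^ m / 2 % 2 ^ b = k / 2 ^ m / 2 :=
      Nat.mod_eq_of_lt ((Nat.div_le_self _ _).trans_lt hkm)
    have e5 : k / 2 ^ m / 2 = k / 2 ^ (m + 1) := by rw [Nat.div_div_eq_div_mul, pow_succ]
    simp only [runs_seq, runs_mod, runs_ite, runs_div, runs_load, runs_skip, State.reg_setReg,
      State.mem_setReg, h43, c₁.two, e1, e3, h42, h13]
    norm_num [h43, h42, h13, c₁.two, e2, e4, hmr, hwn', eT, hT m hm.le]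
    -- Splits digit `m` off the low part of `k`.
    have e6 := Nat.mod_pow_succ (b := 2) (k := m) (x := k)
    split_ifs with h
    · rw [h, mul_zero, add_zero] at e6
      exact ⟨by omega, e5, by rw [e6]⟩
    · rw [show k / 2 ^ m % 2 = 1 by omega, mul_one, add_comm (k % 2 ^ m)] at e6
      exact ⟨by omega, e5, by rw [e6, Function.iterate_add_apply]⟩
  · intro t s' ⟨ht, _, h42⟩ _
    -- All digits have been read, as `k < n < 2 ^ l`.
    rw [h42, Nat.mod_eq_of_lt (hkn.trans P.n_lt_two_pow)]
    exact ⟨by omega, rfl⟩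

/-- The contents of the memory after a search: coordinates and a cycle tree. -/
structure Coords (n d : ℕ) (nc : ℕ) (pu pj ci of : ℕ → ℕ) (s : State) : Prop where
  nc_eq : s.reg 26 = nc
  pu_eq : s.mem 15 0 = pu
  pj_eq : s.mem 16 0 = pj
  ci_eq : s.mem 12 0 = ci
  of_eq : s.mem 13 0 = of
  tree : IsCycleTree n d pu pj ci nc
  ci_lt : ∀ u < n, ci u < nc
  of_lt : ∀ u < n, of u < n
  nc_le : nc ≤ n

theorem Coords.of_frame {nc : ℕ} {pu pj ci of : ℕ → ℕ} {s s' : State} {p : Cmd}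
    (h : Coords n d nc pu pj ci of s) (hF : Frame p s s')
    (hw : (p.writesReg 26 || p.writesSeg 15 || p.writesSeg 16 || p.writesSeg 12 || p.writesSeg 13) =
      false := by rfl) : Coords n d nc pu pj ci of s' := by
  simp only [Bool.or_eq_false_iff] at hw
  obtain ⟨⟨⟨⟨h26, h15⟩, h16⟩, h12⟩, h13⟩ := hw
  exact { h with
    nc_eq := (hF.reg 26 h26).trans h.nc_eq
    pu_eq := by rw [hF.mem 15 h15, h.pu_eq]
    pj_eq := by rw [hF.mem 16 h16, h.pj_eq]
    ci_eq := by rw [hF.mem 12 h12, h.ci_eq]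
    of_eq := by rw [hF.mem 13 h13, h.of_eq] }

theorem Coords.setReg {nc : ℕ} {pu pj ci of : ℕ → ℕ} (h : Coords n d nc pu pj ci of s) (x v : ℕ)
    (hx : 26 ≠ x := by omega) : Coords n d nc pu pj ci of (s.setReg x v) :=
  { h with nc_eq := by rw [State.reg_setReg, if_neg hx, h.nc_eq] }

/-- One jump per cycle recomputes the base points for the root `q`, and two more jumps locate both
sides, so the cost does not involve `n` other than through `l`. The right side of the relation is
read from segment `0` in either system, since `u` and `A j u` serve as names of words. -/
theorem runs_evalRelated (P : Params b r n d l) (c : Ctx b n d l s) {G T J nc : ℕ}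
    {pu pj ci of : ℕ → ℕ} {F : ℕ → ℕ → ℕ} (hGT : G < 4 ∧ T < 4) (h0 : s.mem 0 = A)
    (hA : PermSystem n d A)
    (hF : PermSystem n d F) (hJ : J < d) (hG : s.mem G = F)
    (hT : ∀ i ≤ l, ∀ p < n, s.mem T i p = (F J)^[2 ^ i] p) (C : Coords n d nc pu pj ci of s)
    {u j q : ℕ} (hu : s.reg 38 = u) (hj : s.reg 39 = j) (hq : s.reg 40 = q) (hun : u < n)
    (hjd : j < d) (hqn : q < n) :
    Runs b r n (evalRelated G T) s fun t s' => t ≤ nc * (7 * l + 14) + 14 * l + 19 ∧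
      s'.reg 36 = if Related F J pu pj ci of nc j u (A j u) q then 1 else 0 := by
  have hr := P.r_pos
  have hb := P.one_lt
  have hnb := P.n_lt
  have hdb := P.d_lt
  have hdr := P.d_le
  have hncn := C.nc_le
  have htree := C.tree
  rw [evalRelated, runs_seq]
  refine runs_for hb (fun k t s₁ => t ≤ k * (7 * l + 14) ∧
    ∀ i < k, s₁.mem 17 0 i = basePoints F J pu pj ci of q k i) C.nc_eq (by omega) c.one rfl (by decide)
    (fun v => ⟨by simp, by omega⟩) ?_ ?_
  · intro k t s₁ hk ⟨ht, hI⟩ h41 hF₁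
    have c₁ := c.of_frame hF₁
    have C₁ := C.of_frame hF₁
    have e40 : s₁.reg 40 = q := (hF₁.reg 40 rfl).trans hq
    have eG : s₁.mem G = F := by
      rw [hF₁.mem G, hG]; simp [Cmd.for, Cmd.writesSeg, locateCmd]; omega
    have eT : s₁.mem T = s.mem T := by
      rw [hF₁.mem T]; simp [Cmd.for, Cmd.writesSeg, locateCmd]; omega
    have hkn : k < n := by omega
    rw [runs_ite]
    split_ifs with hk0
    · rw [h41] at hk0
      subst hk0
      simp [c₁.zero, h41, hr, hkn, e40, basePoints]
      omega
    · rw [h41] at hk0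
      have hk1 : 0 < k := by omega
      have hpu := htree.pu_lt k hk1 hk
      have hpj := htree.pj_lt k hk1 hk
      have hci := htree.ci_lt k hk1 hk
      have hbase := basePoints_lt (of := of) hF hJ htree hqn hk.le _ hci
      rw [runs_seq, runs_load, runs_seq, runs_load, runs_seq]
      norm_num [c₁.zero, h41, hr, hkn, C₁.pu_eq, C₁.pj_eq]
      refine (runs_locate P ((c₁.setReg 30 _).setReg 47 _) (hF.perm J hJ) (by simpa [eT] using hT)
        (u := pu k) (by simp) hpu rfl (by simpa [C₁.of_eq] using C.of_lt _ hpu) (i := ci (pu k))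
        (by simp [C₁.ci_eq]) (by have := C.ci_lt _ hpu; omega) (by simp; exact hI _ hci)
        hbase).framed ?_
      intro t₂ s₂ ⟨ht₂, h42⟩ hF₂
      have c₂ := ((c₁.setReg 30 _).setReg 47 _).of_frame hF₂
      have e47 : s₂.reg 47 = pj k := (hF₂.reg 47 rfl).trans (by simp)
      have e41 : s₂.reg 41 = k := (hF₂.reg 41 rfl).trans (by simp [h41])
      have eG₂ : s₂.mem G = F := (hF₂.mem G rfl).trans eG
      have e17 : s₂.mem 17 = s₁.mem 17 := hF₂.mem 17 rfl
      have hpr : pj k < r := by omega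
      have hit := (hF.perm J hJ).iterate_lt (of (pu k)) hbase
      simp [C₁.of_eq] at h42
      simp [e47, h42, c₂.zero, e41, eG₂, hpr, hit, hr, hkn, e17]
      refine ⟨by rw [add_mul]; omega, fun i hi => ?_⟩
      split_ifs with hik
      · subst hik
        rw [basePoints, Function.update_self, if_neg hk0]
      · rw [basePoints_succ_of_lt (by omega), hI i (by omega)]
  · intro t s₁ ⟨ht, hI⟩ hF₁
    have c₁ := c.of_frame hF₁
    have C₁ := C.of_frame hF₁
    have e38 : s₁.reg 38 = u := (hF₁.reg 38 rfl).trans hu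
    have e39 : s₁.reg 39 = j := (hF₁.reg 39 rfl).trans hj
    have eG : s₁.mem G = F := by
      rw [hF₁.mem G, hG]; simp [Cmd.for, Cmd.writesSeg, locateCmd]; omega
    have eA : s₁.mem 0 = A := by
      rw [hF₁.mem 0, h0]; simp [Cmd.for, Cmd.writesSeg, locateCmd]
    have eT : s₁.mem T = s.mem T := by
      rw [hF₁.mem T]; simp [Cmd.for, Cmd.writesSeg, locateCmd]; omega
    have hub : u % 2 ^ b = u := Nat.mod_eq_of_lt (by omega)
    have hAu := (hA.perm j hjd).lt u hun
    have hloc : ∀ v < n, locate F J pu pj ci of nc q v < n :=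
      fun v hv => locate_lt hF hJ htree hqn (C.ci_lt v hv)
    have hbase : ∀ v < n, basePoints F J pu pj ci of q nc (ci v) < n :=
      fun v hv => basePoints_lt hF hJ htree hqn le_rfl _ (C.ci_lt v hv)
    have hjr : j < r := by omega
    rw [runs_seq, runs_add, c₁.zero, e38, add_zero, hub, runs_seq]
    refine (runs_locate P (c₁.setReg 30 _) (hF.perm J hJ) (by simpa [eT] using hT)
        (u := u) (by simp) hun rfl (by simpa [C₁.of_eq] using C.of_lt _ hun) (i := ci u)
        (by simp [C₁.ci_eq]) (by have := C.ci_lt _ hun; omega) (by simp; exact hI _ (C.ci_lt _ hun))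
        (hbase u hun)).framed ?_
    intro t₂ s₂ ⟨ht₂, h42⟩ hF₂
    have c₂ := (c₁.setReg 30 _).of_frame hF₂
    have C₂ : Coords n d nc pu pj ci of s₂ := (C₁.setReg 30 _).of_frame hF₂
    have e39₂ : s₂.reg 39 = j := (hF₂.reg 39 rfl).trans (by simp [e39])
    have e38₂ : s₂.reg 38 = u := (hF₂.reg 38 rfl).trans (by simp [e38])
    have eG₂ : s₂.mem G = F := (hF₂.mem G rfl).trans eG
    have eA₂ : s₂.mem 0 = A := (hF₂.mem 0 rfl).trans eA
    have eT₂ : s₂.mem T = s.mem T := (hF₂.mem T rfl).trans eT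
    have e17 : s₂.mem 17 = s₁.mem 17 := hF₂.mem 17 rfl
    rw [State.mem_setReg, C₁.of_eq] at h42
    rw [runs_seq, runs_load, runs_seq, runs_load, runs_seq]
    norm_num [h42, e39₂, eG₂, hjr, e38₂, hun, eA₂]
    refine ⟨hloc u hun, ?_⟩
    refine (runs_locate P ((c₂.setReg 48 _).setReg 30 _) (hF.perm J hJ) (by simpa [eT₂] using hT)
        (u := A j u) (by simp) hAu rfl (by simpa [C₂.of_eq] using C.of_lt _ hAu) (i := ci (A j u))
        (by simp [C₂.ci_eq]) (by have := C.ci_lt _ hAu; omega)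
        (by simp [e17]; exact hI _ (C.ci_lt _ hAu)) (hbase _ hAu)).framed ?_
    intro t₃ s₃ ⟨ht₃, h42'⟩ hF₃
    have e48 := hF₃.reg 48 rfl
    simp at e48
    rw [State.mem_setReg, State.mem_setReg, C₂.of_eq] at h42'
    rw [runs_eq hb, h42', e48]
    refine ⟨by omega, ?_⟩
    simp
    rfl

end WordRAM

/-! ### Refining the sets of candidates -/

/-- The nonzero values of `S` and `S'` mark sets of the same size `m ≥ 1` that every equivariant map
matches. -/
structure Candidates (n d : ℕ) (A B : ℕ → ℕ → ℕ) (S S' : ℕ → ℕ) (m : ℕ) : Prop where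
  card_left : ((Finset.range n).filter fun p => S p ≠ 0).card = m
  card_right : ((Finset.range n).filter fun p => S' p ≠ 0).card = m
  pos : 1 ≤ m
  matching : Matching n d A B (fun p => S p ≠ 0) (fun p => S' p ≠ 0)

section Candidates

variable {n d m : ℕ} {A B : ℕ → ℕ → ℕ} {S S' : ℕ → ℕ}

theorem Candidates.exists_left (h : Candidates n d A B S S' m) : ∃ p < n, S p ≠ 0 := by
  obtain ⟨p, hp⟩ := Finset.card_pos.1 (h.pos.trans_eq h.card_left.symm)
  exact ⟨p, by simpa using hp⟩

theorem Candidates.exists_right (h : Candidates n d A B S S' m) : ∃ p < n, S' p ≠ 0 := by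
  obtain ⟨p, hp⟩ := Finset.card_pos.1 (h.pos.trans_eq h.card_right.symm)
  exact ⟨p, by simpa using hp⟩

theorem Candidates.matching_and (h : Candidates n d A B S S' m) {R R' : ℕ → Prop}
    (hR : Matching n d A B R R') :
    Matching n d A B (fun p => S p ≠ 0 ∧ R p) (fun p => S' p ≠ 0 ∧ R' p) :=
  fun τ hτ p hp => and_congr (h.matching τ hτ p hp) (hR τ hτ p hp)

theorem Candidates.restrict (h : Candidates n d A B S S' m) {R R' : ℕ → Prop} [DecidablePred R]
    [DecidablePred R'] (hR : Matching n d A B R R') {T T' : ℕ → ℕ} {k : ℕ}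
    (hT : ∀ p < n, T p ≠ 0 ↔ S p ≠ 0 ∧ R p) (hT' : ∀ p < n, T' p ≠ 0 ↔ S' p ≠ 0 ∧ R' p)
    (hk : ((Finset.range n).filter fun p => S p ≠ 0 ∧ R p).card = k)
    (hk' : ((Finset.range n).filter fun p => S' p ≠ 0 ∧ R' p).card = k) (h1 : 1 ≤ k) :
    Candidates n d A B T T' k where
  card_left := by
    rw [← hk]
    exact congrArg _ (Finset.filter_congr fun p hp => hT p (Finset.mem_range.1 hp))
  card_right := by
    rw [← hk']
    exact congrArg _ (Finset.filter_congr fun p hp => hT' p (Finset.mem_range.1 hp))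
  pos := h1
  matching τ hτ p hp := by
    change T p ≠ 0 ↔ T' (τ p) ≠ 0
    rw [hT p hp, hT' _ (hτ.lt p hp)]
    exact h.matching_and hR τ hτ p hp

/-- If the tested parts have equal size on both sides, so do their complements; either may then be
kept. -/
theorem card_filter_and_not (n : ℕ) (S : ℕ → ℕ) (R : ℕ → Prop) [DecidablePred R] :
    ((Finset.range n).filter fun p => S p ≠ 0 ∧ ¬ R p).card =
      ((Finset.range n).filter fun p => S p ≠ 0).card -
        ((Finset.range n).filter fun p => S p ≠ 0 ∧ R p).card := by
  have := Finset.card_filter_add_card_filter_not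
    (s := (Finset.range n).filter fun p => S p ≠ 0) R
  rw [Finset.filter_filter, Finset.filter_filter] at this
  omega

end Candidates

/-! ### One round of refinement -/

namespace WordRAM

/-- Clear the marks, and put candidates of both systems into registers `20` and `21`. -/
def pick : Cmd :=
  .for 40 0 (.store 10 3 40 3 ⨟
    .load 36 6 3 40 ⨟ .ite 36 (.op .add 20 40 3) .skip ⨟
    .load 36 7 3 40 ⨟ .ite 36 (.op .add 21 40 3) .skip)

/-- Test the relation given by registers `38` and `39` at all candidates in system `g`; register
`10` receives the number of candidates that satisfy it. -/
def evalAll (g : ℕ) : Cmd :=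
  .const 10 0 ⨟ .for 40 0 (.load 49 (g + 6) 3 40 ⨟
    .ite 49 (evalRelated g (g + 2) ⨟ .store (g + 8) 3 40 36 ⨟ .op .add 10 10 36) .skip)

/-- Keep the candidates in system `g` for which the test gave the result in register `50`. -/
def restrict (g : ℕ) : Cmd :=
  .for 40 0 (.load 49 (g + 6) 3 40 ⨟
    .ite 49 (.load 36 (g + 8) 3 40 ⨟ .op .eq 36 36 50 ⨟ .store (g + 6) 3 40 36) .skip)

/-- Keep the smaller part of the candidates. -/
def shrink : Cmd :=
  .op .sub 36 22 10 ⨟ .op .lt 36 36 10 ⨟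
  .ite 36 (.const 50 0 ⨟ .op .sub 22 22 10) (.const 50 1 ⨟ .op .add 22 10 3) ⨟
  restrict 0 ⨟ restrict 1

/-- Test one pair of candidates. Either register `23` is cleared and register `24` receives the
answer, or the number of candidates, in register `22`, is halved. -/
def round : Cmd :=
  pick ⨟ explore ⨟ verify ⨟
  .ite 37
    (evalAll 0 ⨟ .op .add 11 10 3 ⨟ evalAll 1 ⨟ .op .eq 36 10 11 ⨟
      .ite 36 shrink (.const 24 0 ⨟ .const 23 0))
    (.const 24 1 ⨟ .const 23 0)

variable {b r n d l : ℕ} {s : State} {A B : ℕ → ℕ → ℕ}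

theorem runs_pick (P : Params b r n d l) (c : Ctx b n d l s) (h6 : ∃ p < n, s.mem 6 0 p ≠ 0)
    (h7 : ∃ p < n, s.mem 7 0 p ≠ 0) :
    Runs b r n pick s fun t s' => t ≤ 10 * n + 3 ∧ (∀ p < n, s'.mem 10 0 p = 0) ∧
      (s'.reg 20 < n ∧ s.mem 6 0 (s'.reg 20) ≠ 0) ∧
      (s'.reg 21 < n ∧ s.mem 7 0 (s'.reg 21) ≠ 0) := by
  have hr := P.r_pos
  have hnb := P.n_lt
  rw [pick]
  refine runs_for P.one_lt (fun k t s₁ => t ≤ 10 * k ∧ (∀ p < k, s₁.mem 10 0 p = 0) ∧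
    ((∃ p < k, s.mem 6 0 p ≠ 0) → s₁.reg 20 < n ∧ s.mem 6 0 (s₁.reg 20) ≠ 0) ∧
    ((∃ p < k, s.mem 7 0 p ≠ 0) → s₁.reg 21 < n ∧ s.mem 7 0 (s₁.reg 21) ≠ 0))
    c.n hnb c.one rfl (by decide) (fun v => by simp) ?_ ?_
  · intro k t s₁ hk ⟨ht, h0, h1, h2⟩ h40 hF
    have c₁ := c.of_frame hF
    have e6 : s₁.mem 6 = s.mem 6 := hF.mem 6 rfl
    have e7 : s₁.mem 7 = s.mem 7 := hF.mem 7 rfl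
    have hkb : k % 2 ^ b = k := Nat.mod_eq_of_lt (by omega)
    have hz : ∀ p < k + 1, (if p = k then 0 else s₁.mem 10 0 p) = 0 := by
      intro p hp
      split_ifs with h
      exacts [rfl, h0 p (by omega)]
    have step : ∀ f : ℕ → ℕ, f k = 0 → (∃ p < k + 1, f p ≠ 0) → ∃ p < k, f p ≠ 0 := by
      rintro f hf ⟨p, hp, hp0⟩
      exact ⟨p, lt_of_le_of_ne (by omega) fun e => hp0 (e ▸ hf), hp0⟩
    simp only [runs_seq, runs_store, runs_load, runs_ite, runs_add, runs_skip]
    norm_num [c₁.zero, h40, hr, hk, e6, e7, hkb]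
    split_ifs with ha hb hb
    · exact ⟨by omega, by simpa using hz, fun p hp hp0 => h1 (step _ ha ⟨p, by omega, hp0⟩),
        fun p hp hp0 => h2 (step _ hb ⟨p, by omega, hp0⟩)⟩
    · exact ⟨by omega, by simpa using hz, fun p hp hp0 => h1 (step _ ha ⟨p, by omega, hp0⟩),
        fun _ _ _ => hb⟩
    · exact ⟨by omega, by simpa using hz, fun _ _ _ => ha,
        fun p hp hp0 => h2 (step _ hb ⟨p, by omega, hp0⟩)⟩
    · exact ⟨by omega, by simpa using hz, fun _ _ _ => ha, fun _ _ _ => hb⟩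
  · intro t s' ⟨ht, h0, h1, h2⟩ _
    exact ⟨by omega, h0, h1 h6, h2 h7⟩

/-- Noncandidates cost a constant each, and only the `m` candidates cost an evaluation. The product
with `m` is what later sums geometrically. -/
theorem runs_evalAll (P : Params b r n d l) (c : Ctx b n d l s) {g J nc : ℕ}
    {pu pj ci of : ℕ → ℕ} {F : ℕ → ℕ → ℕ} (hg : g < 2) (h0 : s.mem 0 = A)
    (hA : PermSystem n d A) (hF : PermSystem n d F) (hJ : J < d) (hG : s.mem g = F)
    (hT : ∀ i ≤ l, ∀ p < n, s.mem (g + 2) i p = (F J)^[2 ^ i] p)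
    (C : Coords n d nc pu pj ci of s) {u j m : ℕ} (hu : s.reg 38 = u) (hj : s.reg 39 = j)
    (hun : u < n) (hjd : j < d)
    (hm : ((Finset.range n).filter fun p => s.mem (g + 6) 0 p ≠ 0).card = m) :
    Runs b r n (evalAll g) s fun t s' =>
      t ≤ 7 * n + (nc * (7 * l + 14) + 14 * l + 19) * m + 4 ∧
      s'.reg 10 = ((Finset.range n).filter fun p => s.mem (g + 6) 0 p ≠ 0 ∧
        Related F J pu pj ci of nc j u (A j u) p).card ∧
      ∀ p < n, s.mem (g + 6) 0 p ≠ 0 → s'.mem (g + 8) 0 p =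
        if Related F J pu pj ci of nc j u (A j u) p then 1 else 0 := by
  have hr := P.r_pos
  have hnb := P.n_lt
  obtain ⟨S, hS⟩ : ∃ S, s.mem (g + 6) 0 = S := ⟨_, rfl⟩
  rw [hS] at hm ⊢
  rw [evalAll, runs_seq, runs_const]
  refine runs_for P.one_lt (fun k t s₁ => t ≤ 7 * k + (nc * (7 * l + 14) + 14 * l + 19) *
      ((Finset.range k).filter fun p => S p ≠ 0).card ∧
      s₁.reg 10 = ((Finset.range k).filter fun p => S p ≠ 0 ∧
        Related F J pu pj ci of nc j u (A j u) p).card ∧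
      ∀ p < k, S p ≠ 0 → s₁.mem (g + 8) 0 p =
        if Related F J pu pj ci of nc j u (A j u) p then 1 else 0) (l := n)
    (by simp [c.n]) hnb (by simp [c.one]) rfl (by decide) (fun v => by simp) ?_ ?_
  · intro k t s₁ hk ⟨ht, h10, hI⟩ h40 hF₁
    have hw : ∀ i, i < 8 → (Cmd.for 40 0 (.load 49 (g + 6) 3 40 ⨟
        .ite 49 (evalRelated g (g + 2) ⨟ .store (g + 8) 3 40 36 ⨟ .op .add 10 10 36)
          .skip)).writesSeg i = false := by
      intro i hi
      simp [Cmd.for, Cmd.writesSeg, evalRelated, locateCmd]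
      omega
    -- Segment `17` is excluded because it holds the base points, recomputed for every root.
    have hw' : ∀ i, 10 ≤ i → i ≠ 17 → (Cmd.for 40 0 (.load 49 (g + 6) 3 40 ⨟
        .ite 49 (evalRelated g (g + 2) ⨟ .store (g + 8) 3 40 36 ⨟ .op .add 10 10 36)
          .skip)).writesSeg i = false := by
      intro i hi
      simp [Cmd.for, Cmd.writesSeg, evalRelated, locateCmd]
      omega
    have c₁ := (c.setReg 10 _).of_frame hF₁
    have C₁ := (C.setReg 10 _).of_frame hF₁ (by
      rw [hw' 15 (by omega) (by omega), hw' 16 (by omega) (by omega), hw' 12 (by omega) (by omega),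
        hw' 13 (by omega) (by omega)]
      rfl)
    have eS : s₁.mem (g + 6) 0 = S := by rw [hF₁.mem _ (hw _ (by omega))]; exact hS
    have eG : s₁.mem g = F := by rw [hF₁.mem _ (hw _ (by omega))]; exact hG
    have eA : s₁.mem 0 = A := by rw [hF₁.mem _ (hw _ (by omega))]; exact h0
    have eT : s₁.mem (g + 2) = s.mem (g + 2) := hF₁.mem _ (hw _ (by omega))
    have e38 : s₁.reg 38 = u := (hF₁.reg 38 rfl).trans hu
    have e39 : s₁.reg 39 = j := (hF₁.reg 39 rfl).trans hj
    simp only [ne_eq] at ht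
    rw [Finset.range_add_one, Finset.filter_insert, Finset.filter_insert]
    rw [runs_seq, runs_load, runs_ite, c₁.zero, h40, eS]
    refine ⟨hr, hk, ?_⟩
    rw [State.reg_setReg, if_pos rfl]
    by_cases hk0 : S k = 0
    · rw [if_pos hk0]
      simp only [hk0]
      norm_num [h10]
      refine ⟨by omega, fun p hp hp0 => hI p (lt_of_le_of_ne (by omega) fun e => hp0 (e ▸ hk0)) hp0⟩
    · rw [if_neg hk0, runs_seq]
      refine (runs_evalRelated P (c₁.setReg 49 _) (by omega) eA hA hF hJ eG
        (by simpa [eT] using hT) (C₁.setReg 49 _) (u := u) (j := j) (q := k) (by simp [e38])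
        (by simp [e39]) (by simp [h40]) hun hjd hk).framed ?_
      intro t₂ s₂ ⟨ht₂, h36⟩ hF₂
      have c₂ := (c₁.setReg 49 _).of_frame hF₂
      have e40 : s₂.reg 40 = k := (hF₂.reg 40 rfl).trans (by simp [h40])
      have e10 : s₂.reg 10 = s₁.reg 10 := (hF₂.reg 10 rfl).trans (by simp)
      have e8 : s₂.mem (g + 8) = s₁.mem (g + 8) := by
        refine hF₂.mem _ ?_
        simp [Cmd.for, Cmd.writesSeg, evalRelated, locateCmd]
        omega
      have hcard : ((Finset.range (k + 1)).filter fun p => S p ≠ 0 ∧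
          Related F J pu pj ci of nc j u (A j u) p).card < 2 ^ b := by
        refine (Finset.card_filter_le _ _).trans_lt ?_
        rw [Finset.card_range]; omega
      rw [Finset.range_add_one, Finset.filter_insert] at hcard
      simp only [runs_seq, runs_store, runs_add, State.reg_setReg, State.reg_setMem, e10, h10, h36]
      norm_num [c₂.zero, e40, hr, hk, hk0, e8, h36]
      refine ⟨by rw [mul_add (nc * (7 * l + 14) + 14 * l + 19)]; omega, ?_, fun p hp hp0 => ?_⟩
      · simp only [hk0, ne_eq, not_false_eq_true, true_and] at hcard
        split_ifs at hcard ⊢ with hR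
        · rw [Finset.card_insert_of_notMem (by simp)] at hcard ⊢
          exact Nat.mod_eq_of_lt hcard
        · exact Nat.mod_eq_of_lt hcard
      · by_cases hpk : p = k
        · rw [if_pos hpk, hpk]
        · rw [if_neg hpk]; exact hI p (by omega) hp0
  · intro t s' ⟨ht, h10, hI⟩ _
    rw [hm] at ht
    exact ⟨by omega, h10, hI⟩

theorem runs_restrict (P : Params b r n d l) (c : Ctx b n d l s) (g : ℕ) :
    Runs b r n (restrict g) s fun t s' => t ≤ 8 * n + 3 ∧
      ∀ p < n, s'.mem (g + 6) 0 p ≠ 0 ↔ s.mem (g + 6) 0 p ≠ 0 ∧ s.mem (g + 8) 0 p = s.reg 50 := by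
  have hr := P.r_pos
  have hnb := P.n_lt
  rw [restrict]
  refine runs_for P.one_lt (fun k t s₁ => t ≤ 8 * k ∧ (∀ p < k, s₁.mem (g + 6) 0 p ≠ 0 ↔
      s.mem (g + 6) 0 p ≠ 0 ∧ s.mem (g + 8) 0 p = s.reg 50) ∧
      ∀ p ≥ k, s₁.mem (g + 6) 0 p = s.mem (g + 6) 0 p)
    c.n hnb c.one rfl (by decide) (fun v => by simp) ?_ ?_
  · intro k t s₁ hk ⟨ht, hI, hI'⟩ h40 hF
    have c₁ := c.of_frame hF
    have e8 : s₁.mem (g + 8) = s.mem (g + 8) := by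
      refine hF.mem _ ?_
      simp [Cmd.for, Cmd.writesSeg]
    have e50 : s₁.reg 50 = s.reg 50 := hF.reg 50 rfl
    simp only [runs_seq, runs_load, runs_ite, runs_eq P.one_lt, runs_store, runs_skip]
    norm_num [c₁.zero, h40, hr, hk, e8, e50, hI' k le_rfl]
    split_ifs with hk0 hV
    · refine ⟨by omega, fun p hp => ?_, fun p hp => by simpa using hI' p (by omega)⟩
      rcases Nat.lt_or_eq_of_le hp with hp | rfl
      · simpa using hI p hp
      · simp [hI' p le_rfl, hk0]
    all_goals
      refine ⟨by omega, fun p hp => ?_, fun p hp => ?_⟩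
      · by_cases hpk : p = k
        · simp [hpk, hk0, hV]
        · simpa [hpk] using hI p (by omega)
      · simpa [show p ≠ k by omega] using hI' p (by omega)
  · intro t s' ⟨ht, hI, _⟩ _
    exact ⟨by omega, hI⟩

end WordRAM

theorem Candidates.le {n d m : ℕ} {A B : ℕ → ℕ → ℕ} {S S' : ℕ → ℕ}
    (h : Candidates n d A B S S' m) : m ≤ n := by
  rw [← h.card_left]
  exact (Finset.card_filter_le _ _).trans_eq (Finset.card_range n)

/-- At the root of the search the coordinates of a point decode to that point, so the relation is a
tautology. -/
theorem Explored.related_left {n d : ℕ} {A B : ℕ → ℕ → ℕ} {J x y nc : ℕ}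
    {mk ci of ta pu pj : ℕ → ℕ} (h : Explored n d A B J x y mk ci of ta pu pj nc)
    (hmk : ∀ u < n, mk u ≠ 0) {j u : ℕ} (hu : u < n) (hA : A j u < n) :
    Related A J pu pj ci of nc j u (A j u) x := by
  rw [Related, (h.locate hu (hmk u hu)).1, (h.locate hA (hmk _ hA)).1]

/-- At the root `y` coordinates decode to values of `ta`, so the relation there says precisely what
verification found to be false. -/
theorem Explored.not_related_right {n d : ℕ} {A B : ℕ → ℕ → ℕ} {J x y nc : ℕ}
    {mk ci of ta pu pj : ℕ → ℕ} (h : Explored n d A B J x y mk ci of ta pu pj nc)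
    (hmk : ∀ u < n, mk u ≠ 0) {j u : ℕ} (hu : u < n) (hA : A j u < n)
    (hne : ta (A j u) ≠ B j (ta u)) :
    ¬ Related B J pu pj ci of nc j u (A j u) y := by
  rw [Related, (h.locate hu (hmk u hu)).2, (h.locate hA (hmk _ hA)).2]
  exact hne.symm

namespace WordRAM

variable {b r n d l : ℕ} {s : State} {A B : ℕ → ℕ → ℕ}

/-- From `1 ≤ k < m`, both the part where `R` holds and its complement are nonempty, with sizes `k`
and `m - k` in both systems; the smaller has at most `m / 2` elements. -/
theorem runs_shrink (P : Params b r n d l) (c : Ctx b n d l s) {m k : ℕ}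
    (h : Candidates n d A B (s.mem 6 0) (s.mem 7 0) m) (hm : s.reg 22 = m) (hk : s.reg 10 = k)
    {R R' : ℕ → Prop} [DecidablePred R] [DecidablePred R'] (hR : Matching n d A B R R')
    (hV : ∀ p < n, s.mem 6 0 p ≠ 0 → s.mem 8 0 p = if R p then 1 else 0)
    (hV' : ∀ p < n, s.mem 7 0 p ≠ 0 → s.mem 9 0 p = if R' p then 1 else 0)
    (hkl : ((Finset.range n).filter fun p => s.mem 6 0 p ≠ 0 ∧ R p).card = k)
    (hkr : ((Finset.range n).filter fun p => s.mem 7 0 p ≠ 0 ∧ R' p).card = k)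
    (h1 : 1 ≤ k) (hlt : k < m) :
    Runs b r n shrink s fun t s' => t ≤ 16 * n + 11 ∧ 2 * s'.reg 22 ≤ m ∧
      Candidates n d A B (s'.mem 6 0) (s'.mem 7 0) (s'.reg 22) := by
  have hb := P.one_lt
  have hnb := P.n_lt
  have hmn := h.le
  have hb1 : 1 % 2 ^ b = 1 := Nat.mod_eq_of_lt hb
  have hb2 : (m - k) % 2 ^ b = m - k := Nat.mod_eq_of_lt (by omega)
  have hb3 : k % 2 ^ b = k := Nat.mod_eq_of_lt (by omega)
  -- Common end of both branches, which differ only in the result to be kept (register `50`) and in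
  -- the new size (register `22`).
  have key : ∀ (s₁ : State) (t₁ : ℕ), Ctx b n d l s₁ → s₁.mem = s.mem → t₁ ≤ 5 →
      2 * s₁.reg 22 ≤ m →
      (s₁.reg 50 = 0 ∧ s₁.reg 22 = m - k ∨ s₁.reg 50 = 1 ∧ s₁.reg 22 = k) →
      Runs b r n (restrict 0 ⨟ restrict 1) s₁ fun t s' => t₁ + t ≤ 16 * n + 11 ∧
        2 * s'.reg 22 ≤ m ∧ Candidates n d A B (s'.mem 6 0) (s'.mem 7 0) (s'.reg 22) := by
    intro s₁ t₁ c₁ e₁ ht₁ hm₁ hcase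
    rw [runs_seq]
    refine (runs_restrict P c₁ 0).framed ?_
    intro t₂ s₂ ⟨ht₂, h6⟩ hF₂
    have c₂ := c₁.of_frame hF₂
    refine (runs_restrict P c₂ 1).framed ?_
    intro t₃ s₃ ⟨ht₃, h7⟩ hF₃
    have e22 : s₃.reg 22 = s₁.reg 22 := (hF₃.reg 22 rfl).trans (hF₂.reg 22 rfl)
    have e50 : s₂.reg 50 = s₁.reg 50 := hF₂.reg 50 rfl
    have e7 : s₂.mem 7 = s.mem 7 := by rw [hF₂.mem 7 rfl, e₁]
    have e9 : s₂.mem 9 = s.mem 9 := by rw [hF₂.mem 9 rfl, e₁]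
    have e6 : s₃.mem 6 = s₂.mem 6 := hF₃.mem 6 rfl
    norm_num [e₁] at h6
    norm_num [e7, e9, e50] at h7
    rw [e22]
    refine ⟨by omega, hm₁, ?_⟩
    have neg01 : (0 : ℕ) ≠ 1 := zero_ne_one
    rcases hcase with ⟨e50', e22'⟩ | ⟨e50', e22'⟩
    · rw [e22']
      have hcl := card_filter_and_not n (s.mem 6 0) R
      have hcr := card_filter_and_not n (s.mem 7 0) R'
      rw [h.card_left, hkl] at hcl
      rw [h.card_right, hkr] at hcr
      refine h.restrict (R := fun p => ¬ R p) (R' := fun p => ¬ R' p)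
        (fun τ hτ p hp => not_congr (hR τ hτ p hp)) (fun p hp => ?_) (fun p hp => ?_) hcl hcr
        (by omega)
      · rw [e6, ne_eq, h6 p hp, e50']
        refine and_congr_right fun h0 => ?_
        rw [hV p hp h0]
        simp
      · rw [ne_eq, h7 p hp, e50']
        refine and_congr_right fun h0 => ?_
        rw [hV' p hp h0]
        simp
    · rw [e22']
      refine h.restrict hR (fun p hp => ?_) (fun p hp => ?_) hkl hkr h1
      · rw [e6, ne_eq, h6 p hp, e50']
        refine and_congr_right fun h0 => ?_
        rw [hV p hp h0]
        simp
      · rw [ne_eq, h7 p hp, e50']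
        refine and_congr_right fun h0 => ?_
        rw [hV' p hp h0]
        simp
  rw [shrink, runs_seq, runs_sub, runs_seq, runs_lt hb, runs_seq, runs_ite]
  by_cases hcmp : m - k < k
  · norm_num [hm, hk, hb2, hcmp, -runs_seq]
    rw [runs_seq, runs_const, runs_sub]
    refine (key _ 5 ((((c.setReg 36 _).setReg 36 _).setReg 50 _).setReg 22 _) rfl le_rfl ?_ ?_).mono
      fun t s' ⟨h1, h2⟩ => ⟨by omega, h2⟩
    · simp [hk, hm, hb2]; omega
    · simp [hk, hm, hb2]
  · norm_num [hm, hk, hb2, hcmp, -runs_seq]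
    rw [runs_seq, runs_const, runs_add]
    refine (key _ 5 ((((c.setReg 36 _).setReg 36 _).setReg 50 _).setReg 22 _) rfl le_rfl ?_ ?_).mono
      fun t s' ⟨h1, h2⟩ => ⟨by omega, h2⟩
    · simp [hk, c.zero, hb3]; omega
    · simp [hk, c.zero, hb3, hb1]

/-- A failed verification still yields progress: its relation holds at the candidate `x` and fails
at the candidate `y`, so it either refutes conjugacy by counting or splits the candidates properly.
-/
theorem runs_round (P : Params b r n d l) (c : Ctx b n d l s) {J m L : ℕ} (D : Data n l J A B s)
    (hA : PermSystem n d A) (hB : PermSystem n d B) (hJ : J < d)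
    (hL : (cycleMins n (A J)).card = L)
    (h : Candidates n d A B (s.mem 6 0) (s.mem 7 0) m) (hm : s.reg 22 = m) (hgo : s.reg 23 ≠ 0) :
    Runs b r n round s fun t s' =>
      t ≤ n * (20 * d + 64) + (13 * n + 10) * L + 60 + 2 * (L * (7 * l + 14) + 14 * l + 19) * m ∧
      ((s'.reg 23 = 0 ∧ s'.reg 24 = 1 ∧ ∃ τ, IsEquivariant n d A B τ) ∨
       (s'.reg 23 = 0 ∧ s'.reg 24 = 0 ∧ ¬ ∃ τ, IsEquivariant n d A B τ) ∨
       (s'.reg 23 ≠ 0 ∧ 2 * s'.reg 22 ≤ m ∧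
        Candidates n d A B (s'.mem 6 0) (s'.mem 7 0) (s'.reg 22))) := by
  have hb := P.one_lt
  have hnb := P.n_lt
  have hb1 : 1 % 2 ^ b = 1 := Nat.mod_eq_of_lt hb
  rw [round, runs_seq]
  refine (runs_pick P c h.exists_left h.exists_right).framed ?_
  intro t₁ s₁ ⟨ht₁, hmk, ⟨hx, hxS⟩, hy, hyS⟩ hF₁
  have c₁ := c.of_frame hF₁
  have D₁ := D.of_frame hF₁
  rw [runs_seq]
  refine (runs_explore P c₁ D₁ hA hB hJ rfl rfl hx hy hmk).framed ?_
  intro t₂ s₂ ⟨ht₂, S, hpos, hall⟩ hF₂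
  have c₂ := c₁.of_frame hF₂
  have D₂ := D₁.of_frame hF₂
  have hncL : s₂.reg 26 ≤ L := by
    rw [← hL]
    exact S.card.trans (Finset.card_filter_le _ _)
  have htime : (13 * n + 10) * s₂.reg 26 ≤ (13 * n + 10) * L := Nat.mul_le_mul_left _ hncL
  have X := S.explored
  have C₂ : Coords n d (s₂.reg 26) (s₂.mem 15 0) (s₂.mem 16 0) (s₂.mem 12 0) (s₂.mem 13 0) s₂ :=
    ⟨rfl, rfl, rfl, rfl, rfl, X.tree, fun u hu => X.ci_lt u hu (hall u hu),
      fun u hu => X.of_lt u hu (hall u hu), (hncL.trans_eq hL.symm).trans (card_cycleMins_le _ _)⟩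
  rw [runs_seq]
  refine (runs_verify P c₂ D₂ hA.perm rfl fun u hu => X.ta_lt u hu (hall u hu)).framed ?_
  intro t₃ s₃ ⟨ht₃, hgood, hbad⟩ hF₃
  have c₃ := c₂.of_frame hF₃
  have D₃ := D₂.of_frame hF₃
  have C₃ := C₂.of_frame hF₃
  rw [runs_ite]
  split_ifs with h37
  · simp [hb1]
    refine ⟨?_, _, hgood h37⟩
    rw [mul_add n (20 * d)]
    rw [mul_add n (11 * d)] at ht₃
    rw [mul_add n (9 * d)] at ht₂
    have : n * (20 * d) = n * (11 * d) + n * (9 * d) := by ring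
    omega
  · obtain ⟨hu, hj, hne⟩ := hbad h37
    have e6 : s₃.mem 6 = s.mem 6 := by rw [hF₃.mem 6 rfl, hF₂.mem 6 rfl, hF₁.mem 6 rfl]
    have e7 : s₃.mem 7 = s.mem 7 := by rw [hF₃.mem 7 rfl, hF₂.mem 7 rfl, hF₁.mem 7 rfl]
    have e22 : s₃.reg 22 = m := by rw [hF₃.reg 22 rfl, hF₂.reg 22 rfl, hF₁.reg 22 rfl, hm]
    have e23 : s₃.reg 23 ≠ 0 := by rwa [hF₃.reg 23 rfl, hF₂.reg 23 rfl, hF₁.reg 23 rfl]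
    rw [runs_seq]
    refine (runs_evalAll P c₃ (g := 0) (by omega) D₃.left hA hA hJ D₃.left D₃.pow_left C₃ rfl rfl hu
      hj (m := m) (by rw [e6]; exact h.card_left)).framed ?_
    intro t₄ s₄ ⟨ht₄, h10, hV⟩ hF₄
    have c₄ := c₃.of_frame hF₄
    have D₄ := D₃.of_frame hF₄
    have C₄ := C₃.of_frame hF₄
    have e7₄ : s₄.mem 7 = s.mem 7 := by rw [hF₄.mem 7 rfl, e7]
    rw [runs_seq, runs_add, runs_seq]
    refine (runs_evalAll P (c₄.setReg 11 _) (g := 1) (by omega) D₄.left hA hB hJ D₄.right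
      D₄.pow_right (C₄.setReg 11 _) (u := s₃.reg 38) (j := s₃.reg 39) (by simp [hF₄.reg 38 rfl])
      (by simp [hF₄.reg 39 rfl]) hu hj (m := m) (by
        rw [State.mem_setReg, e7₄]; exact h.card_right)).framed ?_
    intro t₅ s₅ ⟨ht₅, h10', hV'⟩ hF₅
    have c₅ := (c₄.setReg 11 _).of_frame hF₅
    obtain ⟨u, eu⟩ : ∃ u, s₃.reg 38 = u := ⟨_, rfl⟩
    obtain ⟨j, ej⟩ : ∃ j, s₃.reg 39 = j := ⟨_, rfl⟩
    rw [eu, ej] at hne h10 hV h10' hV'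
    rw [eu] at hu
    rw [ej] at hj
    have hAu := (hA.perm j hj).lt u hu
    have hR : Matching n d A B
        (Related A J (s₂.mem 15 0) (s₂.mem 16 0) (s₂.mem 12 0) (s₂.mem 13 0) (s₂.reg 26) j u (A j u))
        (Related B J (s₂.mem 15 0) (s₂.mem 16 0) (s₂.mem 12 0) (s₂.mem 13 0) (s₂.reg 26) j u
          (A j u)) :=
      fun τ hτ p hp => hτ.related_iff hA hB hJ X.tree hp hj (C₂.ci_lt u hu) (C₂.ci_lt _ hAu)
    have hRx := X.related_left hall hu hAu
    have hRy := X.not_related_right hall hu hAu hne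
    set R := Related A J (s₂.mem 15 0) (s₂.mem 16 0) (s₂.mem 12 0) (s₂.mem 13 0) (s₂.reg 26) j u
      (A j u) with hRdef
    set R' := Related B J (s₂.mem 15 0) (s₂.mem 16 0) (s₂.mem 12 0) (s₂.mem 13 0) (s₂.reg 26) j u
      (A j u) with hRdef'
    have e6' : s₃.mem (0 + 6) = s.mem 6 := e6
    have e7' : (s₄.setReg 11 ((s₄.reg 10 + s₄.reg 3) % 2 ^ b)).mem (1 + 6) = s.mem 7 := e7₄
    rw [e6'] at h10 hV
    rw [e7'] at h10' hV'
    have h6₅ : s₅.mem 6 = s.mem 6 := by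
      rw [hF₅.mem 6 rfl, State.mem_setReg, hF₄.mem 6 rfl, e6]
    have h7₅ : s₅.mem 7 = s.mem 7 := by rw [hF₅.mem 7 rfl, State.mem_setReg, e7₄]
    have h8₅ : s₅.mem 8 = s₄.mem 8 := by rw [hF₅.mem 8 rfl, State.mem_setReg]
    have hcl : ((Finset.range n).filter fun p => s.mem 6 0 p ≠ 0 ∧ R p).card ≤ n :=
      (Finset.card_filter_le _ _).trans_eq (Finset.card_range n)
    have h11 : s₅.reg 11 = ((Finset.range n).filter fun p => s.mem 6 0 p ≠ 0 ∧ R p).card := by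
      rw [hF₅.reg 11 rfl, State.reg_setReg, if_pos rfl, c₄.zero, h10, add_zero]
      exact Nat.mod_eq_of_lt (hcl.trans_lt hnb)
    have e22₅ : s₅.reg 22 = m := by
      rw [hF₅.reg 22 rfl, State.reg_setReg, if_neg (by omega), hF₄.reg 22 rfl, e22]
    have e23₅ : s₅.reg 23 ≠ 0 := by
      rwa [hF₅.reg 23 rfl, State.reg_setReg, if_neg (by omega), hF₄.reg 23 rfl]
    have htE : (s₂.reg 26 * (7 * l + 14) + 14 * l + 19) * m ≤ (L * (7 * l + 14) + 14 * l + 19) * m := by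
      gcongr
    have htt : ∀ x ≤ 16 * n + 18, t₁ + (t₂ + (t₃ + (t₄ + (1 + (t₅ + x)) + 1))) ≤
        n * (20 * d + 64) + (13 * n + 10) * L + 60 + 2 * (L * (7 * l + 14) + 14 * l + 19) * m := by
      intro x hx
      rw [mul_add n (20 * d), mul_assoc 2]
      rw [mul_add n (11 * d)] at ht₃
      rw [mul_add n (9 * d)] at ht₂
      have : n * (20 * d) = n * (11 * d) + n * (9 * d) := by ring
      omega
    rw [runs_seq, runs_eq hb, runs_ite]
    by_cases hcard : ((Finset.range n).filter fun p => s.mem 7 0 p ≠ 0 ∧ R' p).card =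
        ((Finset.range n).filter fun p => s.mem 6 0 p ≠ 0 ∧ R p).card
    · rw [h10', h11, if_pos hcard, if_neg (by simp)]
      refine (runs_shrink P (c₅.setReg 36 _) (m := m) (by simpa [h6₅, h7₅] using h)
        (by simp [e22₅]) (k := ((Finset.range n).filter fun p => s.mem 6 0 p ≠ 0 ∧ R p).card)
        (by rw [State.reg_setReg, if_neg (by omega), h10']; exact hcard) hR ?_ ?_ ?_ ?_ ?_ ?_).framed ?_
      · intro p hp h0
        simp only [State.mem_setReg, h6₅, h8₅] at h0 ⊢
        exact hV p hp h0
      · intro p hp h0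
        simp only [State.mem_setReg, h7₅] at h0 ⊢
        exact hV' p hp h0
      · simp only [State.mem_setReg, h6₅]
      · simp only [State.mem_setReg, h7₅]
        exact hcard
      -- The root `x` satisfies the relation, so `1 ≤ k`.
      · exact Finset.card_pos.2 ⟨s₁.reg 20, by simpa using ⟨hx, hxS, hRx⟩⟩
      -- The root `y` violates it, so `k < m`.
      · rw [← hcard]
        refine (Finset.card_lt_card ?_).trans_eq h.card_right
        refine Finset.ssubset_iff_of_subset ?_ |>.2 ⟨s₁.reg 21, by simpa using ⟨hy, hyS⟩, ?_⟩
        · intro p hp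
          rw [Finset.mem_filter] at hp ⊢
          exact ⟨hp.1, hp.2.1⟩
        · rw [Finset.mem_filter]
          exact fun h' => hRy h'.2.2
      · intro t₆ s₆ ⟨ht₆, h22, hC⟩ hF₆
        refine ⟨htt _ (by omega), .inr (.inr ⟨?_, h22, hC⟩)⟩
        rw [hF₆.reg 23 rfl, State.reg_setReg, if_neg (by omega)]
        exact e23₅
    · rw [h10', h11, if_neg hcard, if_pos (by simp)]
      rw [runs_seq, runs_const, runs_const]
      refine ⟨htt _ (by omega), .inr (.inl ⟨by simp, by simp, ?_⟩)⟩
      rintro ⟨τ, hτ⟩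
      exact hcard ((h.matching_and hR).card_eq hA hB P.n_pos hτ).symm

end WordRAM

theorem SimConj.numCycles_eq {n d : ℕ} {σ ρ : Fin d → Equiv.Perm (Fin n)} (h : SimConj σ ρ)
    (j : Fin d) : numCycles (σ j) = numCycles (ρ j) := by
  obtain ⟨τ, hτ⟩ := h
  have : IsConj (σ j) (ρ j) := isConj_iff.2 ⟨τ⁻¹, by rw [hτ j, inv_inv]⟩
  rw [numCycles, numCycles, Equiv.Perm.partition_eq_of_isConj.1 this]

/-! ### The complete program and the sum of its running times -/

namespace WordRAM

/-- Make all points candidates. -/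
def initCandidates : Cmd :=
  .for 40 0 (.store 6 3 40 2 ⨟ .store 7 3 40 2) ⨟ .op .add 22 0 3 ⨟ .const 23 1

/-- The test for simultaneous conjugacy. -/
def simConjTest : Cmd :=
  setup ⨟ select ⨟
  .ite 8 (.op .add 7 9 3 ⨟ cycleCounts ⨟ initCandidates ⨟ .loop 23 round) (.op .eq 24 1 3) ⨟
  .op .add 0 24 3

variable {b r n d l : ℕ} {s : State} {A B : ℕ → ℕ → ℕ}

theorem runs_initCandidates (P : Params b r n d l) (c : Ctx b n d l s) :
    Runs b r n initCandidates s fun t s' => t ≤ 5 * n + 5 ∧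
      Candidates n d A B (s'.mem 6 0) (s'.mem 7 0) n ∧ s'.reg 22 = n ∧ s'.reg 23 ≠ 0 := by
  have hr := P.r_pos
  have hnb := P.n_lt
  have hb1 : 1 % 2 ^ b = 1 := Nat.mod_eq_of_lt P.one_lt
  have hb2 : n % 2 ^ b = n := Nat.mod_eq_of_lt hnb
  rw [initCandidates, runs_seq]
  refine runs_for P.one_lt (fun k t s₁ => t ≤ 5 * k ∧
    ∀ p < k, s₁.mem 6 0 p ≠ 0 ∧ s₁.mem 7 0 p ≠ 0) c.n hnb c.one rfl (by decide)
    (fun v => by simp) ?_ ?_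
  · intro k t s₁ hk ⟨ht, hI⟩ h40 hF
    have c₁ := c.of_frame hF
    simp only [runs_seq, runs_store]
    norm_num [c₁.zero, c₁.one, h40, hr, hk]
    refine ⟨by omega, fun p hp => ?_⟩
    by_cases hpk : p = k
    · simp [hpk]
    · simpa [hpk] using hI p (lt_of_le_of_ne hp hpk)
  · intro t s' ⟨ht, hI⟩ hF
    have c' := c.of_frame hF
    have hC : Candidates n d A B (s'.mem 6 0) (s'.mem 7 0) n := by
      refine ⟨?_, ?_, P.n_pos, fun τ hτ p hp => iff_of_true (hI p hp).1 (hI _ (hτ.lt p hp)).2⟩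
      · rw [Finset.filter_true_of_mem fun p hp => (hI p (Finset.mem_range.1 hp)).1,
          Finset.card_range]
      · rw [Finset.filter_true_of_mem fun p hp => (hI p (Finset.mem_range.1 hp)).2,
          Finset.card_range]
    rw [runs_seq, runs_add, runs_const, c'.n, c'.zero]
    exact ⟨by omega, hC, by simp [hb2], by simp [hb1]⟩

/-- The search cost is paid at most `Nat.log 2 m + 1` times. The evaluation cost `2 * E * m` of a
round at least halves each time, so these costs sum to at most `4 * E * m`. -/
theorem runs_rounds (P : Params b r n d l) {J L : ℕ}
    (hA : PermSystem n d A) (hB : PermSystem n d B) (hJ : J < d)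
    (hL : (cycleMins n (A J)).card = L) (m : ℕ) : ∀ s : State, Ctx b n d l s → Data n l J A B s →
    Candidates n d A B (s.mem 6 0) (s.mem 7 0) m → s.reg 22 = m → s.reg 23 ≠ 0 →
    Runs b r n (.loop 23 round) s fun t s' =>
      t ≤ (n * (20 * d + 64) + (13 * n + 10) * L + 62) * (Nat.log 2 m + 1) +
        4 * (L * (7 * l + 14) + 14 * l + 19) * m ∧
      (s'.reg 24 = 1 ∧ (∃ τ, IsEquivariant n d A B τ) ∨
        s'.reg 24 = 0 ∧ ¬ ∃ τ, IsEquivariant n d A B τ) := by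
  induction m using Nat.strong_induction_on with
  | _ m ih =>
    intro s c D h hm hgo
    rw [runs_loop, if_neg hgo]
    refine (runs_round P c D hA hB hJ hL h hm hgo).framed ?_
    intro t s₁ ⟨ht, hcase⟩ hF
    have c₁ := c.of_frame hF
    have D₁ := D.of_frame hF
    have hm1 := h.pos
    generalize n * (20 * d + 64) + (13 * n + 10) * L = K at ht ih ⊢
    generalize L * (7 * l + 14) + 14 * l + 19 = E at ht ih ⊢
    have hend : t + 1 + 1 ≤ (K + 62) * (Nat.log 2 m + 1) + 4 * E * m := by
      have h1 : K + 62 ≤ (K + 62) * (Nat.log 2 m + 1) := Nat.le_mul_of_pos_right _ (by omega)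
      have h2 : 2 * E * m ≤ 4 * E * m := by gcongr; omega
      omega
    rcases hcase with ⟨h23, h24, hτ⟩ | ⟨h23, h24, hτ⟩ | ⟨h23, h22, hC⟩
    · rw [runs_loop, if_pos h23]
      exact ⟨hend, .inl ⟨h24, hτ⟩⟩
    · rw [runs_loop, if_pos h23]
      exact ⟨hend, .inr ⟨h24, hτ⟩⟩
    · have hpos := hC.pos
      refine (ih (s₁.reg 22) (by omega) s₁ c₁ D₁ hC rfl h23).mono ?_
      intro t' s' ⟨ht', h'⟩
      refine ⟨?_, h'⟩
      have hlog : Nat.log 2 (s₁.reg 22) + 1 ≤ Nat.log 2 m := by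
        rw [Nat.log_of_one_lt_of_le (n := m) (by omega) (by omega)]
        exact Nat.succ_le_succ (Nat.log_mono_right (by omega))
      have h1 : (K + 62) * (Nat.log 2 (s₁.reg 22) + 1) ≤ (K + 62) * Nat.log 2 m :=
        Nat.mul_le_mul_left _ hlog
      -- With `m'` candidates left, `2 * E * m + 4 * E * m' ≤ 4 * E * m` because `2 * m' ≤ m`.
      have h2 : 2 * E * (2 * s₁.reg 22) ≤ 2 * E * m := Nat.mul_le_mul_left _ h22
      have h3 : 2 * E * (2 * s₁.reg 22) = 4 * E * s₁.reg 22 := by ring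
      have h4 : 4 * E * m = 2 * E * m + 2 * E * m := by ring
      rw [mul_add (K + 62)]
      omega

theorem time_le {n d l L : ℕ} (hn : 1 ≤ n) (hd : 1 ≤ d) (hl : 1 ≤ l) (hL : 1 ≤ L) :
    (3 * l + 6) + (d * (2 * ((l + 1) * (11 * n + 7) + 6 * n + 4) + 12) + 4) +
      (2 * ((l + 1) * (11 * n + 7) + 6 * n + 4)) + (5 * n + 5) +
      ((n * (20 * d + 64) + (13 * n + 10) * L + 62) * l +
        4 * (L * (7 * l + 14) + 14 * l + 19) * n) + 10 ≤ 1000 * ((d + L) * n * l) := by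
  -- After shifting every variable by one, both sides expand to polynomials with natural
  -- coefficients, and the bound follows from a linear comparison of monomials.
  obtain ⟨n, rfl⟩ := Nat.exists_eq_add_of_le' hn
  obtain ⟨d, rfl⟩ := Nat.exists_eq_add_of_le' hd
  obtain ⟨l, rfl⟩ := Nat.exists_eq_add_of_le' hl
  obtain ⟨L, rfl⟩ := Nat.exists_eq_add_of_le' hL
  ring_nf
  omega

end WordRAM

/-! ### Correctness, time and space of the test -/

namespace WordRAM

theorem runs_simConjTest {n d b : ℕ} {σ ρ : Fin d → Equiv.Perm (Fin n)} (hn : 1 ≤ n)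
    (hnb : n < 2 ^ b) (hdb : d < 2 ^ b) (hσ : GeneratesTransitive σ) (hρ : GeneratesTransitive ρ) :
    Runs b (d + Nat.log 2 n + 2) n simConjTest (inputState σ ρ) fun t s' =>
      (SimConj σ ρ → s'.reg 0 = 1) ∧ (¬ SimConj σ ρ → s'.reg 0 = 0) ∧
      ∀ L : ℕ, IsLeast {m : ℕ | ∃ j : Fin d, numCycles (σ j) = m ∧ numCycles (ρ j) = m} L →
        t ≤ 1000 * ((d + L) * n * (Nat.log 2 n + 1)) := by
  have hb : 1 < 2 ^ b := by omega
  have hb1 : 1 % 2 ^ b = 1 := Nat.mod_eq_of_lt hb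
  -- The doubling tables have rows `0` to `Nat.log 2 n + 1`, which requires `Nat.log 2 n + 2` rows;
  -- the input tables require `d`.
  have P : Params b (d + Nat.log 2 n + 2) n d (Nat.log 2 n + 1) :=
    ⟨hb, hnb, hdb, (Nat.succ_le_of_lt (Nat.log_lt_self 2 (by omega))).trans_lt hnb, by omega,
      by omega, hn, by omega, Nat.lt_pow_succ_log_self one_lt_two n⟩
  have hA := permSystem_permTable hσ
  have hB := permSystem_permTable hρ
  have hcA := card_cycleMins σ
  have hcB := card_cycleMins ρ
  have hconj := simConj_iff hn hσ hρ
  have e0 : (inputState σ ρ).mem 0 = permTable σ := rfl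
  have e1 : (inputState σ ρ).mem 1 = permTable ρ := rfl
  generalize permTable σ = A at *
  generalize permTable ρ = B at *
  generalize hl : Nat.log 2 n + 1 = l at *
  rw [simConjTest, runs_seq]
  refine (runs_setup (d := d) (r := d + Nat.log 2 n + 2) hb hn hnb rfl rfl).mono ?_
  rw [hl]
  intro t₁ s₁ ⟨ht₁, hm₁, c₁⟩
  rw [← hm₁] at e0 e1
  rw [runs_seq]
  refine (runs_select P c₁ e0 e1 hA.perm hB.perm).framed ?_
  intro t₂ s₂ ⟨ht₂, hS⟩ hF₂
  have c₂ := c₁.of_frame hF₂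
  have e0₂ := (hF₂.mem 0 rfl).trans e0
  have e1₂ := (hF₂.mem 1 rfl).trans e1
  rw [runs_seq, runs_ite]
  by_cases h8 : s₂.reg 8 = 0
  · rw [if_pos h8, runs_eq hb, runs_add]
    simp only [State.reg_setReg, c₂.zero, c₂.d, reduceIte, Nat.reduceEqDiff, add_zero]
    -- Nothing was selected, so all cycle counts differ and the tuples are conjugate only if `d =
    -- 0`, which is what the program tests. The time bound is vacuous here.
    have hne : ∀ j : Fin d, numCycles (σ j) ≠ numCycles (ρ j) := by
      intro j
      rw [← hcA, ← hcB]
      exact hS.none h8 j j.2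
    refine ⟨fun h => ?_, fun h => ?_, fun L hL => ?_⟩
    · have hd : d = 0 := by
        by_contra hd
        exact hne ⟨0, by omega⟩ (h.numCycles_eq _)
      simp [hd, hb1]
    · have hd : d ≠ 0 := by
        rintro rfl
        exact h ⟨1, fun j => j.elim0⟩
      simp [hd]
    · obtain ⟨j, e, e'⟩ := hL.1
      exact absurd (e.trans e'.symm) (hne j)
  · have hJd := hS.lt h8
    have hJb : s₂.reg 9 % 2 ^ b = s₂.reg 9 := Nat.mod_eq_of_lt (by omega)
    have hleft := hS.left h8
    have hleast : ∀ L, IsLeast {m | ∃ j : Fin d, numCycles (σ j) = m ∧ numCycles (ρ j) = m} L →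
        L = s₂.reg 8 := by
      intro L hL
      refine le_antisymm (hL.2 ⟨⟨_, hJd⟩, ?_, ?_⟩) ?_
      · rw [← hcA]; exact hleft
      · rw [← hcB]; exact hS.right h8
      · obtain ⟨j, e, e'⟩ := hL.1
        rw [← hcA] at e
        rw [← hcB] at e'
        exact (hS.le h8 j j.2 (e.trans e'.symm)).trans_eq e
    rw [if_neg h8, runs_seq, runs_add, c₂.zero, add_zero, hJb]
    generalize hJ : s₂.reg 9 = J at *
    generalize hL : s₂.reg 8 = L at *
    have c₃ := c₂.setReg 7 J
    rw [runs_seq]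
    refine (runs_cycleCounts P c₃ (J := J) (by simp) (by omega) e0₂ e1₂ (hA.perm J hJd)
      (hB.perm J hJd)).framed ?_
    intro t₄ s₄ ⟨ht₄, _, _, hpow⟩ hF₄
    have c₄ := c₃.of_frame hF₄
    have D₄ : Data n l J A B s₄ := ⟨(hF₄.mem 0 rfl).trans e0₂, (hF₄.mem 1 rfl).trans e1₂,
      fun i hi p hp => (hpow i hi p hp).1, fun i hi p hp => (hpow i hi p hp).2⟩
    rw [runs_seq]
    refine (runs_initCandidates (A := A) (B := B) P c₄).framed ?_
    intro t₅ s₅ ⟨ht₅, hC, h22, h23⟩ hF₅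
    refine (runs_rounds P hA hB hJd hleft n s₅ (c₄.of_frame hF₅) (D₄.of_frame hF₅) hC h22
      h23).framed ?_
    intro t₆ s₆ ⟨ht₆, hans⟩ hF₆
    have c₆ := (c₄.of_frame hF₅).of_frame hF₆
    rw [runs_add, State.reg_setReg, if_pos rfl, c₆.zero, add_zero, hconj]
    refine ⟨fun h => ?_, fun h => ?_, fun L' hL' => ?_⟩
    · rcases hans with ⟨h24, -⟩ | ⟨-, hno⟩
      · rw [h24, hb1]
      · exact absurd h hno
    · rcases hans with ⟨-, hyes⟩ | ⟨h24, -⟩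
      · exact absurd hyes h
      · rw [h24, Nat.zero_mod]
    · rw [hleast L' hL']
      have := time_le hn (by omega : 1 ≤ d) P.l_pos (by omega : 1 ≤ L)
      rw [hl] at ht₆
      omega

/-- The two extra rows are absorbed because `d + k ≥ 1`. -/
theorem space_le (p : Cmd) {n d : ℕ} (hn : 1 ≤ n) (hd : 1 ≤ d) (k : ℕ) :
    space p (fun _ => d + k + 2) (fun _ => n) ≤
      (p.regs.card + 3 * p.segments.card) * ((d + k) * n) := by
  rw [space, Finset.sum_const, smul_eq_mul, add_mul p.regs.card]
  have h1 : 1 ≤ (d + k) * n := Nat.mul_pos (by omega) hn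
  have h2 : (d + k + 2) * n ≤ 3 * ((d + k) * n) := by
    rw [← mul_assoc]
    exact Nat.mul_le_mul_right _ (by omega)
  refine add_le_add (Nat.le_mul_of_pos_right _ h1) ?_
  rw [mul_comm 3, mul_assoc]
  exact Nat.mul_le_mul_left _ h2

end WordRAM

theorem theorem2 :
    ∃ (P : WordRAM.Cmd) (C : ℕ),
      ∀ (n d b : ℕ) (σ ρ : Fin d → Equiv.Perm (Fin n)),
        1 ≤ n → n < 2 ^ b → d < 2 ^ b →
        GeneratesTransitive σ → GeneratesTransitive ρ →
        ∃ (t : ℕ) (R K : ℕ → ℕ) (s : WordRAM.State),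
          WordRAM.Exec b R K P (inputState σ ρ) t s ∧
          (SimConj σ ρ → s.reg 0 = 1) ∧
          (¬ SimConj σ ρ → s.reg 0 = 0) ∧
          ∀ l : ℕ, IsLeast {m : ℕ | ∃ j : Fin d, numCycles (σ j) = m ∧ numCycles (ρ j) = m} l →
            t ≤ C * ((d + l) * n * (Nat.log 2 n + 1)) ∧
            WordRAM.space P R K ≤ C * ((d + Nat.log 2 n) * n) := by
  -- One constant for both bounds: `1000` serves the time, the other summands the space.
  refine ⟨WordRAM.simConjTest, 1000 + (WordRAM.simConjTest.regs.card +
    3 * WordRAM.simConjTest.segments.card), ?_⟩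
  intro n d b σ ρ hn hnb hdb hσ hρ
  obtain ⟨t, s, he, hyes, hno, ht⟩ := WordRAM.runs_simConjTest hn hnb hdb hσ hρ
  refine ⟨t, _, _, s, he, hyes, hno, fun l hl => ⟨?_, ?_⟩⟩
  · exact (ht l hl).trans (Nat.mul_le_mul_right _ (by omega))
  -- An index with equal counts exists, which forces `d ≥ 1`.
  · obtain ⟨j, -⟩ := hl.1
    exact (WordRAM.space_le _ hn (Nat.one_le_of_lt j.2) _).trans (Nat.mul_le_mul_right _ (by omega))
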